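/- **Conventions.** All graphs are finite and simple. A graph $G$ is *$H$-free* if no induced subgraph of $G$ is isomorphic to $H$; $2P_3$ is the disjoint union of two three-vertex paths, and $C_k$ is the cycle on $k$ vertices. A *clique* is a (possibly empty) set of pairwise adjacent vertices. For disjoint vertex sets $X,Y$, $X$ is *complete* (resp. *anticomplete*) to $Y$ if every vertex of $X$ is adjacent (resp. nonadjacent) to every vertex of $Y$. A vertex is *simplicial* if its neighbors form a (possibly empty) clique. An *anticomponent* of $G$ is a maximal induced subgraph of $G$ whose complement is connected; it is *nontrivial* if it has at least two vertices. The sets of a partition may be empty unless stated otherwise. $N_Q(v)$ is the set of neighbors of $v$ in $Q$. **The 3-pentagon** has vertices $a,b_1,b_2,b_3,c_1,c_2,c_3$ and edges $ab_i$, $b_ic_i$ (for $i=1,2,3$) and $c_1c_2,c_1c_3,c_2c_3$. **$T_0$** is the nine-vertex graph obtained from the 3-pentagon by adding two vertices $x,y$ and the edges $xa,\ xb_1,\ xy,\ yc_2,\ yc_3$. **5-basket**: a graph $Q$ whose vertex set can be partitioned into cliques $A,B_1,B_2,B_3,C_1,C_2,C_3,F$, all nonempty except possibly $F$, such that: $B_1,B_2,B_3$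 are pairwise anticomplete; $C_1,C_2,C_3$ are pairwise complete; $A$ is anticomplete to each $C_i$; $B_i$ is complete to $C_i$ and anticomplete to $C_j$ for $j\neq i$; for some $i^*\in\{1,2,3\}$, $A$ is complete to $B_i$ for all $i\ne i^*$, and $A$ can be ordered as $a_1,\dots,a_s$ so that $N_Q(a_s)\cap B_{i^*}\subseteq\dots\subseteq N_Q(a_1)\cap B_{i^*}=B_{i^*}$; and for some $j^*\in\{1,2,3\}$, $F$ is anticomplete to $B_{j^*}\cup C_{j^*}$ and complete to $A$ and to $B_j\cup C_j$ for all $j\neq j^*$. **$t$-villa** ($t\ge 3$ an integer): a graph $Q$ whose vertex set can be partitioned into nonempty cliques $A,B_1,\dots,B_t,C_1,\dots,C_t$ such that: $A$ is complete to each $B_i$ and anticomplete to each $C_i$; the $B_i$ are pairwise anticomplete; the $C_i$ are pairwise complete; $B_i$ is anticomplete to $C_j$ for $i\neq j$; and each $B_i$ can be ordered as $b_1,\dots,b_r$ so that $\emptyset\neq N_Q(b_r)\cap C_i\subseteq\dots\subseteq N_Q(b_1)\cap C_i=C_i$. Then $(A;B_1,\dots,B_t;C_1,\dots,C_t)$ is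 called a $t$-villa partition of $Q$. A **villa** is a $t$-villa for some $t\geq 3$. **$t$-mansion** ($t\ge 3$ an integer): a graph $Q$ whose vertex set can be partitioned into cliques $A,B_1,\dots,B_t,C_1,\dots,C_t,F,X,Y$, all nonempty except possibly $X$ and $Y$, such that: $(A;B_1,\dots,B_t;C_1,\dots,C_t)$ is a $t$-villa partition of $Q\setminus(F\cup X\cup Y)$; for some $j^*\in\{1,\dots,t\}$, $F$ is complete to $A$ and to $B_j\cup C_j$ for all $j\ne j^*$ and anticomplete to $B_{j^*}\cup C_{j^*}$, $B_{j^*}$ is complete to $C_{j^*}$, and $X$ is complete to $A\cup B_{j^*}$, anticomplete to $B_j$ for all $j\neq j^*$, and anticomplete to every $C_j$; $F$ is complete to $X\cup Y$; $X$ is anticomplete to $Y$; and $Y$ is complete to every $C_j$ and anticomplete to $A$ and to every $B_j$. A **mansion** is a $t$-mansion for some $t\ge 3$. **Theorem.** For any graph $G$, the following are equivalent: (a) $G$ is $(2P_3,C_4,C_6,C_7,T_0)$-free, contains an induced 3-pentagon, and contains no simplicial vertices; (b) $G$ contains exactly one nontrivial anticomponent, and this anticomponent is a 5-basket, a villa,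 or a mansion; (c) $G$ can be obtained from a 5-basket, a villa, or a mansion by possibly adding universal vertices to it; that is, some induced subgraph $Q$ of $G$ is a 5-basket, a villa, or a mansion, and $V(G)\setminus V(Q)$ is a (possibly empty) clique of $G$ that is complete to $V(Q)$. -/

import Mathlib

/-! All vertex sets below are sets of vertices of a fixed simple graph `G`. -/

namespace SimpleGraph

/-- `G` is `H`-free: no induced subgraph of `G` is isomorphic to `H`. -/
def IndFree {V W : Type*} (H : SimpleGraph W) (G : SimpleGraph V) : Prop :=
  ¬ H.IsIndContained G

/-- The graph `2P₃`: the disjoint union of two copies of the path on three vertices. -/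
def twoP3 : SimpleGraph (Fin 3 ⊕ Fin 3) :=
  (pathGraph 3).sum (pathGraph 3)

/-- The `t`-pentagon: `inl ()` is the vertex `a`, `inr (inl i)` is `b i`, and `inr (inr i)` is
`c i`. The vertex `a` is adjacent to exactly the `b i`, the `b i` form a stable set, the `c i`
form a clique, and `b i` is adjacent to `c j` if and only if `i = j`. -/
def pentagon (t : ℕ) : SimpleGraph (Unit ⊕ (Fin t ⊕ Fin t)) where
  Adj
    | .inl _, .inr (.inl _) => True
    | .inr (.inl _), .inl _ => True
    | .inr (.inl i), .inr (.inr j) => i = j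
    | .inr (.inr i), .inr (.inl j) => i = j
    | .inr (.inr i), .inr (.inr j) => i ≠ j
    | _, _ => False
  symm := ⟨by
    rintro (_ | _ | i) (_ | _ | j) h
    all_goals first
      | exact h
      | exact Eq.symm h
      | exact Ne.symm h⟩
  loopless := ⟨by
    rintro (_ | _ | i) h
    · exact h
    · exact h
    · exact h rfl⟩

/-- The nine-vertex graph `T₀`. The vertices `0; 1, 2, 3; 4, 5, 6` are the vertices
`a; b₁, b₂, b₃; c₁, c₂, c₃` of an induced 3-pentagon. The vertex `7` is adjacent to exactly
`a`, `b₁` and `8`, and the vertex `8` is adjacent to exactly `c₂`, `c₃` and `7`. -/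
def T0 : SimpleGraph (Fin 9) :=
  fromEdgeSet
    {s(0, 1), s(0, 2), s(0, 3), s(1, 4), s(2, 5), s(3, 6), s(4, 5), s(4, 6), s(5, 6),
      s(7, 0), s(7, 1), s(7, 8), s(8, 5), s(8, 6)}

/-- `v` is a simplicial vertex of `G`: its neighbours form a (possibly empty) clique. -/
def IsSimplicialVertex {V : Type*} (G : SimpleGraph V) (v : V) : Prop :=
  G.IsClique (G.neighborSet v)

/-- Every vertex of `X` is adjacent to every vertex of `Y`. -/
def CompleteTo {V : Type*} (G : SimpleGraph V) (X Y : Set V) : Prop :=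
  ∀ x ∈ X, ∀ y ∈ Y, G.Adj x y

/-- Every vertex of `X` is nonadjacent to every vertex of `Y`. -/
def AnticompleteTo {V : Type*} (G : SimpleGraph V) (X Y : Set V) : Prop :=
  ∀ x ∈ X, ∀ y ∈ Y, ¬ G.Adj x y

/-- The sets `P i` are pairwise disjoint with union `S`; some of them may be empty. -/
def IsPartitionOf {V ι : Type*} (S : Set V) (P : ι → Set V) : Prop :=
  Pairwise (fun i j => Disjoint (P i) (P j)) ∧ ⋃ i, P i = S

/-- The sequence `x 0, …, x n` is an ordering (without repetition) of the set `X` such that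
`N(x n) ∩ Y ⊆ ⋯ ⊆ N(x 0) ∩ Y = Y`. -/
def IsNestedOrdering {V : Type*} (G : SimpleGraph V) (X Y : Set V) {n : ℕ}
    (x : Fin (n + 1) → V) : Prop :=
  Function.Injective x ∧ Set.range x = X ∧
    Antitone (fun k => G.neighborSet (x k) ∩ Y) ∧ G.neighborSet (x 0) ∩ Y = Y

/-- `(A; B₁, B₂, B₃; C₁, C₂, C₃; F)` is a 5-basket partition of `G`. -/
structure IsFiveBasketPartition {V : Type*} (G : SimpleGraph V)
    (A : Set V) (B C : Fin 3 → Set V) (F : Set V) : Prop where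
  partition : IsPartitionOf Set.univ (Sum.elim ![A, F] (Sum.elim B C))
  nonempty_A : A.Nonempty
  nonempty_B : ∀ i, (B i).Nonempty
  nonempty_C : ∀ i, (C i).Nonempty
  clique_A : G.IsClique A
  clique_B : ∀ i, G.IsClique (B i)
  clique_C : ∀ i, G.IsClique (C i)
  clique_F : G.IsClique F
  B_anticomplete_B : ∀ i j, i ≠ j → G.AnticompleteTo (B i) (B j)
  C_complete_C : ∀ i j, i ≠ j → G.CompleteTo (C i) (C j)
  exists_i : ∃ i₀ : Fin 3,
    (∀ i, i ≠ i₀ → G.CompleteTo A (B i)) ∧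
    ∃ (n : ℕ) (a : Fin (n + 1) → V), G.IsNestedOrdering A (B i₀) a
  A_anticomplete_C : ∀ i, G.AnticompleteTo A (C i)
  B_complete_C : ∀ i, G.CompleteTo (B i) (C i)
  B_anticomplete_C : ∀ i j, i ≠ j → G.AnticompleteTo (B i) (C j)
  exists_j : ∃ j₀ : Fin 3,
    G.CompleteTo F A ∧
    (∀ i, i ≠ j₀ → G.CompleteTo F (B i) ∧ G.CompleteTo F (C i)) ∧
    G.AnticompleteTo F (B j₀) ∧ G.AnticompleteTo F (C j₀)

/-- `G` is a 5-basket. -/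
def IsFiveBasket {V : Type*} (G : SimpleGraph V) : Prop :=
  ∃ (A : Set V) (B C : Fin 3 → Set V) (F : Set V), G.IsFiveBasketPartition A B C F

/-- `(A; B₁, …, B_t; C₁, …, C_t)` is a `t`-villa partition of the subgraph of `G` induced by the
vertex set `S`, where `t ≥ 3`. -/
structure IsVillaPartitionOn {V : Type*} (G : SimpleGraph V) (S : Set V) (t : ℕ)
    (A : Set V) (B C : Fin t → Set V) : Prop where
  three_le : 3 ≤ t
  partition : IsPartitionOf S (Sum.elim ![A] (Sum.elim B C))
  nonempty_A : A.Nonempty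
  nonempty_B : ∀ i, (B i).Nonempty
  nonempty_C : ∀ i, (C i).Nonempty
  clique_A : G.IsClique A
  clique_B : ∀ i, G.IsClique (B i)
  clique_C : ∀ i, G.IsClique (C i)
  A_complete_B : ∀ i, G.CompleteTo A (B i)
  A_anticomplete_C : ∀ i, G.AnticompleteTo A (C i)
  B_anticomplete_B : ∀ i j, i ≠ j → G.AnticompleteTo (B i) (B j)
  C_complete_C : ∀ i j, i ≠ j → G.CompleteTo (C i) (C j)
  B_anticomplete_C : ∀ i j, i ≠ j → G.AnticompleteTo (B i) (C j)
  nested : ∀ i, ∃ (n : ℕ) (b : Fin (n + 1) → V), G.IsNestedOrdering (B i) (C i) b ∧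
    (G.neighborSet (b (Fin.last n)) ∩ C i).Nonempty

/-- `G` is a villa, that is, a `t`-villa for some `t ≥ 3`. -/
def IsVilla {V : Type*} (G : SimpleGraph V) : Prop :=
  ∃ (t : ℕ) (A : Set V) (B C : Fin t → Set V), G.IsVillaPartitionOn Set.univ t A B C

/-- `(A; B₁, …, B_t; C₁, …, C_t; F; X; Y)` is a `t`-mansion partition of `G`, where `t ≥ 3`
(the inequality is part of `villa`). -/
structure IsMansionPartition {V : Type*} (G : SimpleGraph V) (t : ℕ)
    (A : Set V) (B C : Fin t → Set V) (F X Y : Set V) : Prop where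
  partition : IsPartitionOf Set.univ (Sum.elim ![A, F, X, Y] (Sum.elim B C))
  villa : G.IsVillaPartitionOn (F ∪ X ∪ Y)ᶜ t A B C
  nonempty_F : F.Nonempty
  clique_F : G.IsClique F
  clique_X : G.IsClique X
  clique_Y : G.IsClique Y
  exists_j : ∃ j₀ : Fin t,
    G.CompleteTo F A ∧
    (∀ i, i ≠ j₀ → G.CompleteTo F (B i) ∧ G.CompleteTo F (C i)) ∧
    G.AnticompleteTo F (B j₀) ∧ G.AnticompleteTo F (C j₀) ∧
    G.CompleteTo (B j₀) (C j₀) ∧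
    G.CompleteTo X A ∧ G.CompleteTo X (B j₀) ∧
    (∀ i, i ≠ j₀ → G.AnticompleteTo X (B i)) ∧ (∀ i, G.AnticompleteTo X (C i))
  F_complete_X : G.CompleteTo F X
  F_complete_Y : G.CompleteTo F Y
  X_anticomplete_Y : G.AnticompleteTo X Y
  Y_complete_C : ∀ i, G.CompleteTo Y (C i)
  Y_anticomplete_A : G.AnticompleteTo Y A
  Y_anticomplete_B : ∀ i, G.AnticompleteTo Y (B i)

/-- `G` is a mansion, that is, a `t`-mansion for some `t ≥ 3`. -/
def IsMansion {V : Type*} (G : SimpleGraph V) : Prop :=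
  ∃ (t : ℕ) (A : Set V) (B C : Fin t → Set V) (F X Y : Set V),
    G.IsMansionPartition t A B C F X Y

/-- `S` is the vertex set of an anticomponent of `G`: a maximal set of vertices inducing a
subgraph whose complement is connected. -/
def IsAnticomponent {V : Type*} (G : SimpleGraph V) (S : Set V) : Prop :=
  Maximal (fun T : Set V => (G.induce T)ᶜ.Connected) S

/-- `G` is obtained from its subgraph induced by `S` by possibly adding universal vertices: the
vertices outside `S` form a (possibly empty) clique that is complete to `S`. -/
def IsObtainedByAddingUniversal {V : Type*} (G : SimpleGraph V) (S : Set V) : Prop :=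
  G.IsClique Sᶜ ∧ G.CompleteTo Sᶜ S

end SimpleGraph

/-! For (a) implies (c), discard the universal vertices and fix an induced 3-pentagon. The type of a
vertex is its closed neighbourhood in the pentagon, one of 2^7 codes. The pentagon together with
three attached vertices of prescribed types and mutual adjacencies is an explicit graph, so a
computation decides whether a forbidden pattern appears in it (`Pent.good`). This leaves 32 types
and settles most adjacencies between them.

What the forbidden subgraphs do not settle comes from the absence of simplicial vertices. Let `K` be
a nonempty set and `L` a clique such that two closed neighbours of a vertex of `K` can fail to be
equal or adjacent only if one is in `K` and the other in `L`. In a C4-free graph a vertex of `K`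
with fewest neighbours in `L` is then simplicial (`PatternFree.exists_isSimplicialVertex`, in terms
of types `Pent.elim`). Hence no such `K` exists. This removes further types and produces neighbours
that certain vertices must have.

If, for some 3-pentagon, a vertex is adjacent to `a` and exactly two of the `b i` and to no `c i`
(type `AA`), the types themselves are the parts of a 5-basket (`Pent.isFiveBasket_of_AA`). Otherwise
take a t-pentagon with t as large as possible. A question about three attached vertices involves at
most three indices, so it restricts to a 3-pentagon (`Pent.false_of_family`). Maximality excludes
the vertices attached to `a` alone, and the rest form a mansion if some vertex has type `F`, a villa
if none has (`Pent.isVilla_or_isMansion`).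

Conversely, in a basket, villa or mansion the parts of two vertices determine their adjacency,
except for the nested pairs of cliques. A finite search shows that a forbidden pattern could only be
a four-cycle inside such a pair, which nestedness excludes (`patternFree_of_somePattern`). For the
equivalence of (b) and (c), a C4-free graph without universal vertices has connected complement
(`connected_compl`). -/

namespace SimpleGraph

/-! ### Closed adjacency and forbidden patterns -/

/-- Closed adjacency: `x` and `y` are equal or adjacent. -/
def CAdj {V : Type*} (G : SimpleGraph V) (x y : V) : Prop := x = y ∨ G.Adj x y

section CAdj
variable {V : Type*} {G : SimpleGraph V} {x y : V}

theorem CAdj.refl (x : V) : G.CAdj x x := Or.inl rfl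

theorem CAdj.symm (h : G.CAdj x y) : G.CAdj y x := h.imp Eq.symm Adj.symm

theorem cadj_comm : G.CAdj x y ↔ G.CAdj y x := ⟨CAdj.symm, CAdj.symm⟩

theorem CAdj.adj (h : G.CAdj x y) (hne : x ≠ y) : G.Adj x y := h.resolve_left hne

theorem cadj_iff_of_ne (hne : x ≠ y) : G.CAdj x y ↔ G.Adj x y := ⟨fun h => h.adj hne, Or.inr⟩

theorem not_adj_of_not_cadj (h : ¬ G.CAdj x y) : ¬ G.Adj x y := fun h' => h (Or.inr h')

theorem ne_of_not_cadj (h : ¬ G.CAdj x y) : x ≠ y := fun h' => h (Or.inl h')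

end CAdj

/-- The entry `(i, j)` of a 0-1 matrix whose rows are given by the binary digits of natural
numbers. -/
def entry (H : List ℕ) (i j : ℕ) : Bool := (H.getD i 0).testBit j

/-- Some sequence of vertices of `G` has `H` as its matrix of closed adjacencies. -/
def Occurs {V : Type*} (G : SimpleGraph V) (H : List ℕ) : Prop :=
  ∃ f : ℕ → V, ∀ i < H.length, ∀ j < H.length, (G.CAdj (f i) (f j) ↔ entry H i j = true)

/-- Closed adjacency makes injectivity automatic: two indices sent to the same vertex would have
equal rows, and `htw` says that the rows of `H` are distinct. Hence no distinctness assumptions need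
to be carried through the searches. -/
theorem isIndContained_iff_occurs {V W : Type*} {K : SimpleGraph W} {G : SimpleGraph V}
    {n : ℕ} (H : List ℕ) (hn : H.length = n) (hW : 0 < n)
    (e : Fin n ≃ W)
    (he : ∀ i j : Fin n, entry H i j = true ↔ (i = j ∨ K.Adj (e i) (e j)))
    (htw : ∀ i j : Fin n, i ≠ j → ∃ k : Fin n, entry H i k ≠ entry H j k) :
    K.IsIndContained G ↔ G.Occurs H := by
  subst hn
  constructor
  · rintro ⟨g⟩
    -- Indices beyond the length of `H` play no role in `Occurs`; they are sent to the image of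
    -- index 0.
    refine ⟨fun i => g (e (if h : i < H.length then ⟨i, h⟩ else ⟨0, hW⟩)), fun i hi j hj => ?_⟩
    simp only [hi, hj, dif_pos, he ⟨i, hi⟩ ⟨j, hj⟩, CAdj, g.map_adj_iff, g.injective.eq_iff,
      e.injective.eq_iff]
  · rintro ⟨f, hf⟩
    have hinj : Function.Injective fun w : W => f (e.symm w) := by
      intro w w' h
      by_contra hne
      obtain ⟨k, hk⟩ := htw (e.symm w) (e.symm w') (fun h' => hne (e.symm.injective h'))
      apply hk
      rw [Bool.eq_iff_iff, ← hf _ (e.symm w).2 _ k.2, ← hf _ (e.symm w').2 _ k.2]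
      simp only at h
      rw [h]
    refine ⟨⟨⟨_, hinj⟩, ?_⟩⟩
    intro w w'
    change G.Adj (f (e.symm w)) (f (e.symm w')) ↔ _
    by_cases hww : w = w'
    · subst hww; simp
    · rw [← cadj_iff_of_ne (fun h => hww (hinj h)), hf _ (e.symm w).2 _ (e.symm w').2, he]
      simp [hww]

/-- The closed adjacency matrices of `C₄`, `2P₃`, `C₆`, `C₇` and `T₀`. -/
def patternC4 : List ℕ := [11, 7, 14, 13]
def patternTwoP3 : List ℕ := [3, 7, 6, 24, 56, 48]
def patternC6 : List ℕ := [35, 7, 14, 28, 56, 49]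
def patternC7 : List ℕ := [67, 7, 14, 28, 56, 112, 97]
def patternT0 : List ℕ := [143, 147, 37, 73, 114, 372, 376, 387, 480]

def patterns : List (List ℕ) := [patternC4, patternTwoP3, patternC6, patternC7, patternT0]

/-- No forbidden pattern occurs in `G`. -/
def PatternFree {V : Type*} (G : SimpleGraph V) : Prop := ∀ H ∈ patterns, ¬ G.Occurs H

theorem patternFree_iff {V : Type*} (G : SimpleGraph V) :
    G.PatternFree ↔ IndFree twoP3 G ∧ IndFree (cycleGraph 4) G ∧ IndFree (cycleGraph 6) G ∧
      IndFree (cycleGraph 7) G ∧ IndFree T0 G := by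
  have hs : ∀ u v : Fin 3 ⊕ Fin 3, entry patternTwoP3 (finSumFinEquiv u : Fin 6)
      (finSumFinEquiv v : Fin 6) = true ↔ (u = v ∨ twoP3.Adj u v) := by
    rintro (u | u) (v | v) <;>
      simp only [twoP3, SimpleGraph.sum, pathGraph_adj, Sum.inl.injEq, Sum.inr.injEq, reduceCtorEq,
        finSumFinEquiv_apply_left, finSumFinEquiv_apply_right] <;> revert u v <;> decide
  have h1 := isIndContained_iff_occurs (K := cycleGraph 4) (G := G) (n := 4) patternC4 rfl (by decide)
    (Equiv.refl _) (by
      change ∀ i j : Fin 4, _ ↔ (_ ∨ (cycleGraph 4).Adj i j); simp only [cycleGraph_adj]; decide)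
    (by decide)
  have h2 := isIndContained_iff_occurs (K := twoP3) (G := G) (n := 6) patternTwoP3 rfl (by decide)
    (finSumFinEquiv (m := 3) (n := 3)).symm (by
      intro i j
      have := hs (finSumFinEquiv.symm i) (finSumFinEquiv.symm j)
      simpa only [Equiv.apply_symm_apply, EmbeddingLike.apply_eq_iff_eq] using this) (by decide)
  have h3 := isIndContained_iff_occurs (K := cycleGraph 6) (G := G) (n := 6) patternC6 rfl (by decide)
    (Equiv.refl _) (by
      change ∀ i j : Fin 6, _ ↔ (_ ∨ (cycleGraph 6).Adj i j); simp only [cycleGraph_adj]; decide)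
    (by decide)
  have h4 := isIndContained_iff_occurs (K := cycleGraph 7) (G := G) (n := 7) patternC7 rfl (by decide)
    (Equiv.refl _) (by
      change ∀ i j : Fin 7, _ ↔ (_ ∨ (cycleGraph 7).Adj i j); simp only [cycleGraph_adj]; decide)
    (by decide)
  have h5 := isIndContained_iff_occurs (K := T0) (G := G) (n := 9) patternT0 rfl (by decide)
    (Equiv.refl _) (by
      change ∀ i j : Fin 9, _ ↔ (_ ∨ T0.Adj i j)
      simp only [T0, fromEdgeSet_adj, Set.mem_insert_iff, Set.mem_singleton_iff]
      decide +kernel)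
    (by decide +kernel)
  simp only [IndFree, PatternFree, patterns, List.mem_cons, List.not_mem_nil, or_false,
    forall_eq_or_imp, forall_eq, h1, h2, h3, h4, h5]
  tauto

/-! ### Backtracking search -/

section Search
variable {L : Type*}

/-- Backtracking search for labels `l` of the indices in a list such that `ok i (l i) j (l j)` for
any two of them, `l i` is in `cand i`, and the labels satisfy `leaf`. -/
def search (ok : ℕ → L → ℕ → L → Bool) (cand : ℕ → List L) (leaf : List (ℕ × L) → Bool) :
    List ℕ → List (ℕ × L) → Bool
  | [], acc => leaf acc
  | i :: is, acc => (cand i).any fun l =>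
      acc.all (fun p => ok i l p.1 p.2) && search ok cand leaf is ((i, l) :: acc)

/-- Completeness is the direction needed here: a search that returns `false` excludes every
labelling. The accumulator holds the treated indices with the latest first, whence `is.reverse ++
js`. -/
theorem search_of_exists {ok : ℕ → L → ℕ → L → Bool} {cand : ℕ → List L}
    {leaf : List (ℕ × L) → Bool} (g : ℕ → L) (hcand : ∀ i, g i ∈ cand i)
    (is js : List ℕ) (hnd : (is.reverse ++ js).Nodup)
    (hok : ∀ i ∈ is.reverse ++ js, ∀ j ∈ is.reverse ++ js, i ≠ j → ok i (g i) j (g j) = true)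
    (hleaf : leaf ((is.reverse ++ js).map fun i => (i, g i)) = true) :
    search ok cand leaf is (js.map fun i => (i, g i)) = true := by
  induction is generalizing js with
  | nil => simpa [search] using hleaf
  | cons i is ih =>
    simp only [search, List.any_eq_true, Bool.and_eq_true, List.all_eq_true]
    simp only [List.reverse_cons, List.append_assoc, List.singleton_append] at hnd hok hleaf
    refine ⟨g i, hcand i, ?_, by simpa using ih (i :: js) hnd hok hleaf⟩
    intro p hp
    obtain ⟨j, hj, rfl⟩ := List.mem_map.1 hp
    refine hok i (by simp) j (by simp [hj]) ?_
    rintro rfl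
    have := (List.nodup_append.1 hnd).2.1
    simp [hj] at this

end Search

/-! ### Pentagons and the types of vertices attached to them -/

/-- `(a; b i; c i)` induces a pentagon, indexed by `ι`, in `G`. -/
structure Pent {V : Type*} (G : SimpleGraph V) (ι : Type*) where
  a : V
  b : ι → V
  c : ι → V
  ab : ∀ i, G.CAdj a (b i)
  ac : ∀ i, ¬ G.CAdj a (c i)
  bb : ∀ i j, i ≠ j → ¬ G.CAdj (b i) (b j)
  cc : ∀ i j, G.CAdj (c i) (c j)
  bc : ∀ i, G.CAdj (b i) (c i)
  bc_ne : ∀ i j, i ≠ j → ¬ G.CAdj (b i) (c j)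

/-- The possible closed neighbourhoods of a vertex in a pentagon indexed by `ι`. -/
abbrev Code (ι : Type*) := Bool × (ι → Bool) × (ι → Bool)

namespace Code
variable {ι : Type*} [DecidableEq ι]
-- The letters anticipate the part that a vertex will belong to: types `A`, `B i` and `C i` are
-- those of the pentagon's own vertices, `F i` is the type of the vertices in `F`, and `U` that of a
-- vertex complete to the pentagon. Types `AA i` and `BC i` survive only in 5-baskets. In villas and
-- mansions, `AB i` is split between B and X, and `C0` between C and Y.
def O : Code ι := (false, fun _ => false, fun _ => false)
def Za : Code ι := (true, fun _ => false, fun _ => false)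
def Zb (i : ι) : Code ι := (false, fun j => decide (j = i), fun _ => false)
def AB (i : ι) : Code ι := (true, fun j => decide (j = i), fun _ => false)
def AA (i : ι) : Code ι := (true, fun j => decide (j ≠ i), fun _ => false)
def A : Code ι := (true, fun _ => true, fun _ => false)
def Zc (i : ι) : Code ι := (false, fun _ => false, fun j => decide (j = i))
def BC (i : ι) : Code ι := (false, fun j => decide (j = i), fun j => decide (j = i))
def B (i : ι) : Code ι := (true, fun j => decide (j = i), fun j => decide (j = i))
def CC (i : ι) : Code ι := (false, fun _ => false, fun j => decide (j ≠ i))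
def F (i : ι) : Code ι := (true, fun j => decide (j ≠ i), fun j => decide (j ≠ i))
def C0 : Code ι := (false, fun _ => false, fun _ => true)
def C (i : ι) : Code ι := (false, fun j => decide (j = i), fun _ => true)
def U : Code ι := (true, fun _ => true, fun _ => true)
end Code

/-- The type of a vertex with respect to a pentagon. -/
noncomputable def Pent.code {V ι : Type*} {G : SimpleGraph V} (P : Pent G ι) (v : V) : Code ι :=
  open Classical in
  (decide (G.CAdj v P.a), fun i => decide (G.CAdj v (P.b i)), fun i => decide (G.CAdj v (P.c i)))

/-! ### Searching a pentagon with three attached vertices for forbidden patterns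

The following functions are evaluated by the kernel, hence the explicit recursors. -/

/-- The number below `2 ^ n` with binary digits `f 0, …, f (n - 1)`. -/
noncomputable def ofDigits (f : ℕ → Bool) (n : ℕ) : ℕ :=
  Nat.rec (motive := fun _ => ℕ) 0 (fun n ih => Bool.rec ih (ih ||| 2 ^ n) (f n)) n

/-- Evaluate `n` to a literal before applying `k`. -/
noncomputable def force {α : Type} (n : ℕ) (k : ℕ → α) : α :=
  Nat.rec (motive := fun _ => α) (k 0) (fun n _ => k (n + 1)) n

/-- Whether `k v` holds for one of the largest `n` elements `v` of the set of binary digits `c`. -/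
noncomputable def anyDigit (k : ℕ → Bool) (n : ℕ) : ℕ → Bool :=
  Nat.rec (fun _ => false) (fun _ ih c =>
    Nat.rec (motive := fun _ => Bool) false
      (fun c _ => force (Nat.log2 (c + 1)) fun v =>
        Bool.rec (ih ((c + 1) ^^^ 2 ^ v)) true (k v)) c) n

/-- The elements `v` of `c` such that `(u, v)` is a digit of `N` or `K`, according to the entry of
`row`, for the corresponding entry `u` of a list. -/
noncomputable def candidates (N K : ℕ) (row : List Bool) : List ℕ → ℕ → ℕ :=
  List.rec (motive := fun _ => List ℕ → ℕ → ℕ) (fun _ c => c)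
    (fun b _ ih acc c => List.rec (motive := fun _ => ℕ) c
      (fun v vs _ => ih vs (c &&& (Bool.rec (K >>> (10 * v)) (N >>> (10 * v)) b))) acc) row

/-- Backtracking search for a sequence of vertices with given adjacencies. -/
noncomputable def place (N K : ℕ) (rows : List (List Bool)) : List ℕ → Bool :=
  List.rec (motive := fun _ => List ℕ → Bool) (fun _ => true)
    (fun row _ ih acc => anyDigit (fun v => ih (v :: acc)) 10 (candidates N K row acc 1023)) rows

/-- Row `i` of the lower triangular part of `H`, in reverse order. -/
def triRow (H : List ℕ) (i : ℕ) : List Bool := (List.range i).reverse.map (entry H i)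

/-- The lower triangular parts of the forbidden patterns. -/
def triangles : List (List (List Bool)) := [[[], [true], [true, false], [true, false, true]],
  [[], [true], [true, false], [false, false, false], [true, false, false, false], [true, false, false, false, false]],
  [[], [true], [true, false], [true, false, false], [true, false, false, false], [true, false, false, false, true]],
  [[], [true], [true, false], [true, false, false], [true, false, false, false], [true, false, false, false, false], [true, false, false, false, false, true]],
  [[], [true], [false, true], [false, false, true], [false, false, true, false], [true, false, true, false, false], [true, true, true, false, false, false], [false, false, false, false, false, true, true], [true, true, true, false, false, false, false, false]]]

theorem triangles_eq :
    triangles = patterns.map fun H => (List.range H.length).map (triRow H) := by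
  decide +kernel

noncomputable def Code.num (s : Code (Fin 3)) : ℕ :=
  s.1.toNat + 2 * (s.2.1 0).toNat + 4 * (s.2.1 1).toNat + 8 * (s.2.1 2).toNat +
    16 * (s.2.2 0).toNat + 32 * (s.2.2 1).toNat + 64 * (s.2.2 2).toNat

/-- Adjacency in a graph with vertices `0, …, 9`, where `3, …, 9` induce a pentagon. -/
def attachedAdj (s t u : ℕ) (st tu su : Bool) (i j : ℕ) : Bool :=
  match i, j with
  | 0, 0 => false
  | 0, 1 => st
  | 1, 0 => st
  | 0, 2 => su
  | 2, 0 => su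
  | 2, 1 => tu
  | 1, 2 => tu
  | 1, 1 => false
  | 2, 2 => false
  | 0, j + 3 => s.testBit j
  | 1, j + 3 => t.testBit j
  | 2, j + 3 => u.testBit j
  | i + 3, 0 => s.testBit i
  | i + 3, 1 => t.testBit i
  | i + 3, 2 => u.testBit i
  -- The constant is the 10 by 10 adjacency matrix of the pentagon on `3, …, 9`, in the order a, b,
  -- c; the digit read is number 10(i+3) + (j+3).
  | i + 3, j + 3 => (555410461934278606035479429120 : ℕ).testBit (10 * i + j + 33)

/-- No forbidden pattern is found in a 3-pentagon together with three attached vertices of types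
`s`, `t` and `u`. -/
noncomputable def good (s t u : Code (Fin 3)) (st tu su : Bool) : Bool :=
  force s.num fun s' => force t.num fun t' => force u.num fun u' =>
    force (ofDigits (fun k => attachedAdj s' t' u' st tu su (k / 10) (k % 10)) 100) fun N =>
      -- The constant has digit 10i + j equal to 1 exactly when i ≠ j, so `K` is the complement of
      -- `N` off the diagonal. Both matrices vanish on the diagonal, which keeps the search from
      -- using a vertex twice.
      force (633515663914742881158342637566 ^^^ N) fun K => triangles.all fun H => !place N K H []

/-! ### Soundness of the search for forbidden patterns -/

theorem testBit_ofDigits (f : ℕ → Bool) (n i : ℕ) :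
    (ofDigits f n).testBit i = (decide (i < n) && f i) := by
  induction n with
  | zero => simp [ofDigits]
  | succ n ih =>
    change (Bool.rec (ofDigits f n) (ofDigits f n ||| 2 ^ n) (f n) : ℕ).testBit i = _
    rcases hf : f n with _ | _
    · simp only [ih]
      by_cases h : i = n
      · simp [h, hf]
      · have : i < n + 1 ↔ i < n := by omega
        simp [this]
    · simp only [Nat.testBit_or, ih, Nat.testBit_two_pow]
      by_cases h : i = n
      · simp [h, hf]
      · have : i < n + 1 ↔ i < n := by omega
        simp [this, Ne.symm h]

theorem force_eq {α : Type} (n : ℕ) (k : ℕ → α) : force n k = k n := by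
  cases n <;> rfl

/-- For the patterns, only soundness of the search matters: what it finds is really there. A digit
missed because `n` is too small could only make a later check fail. -/
theorem exists_of_anyDigit {k : ℕ → Bool} {n c : ℕ} (h : anyDigit k n c = true) :
    ∃ v, c.testBit v = true ∧ k v = true := by
  induction n generalizing c with
  | zero => exact absurd h (by simp [anyDigit])
  | succ n ih =>
    rcases c with _ | c
    · exact absurd h (by simp [anyDigit])
    · have h' : force (Nat.log2 (c + 1)) (fun v =>
        Bool.rec (anyDigit k n ((c + 1) ^^^ 2 ^ v)) true (k v)) = true := h
      rw [force_eq] at h'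
      have hb : (c + 1).testBit (Nat.log2 (c + 1)) = true := Nat.testBit_log2 (by omega)
      rcases hk : k (Nat.log2 (c + 1)) with _ | _
      · rw [hk] at h'
        obtain ⟨v, hv, hv'⟩ := ih h'
        refine ⟨v, ?_, hv'⟩
        rw [Nat.testBit_xor, Nat.testBit_two_pow] at hv
        by_cases hvc : Nat.log2 (c + 1) = v
        · rw [← hvc]; exact hb
        · simpa [hvc] using hv
      · exact ⟨_, hb, hk⟩

theorem testBit_candidates {N K : ℕ} (l : List ℕ) (h : ℕ → Bool) (f : ℕ → ℕ) {c v : ℕ}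
    (hv : (candidates N K (l.map h) (l.map f) c).testBit v = true) :
    c.testBit v = true ∧
      ∀ j ∈ l, (if h j then N else K).testBit (10 * f j + v) = true := by
  induction l generalizing c with
  | nil => exact ⟨hv, by simp⟩
  | cons j l ih =>
    obtain ⟨h1, h2⟩ := ih hv
    rw [Nat.testBit_and, Bool.and_eq_true] at h1
    refine ⟨h1.1, ?_⟩
    simp only [List.mem_cons, forall_eq_or_imp]
    refine ⟨?_, h2⟩
    rcases hj : h j with _ | _ <;> simpa [hj, Nat.testBit_shiftRight] using h1.2

/-- The induction is on the number `k` of vertices still to be placed, after the first `m` have been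
placed as prescribed by `f`; they are listed with the latest first, in agreement with the reversed
rows `triRow`. -/
theorem exists_of_place {N K : ℕ} (H : List ℕ) (m k : ℕ) (f : ℕ → ℕ)
    (h : place N K ((List.range' m k).map (triRow H)) ((List.range m).reverse.map f) = true) :
    ∃ g : ℕ → ℕ, (∀ i < m, g i = f i) ∧ ∀ i, m ≤ i → i < m + k → g i < 10 ∧
      ∀ j < i, (if entry H i j then N else K).testBit (10 * g j + g i) = true := by
  induction k generalizing m f with
  | zero => exact ⟨f, fun _ _ => rfl, fun i hi hi' => by omega⟩
  | succ k ih =>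
    rw [List.range'_succ, List.map_cons] at h
    change anyDigit (fun v => place N K ((List.range' (m + 1) k).map (triRow H))
      (v :: (List.range m).reverse.map f)) 10
        (candidates N K ((List.range m).reverse.map (entry H m)) ((List.range m).reverse.map f)
          1023) = true at h
    obtain ⟨v, hv, hv'⟩ := exists_of_anyDigit h
    obtain ⟨hv1, hv2⟩ := testBit_candidates _ _ _ hv
    have hacc : v :: (List.range m).reverse.map f =
        (List.range (m + 1)).reverse.map (Function.update f m v) := by
      rw [List.range_succ, List.reverse_append, List.reverse_singleton, List.singleton_append,
        List.map_cons, Function.update_self]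
      congr 1
      refine List.map_congr_left fun j hj => ?_
      rw [Function.update_of_ne]
      have : j < m := by simpa using hj
      omega
    obtain ⟨g, hg, hg'⟩ := ih (m + 1) (Function.update f m v) (hacc ▸ hv')
    have hgm : g m = v := by rw [hg m (by omega), Function.update_self]
    have hgj : ∀ j < m, g j = f j := fun j hj => by
      rw [hg j (by omega), Function.update_of_ne (by omega)]
    refine ⟨g, hgj, fun i hi hi' => ?_⟩
    rcases hi.eq_or_lt with rfl | hlt
    · refine ⟨?_, fun j hj => ?_⟩
      · rw [hgm]
        by_contra hlt
        -- A digit of 1023 has position below 10.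
        rw [Nat.testBit_lt_two_pow] at hv1
        · cases hv1
        · exact lt_of_lt_of_le (by norm_num) (Nat.pow_le_pow_right (by norm_num) (not_lt.1 hlt))
      · rw [hgm, hgj j hj]
        exact hv2 j (by simpa using hj)
    · exact hg' i hlt (by omega)

theorem entry_patterns : ∀ H ∈ patterns, ∀ i < H.length, entry H i i = true ∧
    ∀ j < H.length, entry H i j = entry H j i := by
  decide +kernel

section
variable {V : Type*} {G : SimpleGraph V}

/-- The search constrains each vertex only against earlier ones; symmetry and the unit diagonal of
the patterns give the remaining entries. The map `vert` need not be injective. -/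
theorem occurs_of_place {H : List ℕ} (hH : H ∈ patterns) {N K : ℕ} (vert : ℕ → V)
    (hN : ∀ i < 10, ∀ j < 10, N.testBit (10 * i + j) = true → G.CAdj (vert i) (vert j))
    (hK : ∀ i < 10, ∀ j < 10, K.testBit (10 * i + j) = true → ¬ G.CAdj (vert i) (vert j))
    (h : place N K ((List.range H.length).map (triRow H)) [] = true) : G.Occurs H := by
  rw [List.range_eq_range'] at h
  obtain ⟨g, -, hg⟩ := exists_of_place H 0 H.length id h
  have key : ∀ i < H.length, ∀ j < i, (G.CAdj (vert (g j)) (vert (g i)) ↔ entry H i j = true) := by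
    intro i hi j hj
    have h1 := (hg i (Nat.zero_le _) (by omega))
    have h2 := (hg j (Nat.zero_le _) (by omega)).1
    have h3 := h1.2 j hj
    rcases he : entry H i j with _ | _
    · rw [he] at h3
      simpa using hK _ h2 _ h1.1 h3
    · rw [he] at h3
      simpa using hN _ h2 _ h1.1 h3
  refine ⟨fun i => vert (g i), fun i hi j hj => ?_⟩
  rcases lt_trichotomy i j with hij | rfl | hij
  · rw [key j hj i hij, (entry_patterns H hH i hi).2 j hj]
  · simp [(entry_patterns H hH i hi).1, CAdj.refl]
  · rw [cadj_comm, key i hi j hij]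

/-- The vertices of a 3-pentagon, preceded by three further vertices. -/
def Pent.vert (P : Pent G (Fin 3)) (x y z : V) : ℕ → V
  | 0 => x
  | 1 => y
  | 2 => z
  | 3 => P.a
  | 4 => P.b 0
  | 5 => P.b 1
  | 6 => P.b 2
  | 7 => P.c 0
  | 8 => P.c 1
  | _ => P.c 2

theorem Pent.testBit_code (P : Pent G (Fin 3)) (v x y z : V) (j : ℕ) (hj : j < 7) :
    (P.code v).num.testBit j = true ↔ G.CAdj v (P.vert x y z (j + 3)) := by
  have key : ∀ p q r s t u w : Bool, ∀ j < 7,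
      (Code.num (p, ![q, r, s], ![t, u, w])).testBit j = [p, q, r, s, t, u, w].getD j false := by
    decide +kernel
  -- The finite check above ranges over codes written with vector literals, so the code is first put
  -- into that form.
  have h : P.code v = ((P.code v).1, ![(P.code v).2.1 0, (P.code v).2.1 1, (P.code v).2.1 2],
      ![(P.code v).2.2 0, (P.code v).2.2 1, (P.code v).2.2 2]) := by
    refine Prod.ext rfl (Prod.ext ?_ ?_) <;> funext i <;> fin_cases i <;> rfl
  rw [h, key _ _ _ _ _ _ _ j hj]
  interval_cases j <;> simp [code, vert]

theorem Pent.attachedAdj_iff (P : Pent G (Fin 3)) (x y z : V) (st tu su : Bool)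
    (hst : st = true ↔ G.CAdj x y) (htu : tu = true ↔ G.CAdj y z) (hsu : su = true ↔ G.CAdj x z)
    (i j : ℕ) (hi : i < 10) (hj : j < 10) :
    attachedAdj (P.code x).num (P.code y).num (P.code z).num st tu su i j = true ↔
      i ≠ j ∧ G.CAdj (P.vert x y z i) (P.vert x y z j) := by
  have hc : ∀ v, ∀ j < 7, _ := fun v => P.testBit_code v x y z
  match i, j with
  | 0, 0 => simp [attachedAdj]
  | 0, 1 => simp [attachedAdj, vert, hst]
  | 1, 0 => simp [attachedAdj, vert, hst, cadj_comm]
  | 0, 2 => simp [attachedAdj, vert, hsu]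
  | 2, 0 => simp [attachedAdj, vert, hsu, cadj_comm]
  | 2, 1 => simp [attachedAdj, vert, htu, cadj_comm]
  | 1, 2 => simp [attachedAdj, vert, htu]
  | 1, 1 => simp [attachedAdj]
  | 2, 2 => simp [attachedAdj]
  | 0, j + 3 => exact (hc x j (by omega)).trans ⟨fun h => ⟨by omega, h⟩, fun h => h.2⟩
  | 1, j + 3 => exact (hc y j (by omega)).trans ⟨fun h => ⟨by omega, h⟩, fun h => h.2⟩
  | 2, j + 3 => exact (hc z j (by omega)).trans ⟨fun h => ⟨by omega, h⟩, fun h => h.2⟩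
  | i + 3, 0 => rw [cadj_comm]; exact (hc x i (by omega)).trans ⟨fun h => ⟨by omega, h⟩, fun h => h.2⟩
  | i + 3, 1 => rw [cadj_comm]; exact (hc y i (by omega)).trans ⟨fun h => ⟨by omega, h⟩, fun h => h.2⟩
  | i + 3, 2 => rw [cadj_comm]; exact (hc z i (by omega)).trans ⟨fun h => ⟨by omega, h⟩, fun h => h.2⟩
  | i + 3, j + 3 =>
    have h1 := P.ab
    have h2 := P.ac
    have h3 := P.bb
    have h4 := P.cc
    have h5 := P.bc
    have h6 := P.bc_ne
    have hi' : i < 7 := by omega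
    have hj' : j < 7 := by omega
    have h1' := fun i => (P.ab i).symm
    have h2' := fun i => mt CAdj.symm (P.ac i)
    have h5' := fun i => (P.bc i).symm
    have h6' := fun i j h => mt CAdj.symm (P.bc_ne j i h)
    change (555410461934278606035479429120 : ℕ).testBit (10 * i + j + 33) = true ↔ _
    interval_cases i <;> interval_cases j <;> simp [Nat.testBit, vert, *]

/-- Used contrapositively: a configuration for which `good` evaluates to `false` does not arise. The
vertices `x`, `y`, `z` may coincide with one another or with vertices of the pentagon, so repeating
a vertex gives the tests for single vertices and for pairs. -/
theorem Pent.good (hG : G.PatternFree) (P : Pent G (Fin 3)) (x y z : V) (st tu su : Bool)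
    (hst : st = true ↔ G.CAdj x y) (htu : tu = true ↔ G.CAdj y z) (hsu : su = true ↔ G.CAdj x z) :
    good (P.code x) (P.code y) (P.code z) st tu su = true := by
  simp only [SimpleGraph.good, force_eq, triangles_eq, List.all_map, List.all_eq_true,
    Function.comp_apply]
  intro H hH
  rw [Bool.not_eq_true', ← Bool.not_eq_true]
  refine fun h => hG H hH (occurs_of_place hH (P.vert x y z) ?_ ?_ h)
  · intro i hi j hj h
    rw [testBit_ofDigits, Bool.and_eq_true] at h
    have h' := h.2
    rw [show (10 * i + j) / 10 = i by omega, show (10 * i + j) % 10 = j by omega,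
      P.attachedAdj_iff x y z st tu su hst htu hsu i j hi hj] at h'
    exact h'.2
  · intro i hi j hj h
    rw [Nat.testBit_xor, testBit_ofDigits, show (10 * i + j) / 10 = i by omega,
      show (10 * i + j) % 10 = j by omega, decide_eq_true (by omega : 10 * i + j < 100)] at h
    have h1 : ∀ i < 10, ∀ j < 10, (633515663914742881158342637566 : ℕ).testBit (10 * i + j) =
      decide (i ≠ j) := by decide +kernel
    have h2 := P.attachedAdj_iff x y z st tu su hst htu hsu i j hi hj
    rw [h1 i hi j hj] at h
    intro h'
    by_cases hij : i = j
    · simp only [hij, ne_eq, not_true_eq_false, false_and, iff_false] at h2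
      simp [hij, h2] at h
    · rw [h2.2 ⟨hij, h'⟩] at h
      simp [hij] at h

end

/-! ### Simplicial vertices -/

section
variable {V : Type*} {G : SimpleGraph V}

theorem PatternFree.c4 (hG : G.PatternFree) {x y z w : V} (hxy : G.CAdj x y) (hyz : G.CAdj y z)
    (hzw : G.CAdj z w) (hwx : G.CAdj w x) (hxz : ¬ G.CAdj x z) (hyw : ¬ G.CAdj y w) : False := by
  refine hG patternC4 (by simp [patterns]) ⟨fun i => [x, y, z, w].getD i x, ?_⟩
  have hxz' := mt CAdj.symm hxz
  have hyw' := mt CAdj.symm hyw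
  intro i hi j hj
  simp only [patternC4, List.length_cons, List.length_nil] at hi hj
  interval_cases i <;> interval_cases j <;>
    simp [entry, patternC4, Nat.testBit, CAdj.refl, hxy.symm, hyz.symm, hzw.symm, hwx.symm, *]

/-- If `L` is a clique, and any two closed neighbours of a vertex of `K` are equal, adjacent, or
in `K` and `L`, respectively, then some vertex is simplicial. -/
theorem PatternFree.exists_isSimplicialVertex [Finite V] (hG : G.PatternFree) (K L : Set V)
    (hK : K.Nonempty) (hL : ∀ x ∈ L, ∀ y ∈ L, G.CAdj x y)
    (h : ∀ k ∈ K, ∀ x y, G.CAdj k x → G.CAdj k y →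
      G.CAdj x y ∨ (x ∈ K ∧ y ∈ L) ∨ (x ∈ L ∧ y ∈ K)) : ∃ v, G.IsSimplicialVertex v := by
  -- The simplicial vertex will be an element of `K` with the fewest closed neighbours in `L`.
  obtain ⟨k, hk, hmin⟩ := Set.exists_min_image K (fun k => {x ∈ L | G.CAdj k x}.ncard)
    (Set.toFinite K) hK
  have key : ∀ x ∈ K, ∀ y ∈ L, G.CAdj k x → G.CAdj k y → G.CAdj x y := by
    intro x hx y hy hkx hky
    by_contra hxy
    -- If `x` misses `y`, which `k` sees, then by minimality `x` must see some `z ∈ L` that `k`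
    -- misses, and `k, x, z, y` is an induced four-cycle.
    have : ¬ {z ∈ L | G.CAdj x z} ⊆ {z ∈ L | G.CAdj k z} := by
      intro hsub
      have hss : {z ∈ L | G.CAdj x z} ⊂ {z ∈ L | G.CAdj k z} :=
        ⟨hsub, fun hsub' => hxy (hsub' ⟨hy, hky⟩).2⟩
      exact absurd (Set.ncard_lt_ncard hss (Set.toFinite _)) (not_lt.2 (hmin x hx))
    obtain ⟨z, ⟨hz, hxz⟩, hkz⟩ := Set.not_subset.1 this
    exact hG.c4 hkx hxz (hL z hz y hy) hky.symm (fun h' => hkz ⟨hz, h'⟩) hxy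
  refine ⟨k, fun x hx y hy hxy => ?_⟩
  have hx' : G.CAdj k x := Or.inr hx
  have hy' : G.CAdj k y := Or.inr hy
  refine CAdj.adj ?_ hxy
  rcases h k hk x y hx' hy' with h | ⟨h1, h2⟩ | ⟨h1, h2⟩
  · exact h
  · exact key x h1 y h2 hx' hy'
  · exact (key y h2 x h1 hy' hx').symm

/-! ### Consequences of the search -/

/-- The types of vertices that can be attached to a 3-pentagon. -/
def types : List (Code (Fin 3)) :=
  [.O, .Za, .A, .C0, .U] ++ [0, 1, 2].flatMap fun i =>
    [.Zb i, .AB i, .AA i, .Zc i, .BC i, .B i, .CC i, .F i, .C i]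

namespace Pent

theorem bit_true {x y : V} (h : G.CAdj x y) : true = true ↔ G.CAdj x y := iff_of_true rfl h

theorem bit_false {x y : V} (h : ¬ G.CAdj x y) : false = true ↔ G.CAdj x y :=
  iff_of_false Bool.false_ne_true h

theorem good_self (hG : G.PatternFree) (P : Pent G (Fin 3)) (x : V) :
    SimpleGraph.good (P.code x) (P.code x) (P.code x) true true true = true :=
  P.good hG x x x _ _ _ (bit_true (.refl x)) (bit_true (.refl x)) (bit_true (.refl x))

theorem good_pair (hG : G.PatternFree) (P : Pent G (Fin 3)) {x y : V} (h : G.CAdj x y) :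
    SimpleGraph.good (P.code x) (P.code y) (P.code y) true true true = true :=
  P.good hG x y y _ _ _ (bit_true h) (bit_true (.refl y)) (bit_true h)

theorem good_pair' (hG : G.PatternFree) (P : Pent G (Fin 3)) {x y : V} (h : ¬ G.CAdj x y) :
    SimpleGraph.good (P.code x) (P.code y) (P.code y) false true false = true :=
  P.good hG x y y _ _ _ (bit_false h) (bit_true (.refl y)) (bit_false h)

theorem code_mem_types (hG : G.PatternFree) (P : Pent G (Fin 3)) (v : V) : P.code v ∈ types := by
  have key : ∀ p q r s t u w : Bool, ((p, ![q, r, s], ![t, u, w]) : Code (Fin 3)) ∈ types ∨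
      SimpleGraph.good (p, ![q, r, s], ![t, u, w]) (p, ![q, r, s], ![t, u, w])
        (p, ![q, r, s], ![t, u, w]) true true true = false := by
    decide +kernel
  have h : P.code v = ((P.code v).1, ![(P.code v).2.1 0, (P.code v).2.1 1, (P.code v).2.1 2],
      ![(P.code v).2.2 0, (P.code v).2.2 1, (P.code v).2.2 2]) := by
    refine Prod.ext rfl (Prod.ext ?_ ?_) <;> funext i <;> fin_cases i <;> rfl
  have h1 := good_self hG P v
  rw [h] at h1 ⊢
  rcases key (P.code v).1 ((P.code v).2.1 0) ((P.code v).2.1 1) ((P.code v).2.1 2)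
    ((P.code v).2.2 0) ((P.code v).2.2 1) ((P.code v).2.2 2) with h2 | h2
  · exact h2
  · rw [h2] at h1; cases h1

end Pent

/-- The hypotheses of `exists_isSimplicialVertex`, in terms of types. -/
noncomputable def elimCheck (known : Code (Fin 3) → Code (Fin 3) → Bool)
    (κ ν l : List (Code (Fin 3))) : Bool :=
  -- The first conjunct makes the vertices with types in `l` a clique. The second asks that two
  -- nonadjacent closed neighbours of a vertex with type in `κ` have one type in `κ` and the other
  -- in `l`, unless they are known to be adjacent or a forbidden pattern arises.
  (l.all fun s => l.all fun t => !good s t t false true false) &&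
  κ.all fun k => ν.all fun s => ν.all fun t =>
    (κ.contains s && l.contains t) || (l.contains s && κ.contains t) ||
      known s t || known t s || !good k s t true false true

/-- Neighbours of vertices with types in `κ` have types in `ν`, if all types are in `τ`. -/
noncomputable def nbrCheck (τ κ ν : List (Code (Fin 3))) : Bool :=
  κ.all fun k => τ.all fun s => ν.contains s || !good k s s true true true

namespace Pent

theorem mem_of_nbrCheck (hG : G.PatternFree) (P : Pent G (Fin 3)) {τ κ ν : List (Code (Fin 3))}
    (h : nbrCheck τ κ ν = true) {x y : V} (hx : P.code x ∈ κ) (hy : P.code y ∈ τ)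
    (hxy : G.CAdj x y) : P.code y ∈ ν := by
  simp only [nbrCheck, List.all_eq_true, Bool.or_eq_true, Bool.not_eq_true', List.contains_iff_mem]
    at h
  refine (h _ hx _ hy).resolve_right ?_
  rw [good_pair hG P hxy]
  simp

/-- The set `K` may be smaller than the set of vertices with types in `κ`; hypothesis `hl` takes
care of neighbours with a type in `κ` that are outside `K`. -/
theorem elim [Finite V] (hG : G.PatternFree) (hs : ∀ v, ¬ G.IsSimplicialVertex v)
    (P : Pent G (Fin 3)) {known : Code (Fin 3) → Code (Fin 3) → Bool}
    {κ ν l : List (Code (Fin 3))} (h : elimCheck known κ ν l = true)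
    (hknown : ∀ x y, known (P.code x) (P.code y) = true → G.CAdj x y)
    (K : V → Prop) (hK : ∀ v, K v → P.code v ∈ κ)
    (hν : ∀ k, K k → ∀ x, G.CAdj k x → P.code x ∈ ν)
    (hl : ∀ k, K k → ∀ x y, G.CAdj k x → P.code x ∈ κ → ¬ K x → P.code y ∈ l → G.CAdj x y)
    (v : V) : ¬ K v := by
  intro hv
  simp only [elimCheck, List.all_eq_true, Bool.or_eq_true, Bool.and_eq_true, Bool.not_eq_true',
    List.contains_iff_mem] at h
  obtain ⟨h1, h2⟩ := h
  obtain ⟨u, hu⟩ := hG.exists_isSimplicialVertex {v | K v} {v | P.code v ∈ l} ⟨v, hv⟩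
    (fun x hx y hy => by
      by_contra hxy
      have := h1 _ hx _ hy
      rw [good_pair' hG P hxy] at this
      cases this)
    (fun k hk x y hkx hky => by
      by_cases hxy : G.CAdj x y
      · exact Or.inl hxy
      rcases h2 _ (hK k hk) _ (hν k hk x hkx) _ (hν k hk y hky) with
        (((⟨h, h'⟩ | ⟨h, h'⟩) | h) | h) | h
      · by_cases hx : K x
        · exact Or.inr (Or.inl ⟨hx, h'⟩)
        · exact absurd (hl k hk x y hkx h hx h') hxy
      · by_cases hy : K y
        · exact Or.inr (Or.inr ⟨h, hy⟩)
        · exact absurd (hl k hk y x hky h' hy h).symm hxy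
      · exact absurd (hknown x y h) hxy
      · exact absurd (hknown y x h).symm hxy
      · rw [P.good hG k x y _ _ _ (bit_true hkx) (bit_false hxy) (bit_true hky)] at h
        cases h)
  exact hs u hu

end Pent
end
/-! ### Vertices attached to 3-pentagons -/

def types₂ : List (Code (Fin 3)) :=
  [.Za, .A, .C0, .U] ++ [0, 1, 2].flatMap fun i => [.AB i, .AA i, .BC i, .B i, .F i, .C i]

def types₃ (i : Fin 3) : List (Code (Fin 3)) :=
  [.A, .U, .AA i, .BC i] ++ [0, 1, 2].flatMap fun i => [.B i, .F i, .C i]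

def types₄ : List (Code (Fin 3)) :=
  [.Za, .A, .C0, .U] ++ [0, 1, 2].flatMap fun i => [.AB i, .B i, .F i, .C i]

def typesF : List (Code (Fin 3)) := [.F 0, .F 1, .F 2]

def typesF' (i : Fin 3) : List (Code (Fin 3)) := [.F (i + 1), .F (i + 2)]

def unknown : Code (Fin 3) → Code (Fin 3) → Bool := fun _ _ => false

/-- Whether `s` is the type `A` and `t` is one of the types `AB i` or `B i`. -/
def isAAndB (s t : Code (Fin 3)) : Bool :=
  s == .A && [.AB 0, .AB 1, .AB 2, .B 0, .B 1, .B 2].contains t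

section
variable {V : Type*} {G : SimpleGraph V}

namespace Pent
section
variable {ι : Type*}

theorem code_fst_iff (P : Pent G ι) (v : V) : (P.code v).1 = true ↔ G.CAdj v P.a := by
  simp [code]

theorem code_b_iff (P : Pent G ι) (v : V) (i : ι) :
    (P.code v).2.1 i = true ↔ G.CAdj v (P.b i) := by
  simp [code]

theorem code_c_iff (P : Pent G ι) (v : V) (i : ι) :
    (P.code v).2.2 i = true ↔ G.CAdj v (P.c i) := by
  simp [code]

variable [DecidableEq ι]

omit [DecidableEq ι] in
theorem code_eq_iff (P : Pent G ι) (v : V) (s : Code ι) :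
    P.code v = s ↔ (G.CAdj v P.a ↔ s.1 = true) ∧ (∀ i, G.CAdj v (P.b i) ↔ s.2.1 i = true) ∧
      ∀ i, G.CAdj v (P.c i) ↔ s.2.2 i = true := by
  simp only [← code_fst_iff, ← code_b_iff, ← code_c_iff, ← Bool.eq_iff_iff, Prod.ext_iff,
    funext_iff]

omit [DecidableEq ι] in
theorem code_a (P : Pent G ι) : P.code P.a = .A :=
  (P.code_eq_iff _ _).2 ⟨by simp [Code.A, CAdj.refl], by simp [Code.A, P.ab], by
    simp [Code.A, P.ac]⟩

theorem code_b (P : Pent G ι) (i : ι) : P.code (P.b i) = .B i := by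
  refine (P.code_eq_iff _ _).2 ⟨by simp [Code.B, (P.ab i).symm], fun j => ?_, fun j => ?_⟩
  · by_cases h : j = i
    · simp [Code.B, h, CAdj.refl]
    · simp [Code.B, h, P.bb i j (Ne.symm h)]
  · by_cases h : j = i
    · simp [Code.B, h, P.bc i]
    · simp [Code.B, h, P.bc_ne i j (Ne.symm h)]

theorem code_c (P : Pent G ι) (i : ι) : P.code (P.c i) = .C i := by
  refine (P.code_eq_iff _ _).2 ⟨by simp [Code.C, mt CAdj.symm (P.ac i)], fun j => ?_, fun j => ?_⟩
  · by_cases h : j = i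
    · simp [Code.C, h, (P.bc i).symm]
    · simp [Code.C, h, mt CAdj.symm (P.bc_ne j i h)]
  · simp [Code.C, P.cc i j]

/-- Replace the vertices `a` and `b i` of a pentagon. -/
def replace (P : Pent G ι) (i : ι) (x y : V) (hxb : ∀ j ≠ i, G.CAdj x (P.b j))
    (hxc : ∀ j, ¬ G.CAdj x (P.c j)) (hxy : G.CAdj x y) (hyb : ∀ j ≠ i, ¬ G.CAdj y (P.b j))
    (hyc : G.CAdj y (P.c i)) (hyc' : ∀ j ≠ i, ¬ G.CAdj y (P.c j)) : Pent G ι where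
  a := x
  b := Function.update P.b i y
  c := P.c
  ab j := by
    by_cases h : j = i
    · subst h; simpa using hxy
    · simpa [h] using hxb j h
  ac := hxc
  bb j k hjk := by
    by_cases h : j = i
    · subst h; simpa [Ne.symm hjk] using hyb k (Ne.symm hjk)
    · by_cases h' : k = i
      · subst h'; simpa [hjk] using mt CAdj.symm (hyb j hjk)
      · simpa [h, h'] using P.bb j k hjk
  cc := P.cc
  bc j := by
    by_cases h : j = i
    · subst h; simpa using hyc
    · simpa [h] using P.bc j
  bc_ne j k hjk := by
    by_cases h : j = i
    · subst h; simpa using hyc' k (Ne.symm hjk)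
    · simpa [h] using P.bc_ne j k hjk

end

variable {P : Pent G (Fin 3)} {w x y z : V} {s t u : Code (Fin 3)} {i j : Fin 3}

theorem adj_of (hG : G.PatternFree) (hx : P.code x = s) (hy : P.code y = t)
    (h : SimpleGraph.good s t t false true false = false) : G.CAdj x y := by
  by_contra hxy
  have := P.good_pair' hG hxy
  rw [hx, hy, h] at this
  cases this

theorem not_adj_of (hG : G.PatternFree) (hx : P.code x = s) (hy : P.code y = t)
    (h : SimpleGraph.good s t t true true true = false) : ¬ G.CAdj x y := by
  intro hxy
  have := P.good_pair hG hxy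
  rw [hx, hy, h] at this
  cases this

theorem false_of (hG : G.PatternFree) (hx : P.code x = s) (hy : P.code y = t)
    (hz : P.code z = u) {st tu su : Bool} (hst : st = true ↔ G.CAdj x y)
    (htu : tu = true ↔ G.CAdj y z) (hsu : su = true ↔ G.CAdj x z)
    (h : SimpleGraph.good s t u st tu su = false) : False := by
  have := P.good hG x y z st tu su hst htu hsu
  rw [hx, hy, hz, h] at this
  cases this

/-- Here `K` consists of all vertices of type `k`, so `hl` is vacuous and the elimination is purely
computational. -/
theorem code_ne_of_elim [Finite V] (hG : G.PatternFree) (hs : ∀ v, ¬ G.IsSimplicialVertex v)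
    (P : Pent G (Fin 3)) {k : Code (Fin 3)} {ν l : List (Code (Fin 3))}
    (hn : nbrCheck types [k] ν = true) (he : elimCheck unknown [k] ν l = true) (v : V) :
    P.code v ≠ k :=
  P.elim hG hs he (fun _ _ h => by cases h) (fun v => P.code v = k) (fun v hv => by simp [hv])
    (fun k hk x hkx => P.mem_of_nbrCheck hG hn (by simp [hk]) (P.code_mem_types hG x) hkx)
    (fun k hk x y hkx hx hx' _ => absurd (List.mem_singleton.1 hx) hx') v

/-! ### Types excluded by the absence of simplicial vertices -/

section
variable [Finite V] (hG : G.PatternFree) (hs : ∀ v, ¬ G.IsSimplicialVertex v)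
include hG hs

/-- In this and the next three eliminations, `ν` lists the types that a neighbour can have and `l`
those that form the clique `L`. -/
theorem code_ne_O (P : Pent G (Fin 3)) (v : V) : P.code v ≠ .O :=
  P.code_ne_of_elim hG hs (ν := [.O, .Za, .A, .U] ++ typesF) (l := [.A, .U] ++ typesF)
    (by decide +kernel) (by decide +kernel) v

theorem code_ne_Zb (P : Pent G (Fin 3)) (v : V) (i : Fin 3) : P.code v ≠ .Zb i :=
  P.code_ne_of_elim hG hs (ν := [.Zb i, .AB i, .B i, .A, .U] ++ typesF' i)
    (l := [.A, .U] ++ typesF' i) (by revert i; decide +kernel) (by revert i; decide +kernel) v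

theorem code_ne_Zc (P : Pent G (Fin 3)) (v : V) (i : Fin 3) : P.code v ≠ .Zc i :=
  P.code_ne_of_elim hG hs (ν := [.Zc i, .C i, .U] ++ typesF' i)
    (l := [.U] ++ typesF' i) (by revert i; decide +kernel) (by revert i; decide +kernel) v

theorem code_ne_CC (P : Pent G (Fin 3)) (v : V) (i : Fin 3) : P.code v ≠ .CC i :=
  P.code_ne_of_elim hG hs (ν := [.CC i, .C (i + 1), .C (i + 2), .U, .F i])
    (l := [.U, .F i]) (by revert i; decide +kernel) (by revert i; decide +kernel) v

theorem code_mem_types₂ (P : Pent G (Fin 3)) (v : V) : P.code v ∈ types₂ := by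
  have key : ∀ s ∈ types, s ∈ types₂ ∨ s = .O ∨ ∃ i, s = .Zb i ∨ s = .Zc i ∨ s = .CC i := by
    decide +kernel
  rcases key _ (P.code_mem_types hG v) with h | h | ⟨i, h | h | h⟩
  · exact h
  · exact absurd h (P.code_ne_O hG hs v)
  · exact absurd h (P.code_ne_Zb hG hs v i)
  · exact absurd h (P.code_ne_Zc hG hs v i)
  · exact absurd h (P.code_ne_CC hG hs v i)

/-- The elimination is applied to the vertices of type `BC i` that have no neighbour of type `A`. -/
theorem exists_adj_of_BC (hx : P.code x = .BC i) : ∃ y, P.code y = .A ∧ G.CAdj x y := by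
  by_contra! hno
  refine P.elim hG hs (κ := [.BC i]) (ν := [.BC i, .B i, .C i, .U] ++ typesF' i)
    (l := [.U] ++ typesF' i) (known := unknown) (by clear hx hno; revert i; decide +kernel)
    (fun _ _ h => by cases h)
    (fun v => P.code v = .BC i ∧ ∀ y, P.code y = .A → ¬ G.CAdj v y)
    (fun v hv => by simp [hv]) ?_ ?_ x ⟨hx, hno⟩
  · rintro k ⟨hk, hk'⟩ y hky
    have key : nbrCheck types₂ [.BC i] ([.A, .BC i, .B i, .C i, .U] ++ typesF' i) = true := by
      clear hx hno hk hk'; revert i; decide +kernel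
    have h := P.mem_of_nbrCheck hG key (by simp [hk]) (P.code_mem_types₂ hG hs y) hky
    rcases List.mem_cons.1 h with h | h
    · exact absurd hky (hk' y h)
    · exact h
  · rintro k - y z - hy hy' hz
    -- A vertex `y` of type `BC i` outside `K` has a neighbour `a` of type `A`. Types `U` and `F j`
    -- with j ≠ i are complete to `a`, and missing `y` would create a forbidden pattern.
    have hy := List.mem_singleton.1 hy
    have : ∃ a, P.code a = .A ∧ G.CAdj y a := by
      by_contra! h
      exact hy' ⟨hy, h⟩
    obtain ⟨a, ha, hya⟩ := this
    have key : ∀ s ∈ [.U] ++ typesF' i, SimpleGraph.good .A (.BC i) s true false true = false := by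
      clear * -; revert i; decide +kernel
    by_contra hyz
    refine false_of hG ha hy rfl (bit_true hya.symm) (bit_false hyz) (bit_true ?_) (key _ hz)
    exact adj_of hG ha rfl ((by clear * -; revert i; decide +kernel : ∀ s ∈ [.U] ++ typesF' i,
      SimpleGraph.good .A s s false true false = false) _ hz)

end

end Pent
end
/-! ### Building partitions -/

section
variable {V : Type*} {G : SimpleGraph V}

theorem isClique_of_cadj {X : Set V} (h : ∀ x ∈ X, ∀ y ∈ X, G.CAdj x y) : G.IsClique X :=
  fun x hx y hy hxy => (h x hx y hy).adj hxy

theorem completeTo_of_cadj {X Y : Set V} (hd : Disjoint X Y)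
    (h : ∀ x ∈ X, ∀ y ∈ Y, G.CAdj x y) : G.CompleteTo X Y :=
  fun x hx y hy => (h x hx y hy).adj fun hxy => Set.disjoint_left.1 hd hx (hxy ▸ hy)

theorem anticompleteTo_of_not_cadj {X Y : Set V}
    (h : ∀ x ∈ X, ∀ y ∈ Y, ¬ G.CAdj x y) : G.AnticompleteTo X Y :=
  fun x hx y hy => not_adj_of_not_cadj (h x hx y hy)

/-- Two vertices of the clique `X` with incomparable neighbourhoods in the clique `Y` would give an
induced four-cycle. So the neighbourhoods form a chain, and sorting by their size orders them;
`hcov` makes the largest one all of `Y`. -/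
theorem exists_isNestedOrdering [Finite V] (hG : G.PatternFree) {X Y : Set V}
    (hX : ∀ x ∈ X, ∀ y ∈ X, G.CAdj x y) (hY : ∀ x ∈ Y, ∀ y ∈ Y, G.CAdj x y) (hd : Disjoint X Y)
    (hne : X.Nonempty) (hcov : ∀ y ∈ Y, ∃ x ∈ X, G.CAdj x y) :
    ∃ (n : ℕ) (x : Fin (n + 1) → V), G.IsNestedOrdering X Y x := by
  classical
  have hchain : ∀ x ∈ X, ∀ x' ∈ X, G.neighborSet x ∩ Y ⊆ G.neighborSet x' ∩ Y ∨
      G.neighborSet x' ∩ Y ⊆ G.neighborSet x ∩ Y := by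
    intro x hx x' hx'
    by_contra! h
    obtain ⟨y, ⟨hy1, hy2⟩, hy3⟩ := Set.not_subset.1 h.1
    obtain ⟨y', ⟨hy1', hy2'⟩, hy3'⟩ := Set.not_subset.1 h.2
    have hxy : ¬ G.CAdj x' y := fun h' =>
      hy3 ⟨h'.adj fun he => Set.disjoint_left.1 hd hx' (he ▸ hy2), hy2⟩
    have hxy' : ¬ G.CAdj x y' := fun h' =>
      hy3' ⟨h'.adj fun he => Set.disjoint_left.1 hd hx (he ▸ hy2'), hy2'⟩
    exact hG.c4 (hX x' hx' x hx) (Or.inr hy1) (hY y hy2 y' hy2') (CAdj.symm (Or.inr hy1')) hxy hxy'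
  obtain ⟨m, e⟩ := Finite.exists_equiv_fin X
  obtain ⟨e⟩ := e
  obtain ⟨x0, hx0⟩ := hne
  have hm : m ≠ 0 := by
    rintro rfl
    exact (e ⟨x0, hx0⟩).elim0
  obtain ⟨n, rfl⟩ := Nat.exists_eq_succ_of_ne_zero hm
  -- The order dual makes the increasing sort put the largest neighbourhood first.
  let f : Fin (n + 1) → ℕᵒᵈ := fun k => OrderDual.toDual (G.neighborSet (e.symm k : V) ∩ Y).ncard
  let x : Fin (n + 1) → V := fun k => e.symm (Tuple.sort f k)
  have hxX : ∀ k, x k ∈ X := fun k => (e.symm (Tuple.sort f k)).2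
  have hrange : Set.range x = X := by
    ext v
    constructor
    · rintro ⟨k, rfl⟩
      exact hxX k
    · intro hv
      exact ⟨(Tuple.sort f).symm (e ⟨v, hv⟩), by simp [x]⟩
  have hanti : Antitone (fun k => G.neighborSet (x k) ∩ Y) := by
    intro k l hkl
    have h1 : (G.neighborSet (x l) ∩ Y).ncard ≤ (G.neighborSet (x k) ∩ Y).ncard :=
      Tuple.monotone_sort f hkl
    rcases hchain _ (hxX k) _ (hxX l) with h | h
    · exact (Set.eq_of_subset_of_ncard_le h h1 (Set.toFinite _)).ge
    · exact h
  refine ⟨n, x, ?_, hrange, hanti, Set.inter_eq_right.2 fun y hy => ?_⟩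
  · exact fun k l hkl => (Tuple.sort f).injective (e.symm.injective (Subtype.ext hkl))
  · obtain ⟨z, hz, hzy⟩ := hcov y hy
    rw [← hrange] at hz
    obtain ⟨k, rfl⟩ := hz
    exact (hanti (Fin.zero_le k)
      ⟨hzy.adj fun he => Set.disjoint_left.1 hd (hxX k) (he ▸ hy), hy⟩).1

theorem isPartitionOf_of_types {κ ι : Type*} (c : V → κ) (S : ι → List κ)
    (hd : ∀ k l, k ≠ l → ∀ s ∈ S k, s ∉ S l) (hc : ∀ v, ∃ k, c v ∈ S k) :
    IsPartitionOf Set.univ fun k => {v | c v ∈ S k} :=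
  ⟨fun k l hkl => Set.disjoint_left.2 fun _ hv hv' => hd k l hkl _ hv hv',
    Set.eq_univ_of_forall fun v => Set.mem_iUnion.2 (hc v)⟩

/-! ### Five-baskets around a vertex of type `AA i` -/

namespace Pent
variable {P : Pent G (Fin 3)} {w x y z : V} {s t u : Code (Fin 3)} {i j : Fin 3}

/-- The types in the parts of a 5-basket. -/
def basketTypes (i j : Fin 3) : Fin 2 ⊕ (Fin 3 ⊕ Fin 3) → List (Code (Fin 3))
  | .inl 0 => [.A, .AA i]
  | .inl 1 => [.F j]
  | .inr (.inl k) => if k = i then [.B k, .BC k] else [.B k]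
  | .inr (.inr k) => [.C k]

/-- Vertices of types `F k` and `F j` with k ≠ j can be neither adjacent nor nonadjacent. If no type
`F` occurs, any `j` will do. -/
theorem exists_forall_F (hG : G.PatternFree) (P : Pent G (Fin 3)) :
    ∃ j, ∀ v k, P.code v = .F k → k = j := by
  by_cases h : ∃ v j, P.code v = .F j
  · obtain ⟨v, j, hv⟩ := h
    refine ⟨j, fun v' k hv' => ?_⟩
    by_contra hkj
    have key : ∀ k j : Fin 3, k ≠ j →
        SimpleGraph.good (.F k) (.F j) (.F j) true true true = false ∧
        SimpleGraph.good (.F k) (.F j) (.F j) false true false = false := by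
      decide +kernel
    exact not_adj_of hG hv' hv (key k j hkj).1 (adj_of hG hv' hv (key k j hkj).2)
  · push Not at h
    exact ⟨0, fun v k hv => absurd hv (h v k)⟩

section
variable [Finite V] (hG : G.PatternFree) (hs : ∀ v, ¬ G.IsSimplicialVertex v)
  (hu : ∀ v, ∃ w, ¬ G.CAdj v w)
include hG hs

/-- A vertex of an excluded type could be neither adjacent nor nonadjacent to `w`. Only `Za` passes
this test without being on the list; its possible neighbours are then few enough for it to be
eliminated by a simplicial vertex. -/
theorem code_mem_types₃ (hw : P.code w = .AA i) (v : V) : P.code v ∈ types₃ i := by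
  have key : ∀ i, ∀ s ∈ types₂, s ∈ .Za :: types₃ i ∨
      (SimpleGraph.good (.AA i) s s true true true = false ∧
        SimpleGraph.good (.AA i) s s false true false = false) := by
    decide +kernel
  have h1 : ∀ v, P.code v ∈ .Za :: types₃ i := by
    intro v
    refine (key i _ (P.code_mem_types₂ hG hs v)).resolve_right fun h => ?_
    exact not_adj_of hG hw rfl h.1 (adj_of hG hw rfl h.2)
  refine (List.mem_cons.1 (h1 v)).resolve_left (P.elim hG hs (κ := [.Za])
    (ν := [.Za, .A, .U] ++ typesF) (l := [.A, .U] ++ typesF) (known := unknown)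
    (by decide +kernel) (fun _ _ h => by cases h) (fun v => P.code v = .Za)
    (fun v hv => by simp [hv]) ?_ ?_ v)
  · intro k hk x hkx
    refine P.mem_of_nbrCheck hG (τ := .Za :: types₃ i) (κ := [.Za]) ?_ (by simp [hk]) (h1 x) hkx
    clear * -
    revert i
    decide +kernel
  · intro k hk x y hkx hx hx' _
    exact absurd (List.mem_singleton.1 hx) hx'

include hu

/-- A vertex of type `U` would be universal. Its adjacency to type `BC i` is not forced by pairs
alone, but follows with the help of a neighbour of type `A`. -/
theorem code_ne_U_of_AA (hw : P.code w = .AA i) (v : V) : P.code v ≠ .U := by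
  intro hv
  obtain ⟨y, hy⟩ := hu v
  have key : ∀ i, ∀ s ∈ types₃ i, s = .BC i ∨
      SimpleGraph.good .U s s false true false = false := by
    decide +kernel
  rcases key i _ (P.code_mem_types₃ hG hs hw y) with h | h
  · obtain ⟨x, hx, hyx⟩ := P.exists_adj_of_BC hG hs h
    exact false_of hG hv hx h (bit_true (adj_of hG hv hx (by decide +kernel))) (bit_true hyx.symm)
      (bit_false hy) ((by decide +kernel : ∀ i,
        SimpleGraph.good .U .A (.BC i) true true false = false) i)
  · exact hy (adj_of hG hv rfl h)

-- The special indices are `i` for the nested pair and `j` for `F`. Types `A` and `AA i` together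
-- form the clique A, and `BC i` joins `B i`; these two unions are the nested pair. The adjacencies
-- not forced by pairs of types follow from a third vertex, either `w` or a type `A` neighbour of a
-- vertex of type `BC i`.
set_option synthInstance.maxSize 1000 in
theorem isFiveBasket_of_AA (hw : P.code w = .AA i) : G.IsFiveBasket := by
  obtain ⟨j, hj⟩ := P.exists_forall_F hG
  have hA := fun v => P.code_mem_types₃ hG hs hw v
  have hU := fun v => P.code_ne_U_of_AA hG hs hu hw v
  have hpart : IsPartitionOf Set.univ fun k => {v | P.code v ∈ basketTypes i j k} := by
    refine isPartitionOf_of_types _ _ ?_ ?_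
    · exact (by decide +kernel : ∀ i j k l, k ≠ l → ∀ s ∈ basketTypes i j k,
        s ∉ basketTypes i j l) i j
    · intro v
      have key : ∀ i j, ∀ s ∈ types₃ i, s = .U ∨ (∃ k, s = .F k ∧ k ≠ j) ∨
        ∃ k, s ∈ basketTypes i j k := by decide +kernel
      rcases key i j _ (hA v) with h | ⟨k, h, h'⟩ | h
      · exact absurd h (hU v)
      · exact absurd (hj v k h) h'
      · exact h
  have hadj : ∀ k l, (∀ i j : Fin 3, ∀ s ∈ basketTypes i j k, ∀ t ∈ basketTypes i j l,
      SimpleGraph.good s t t false true false = false) → ∀ x, P.code x ∈ basketTypes i j k →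
      ∀ y, P.code y ∈ basketTypes i j l → G.CAdj x y :=
    fun k l h x hx y hy => adj_of hG rfl rfl (h i j _ hx _ hy)
  have hnadj : ∀ k l, (∀ i j : Fin 3, ∀ s ∈ basketTypes i j k, ∀ t ∈ basketTypes i j l,
      SimpleGraph.good s t t true true true = false) → ∀ x, P.code x ∈ basketTypes i j k →
      ∀ y, P.code y ∈ basketTypes i j l → ¬ G.CAdj x y :=
    fun k l h x hx y hy => not_adj_of hG rfl rfl (h i j _ hx _ hy)
  -- Here `w` is adjacent to both `x` and `y`, and their nonadjacency would complete a forbidden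
  -- pattern.
  have hAB : ∀ x y k, P.code x = .A → P.code y = .B k → k ≠ i → G.CAdj x y := by
    intro x y k hx hy hk
    have key : ∀ i k : Fin 3, k ≠ i → SimpleGraph.good (.AA i) .A (.B k) true false true = false ∧
        SimpleGraph.good (.AA i) .A .A false true false = false ∧
        SimpleGraph.good (.AA i) (.B k) (.B k) false true false = false := by
      decide +kernel
    obtain ⟨k1, k2, k3⟩ := key i k hk
    by_contra hxy
    exact false_of hG hw hx hy (bit_true (adj_of hG hw hx k2)) (bit_false hxy)
      (bit_true (adj_of hG hw hy k3)) k1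
  -- The vertex `w` misses `y`. It sees `x` whenever k ≠ i; for k = i both possibilities are
  -- excluded.
  have hBC : ∀ x y k, P.code x = .B k → P.code y = .C k → G.CAdj x y := by
    intro x y k hx hy
    by_contra hxy
    have hwy : ¬ G.CAdj w y := not_adj_of hG hw hy
      ((by decide +kernel : ∀ i k, SimpleGraph.good (.AA i) (.C k) (.C k) true true true = false) i k)
    have key : ∀ i k e, (k = i ∨ e = true) →
        SimpleGraph.good (.AA i) (.B k) (.C k) e false false = false := by
      decide +kernel
    by_cases hwx : G.CAdj w x
    · exact false_of hG hw hx hy (bit_true hwx) (bit_false hxy) (bit_false hwy)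
        (key i k true (Or.inr rfl))
    · by_cases hk : k = i
      · exact false_of hG hw hx hy (bit_false hwx) (bit_false hxy) (bit_false hwy)
          (key i k false (Or.inl hk))
      · refine hwx (adj_of hG hw hx ?_)
        exact (by decide +kernel : ∀ i k : Fin 3, k ≠ i →
          SimpleGraph.good (.AA i) (.B k) (.B k) false true false = false) i k hk
  have hFBC : ∀ x y, P.code x = .F j → P.code y = .BC i → i ≠ j → G.CAdj x y := by
    intro x y hx hy hij
    obtain ⟨z, hz, hyz⟩ := P.exists_adj_of_BC hG hs hy
    have key : ∀ i j : Fin 3, i ≠ j → SimpleGraph.good .A (.BC i) (.F j) true false true = false ∧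
        SimpleGraph.good .A (.F j) (.F j) false true false = false := by
      decide +kernel
    obtain ⟨k1, k2⟩ := key i j hij
    by_contra hxy
    exact false_of hG hz hy hx (bit_true hyz.symm) (bit_false (mt CAdj.symm hxy))
      (bit_true (adj_of hG hz hx k2)) k1
  have hB : ∀ k s, s ∈ basketTypes i j (.inr (.inl k)) → s = .B k ∨ s = .BC k ∧ k = i := by
    intro k s hk
    simp only [basketTypes] at hk
    split_ifs at hk with h
    · simpa [h] using hk
    · exact Or.inl (by simpa using hk)
  have hBmem : ∀ k, P.code (P.b k) ∈ basketTypes i j (.inr (.inl k)) := by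
    intro k
    rw [P.code_b]
    simp only [basketTypes]
    split_ifs <;> simp
  refine ⟨{v | P.code v ∈ basketTypes i j (.inl 0)},
    fun k => {v | P.code v ∈ basketTypes i j (.inr (.inl k))},
    fun k => {v | P.code v ∈ basketTypes i j (.inr (.inr k))},
    {v | P.code v ∈ basketTypes i j (.inl 1)}, ?_⟩
  have hdisj := fun k l (h : k ≠ l) => hpart.1 h
  refine
    { partition := ?_
      nonempty_A := ⟨P.a, by simp [basketTypes, P.code_a]⟩
      nonempty_B := fun k => ⟨P.b k, hBmem k⟩
      nonempty_C := fun k => ⟨P.c k, by simp [basketTypes, P.code_c]⟩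
      clique_A := isClique_of_cadj (hadj _ _ (by decide +kernel))
      clique_B := fun k => isClique_of_cadj (hadj _ _ (by revert k; decide +kernel))
      clique_C := fun k => isClique_of_cadj (hadj _ _ (by revert k; decide +kernel))
      clique_F := isClique_of_cadj (hadj _ _ (by decide +kernel))
      B_anticomplete_B := fun k l hkl => anticompleteTo_of_not_cadj
        (hnadj _ _ (by revert k l; decide +kernel))
      C_complete_C := fun k l hkl => completeTo_of_cadj (hdisj _ _ (by simpa using hkl))
        (hadj _ _ (by clear hkl; revert k l; decide +kernel))
      exists_i := ⟨i, fun k hk => completeTo_of_cadj (hdisj _ _ (by simp)) ?_, ?_⟩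
      A_anticomplete_C := fun k => anticompleteTo_of_not_cadj
        (hnadj _ _ (by revert k; decide +kernel))
      B_complete_C := fun k => completeTo_of_cadj (hdisj _ _ (by simp)) ?_
      B_anticomplete_C := fun k l hkl => anticompleteTo_of_not_cadj
        (hnadj _ _ (by revert k l; decide +kernel))
      exists_j := ⟨j, completeTo_of_cadj (hdisj _ _ (by simp)) (hadj _ _ (by decide +kernel)),
        fun k hk => ⟨completeTo_of_cadj (hdisj _ _ (by simp)) ?_,
          completeTo_of_cadj (hdisj _ _ (by simp)) ?_⟩,
        anticompleteTo_of_not_cadj ?_, anticompleteTo_of_not_cadj ?_⟩ }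
  · convert hpart using 1
    funext k
    rcases k with k | k | k
    · fin_cases k <;> rfl
    · rfl
    · rfl
  · intro x hx y hy
    rcases hB k _ hy with h | ⟨-, h⟩
    · rcases List.mem_cons.1 hx with h' | h'
      · exact hAB x y k h' h hk
      · exact adj_of hG (List.mem_singleton.1 h') h ((by decide +kernel : ∀ i k : Fin 3, k ≠ i →
          SimpleGraph.good (.AA i) (.B k) (.B k) false true false = false) i k hk)
    · exact absurd h hk
  · refine exists_isNestedOrdering hG (hadj _ _ (by decide +kernel))
      (hadj _ _ (by clear * -; revert i; decide +kernel)) (hdisj _ _ (by simp))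
      ⟨P.a, by simp [basketTypes, P.code_a]⟩ ?_
    intro y hy
    rcases hB i _ hy with h | ⟨h, -⟩
    · exact ⟨P.a, by simp [basketTypes, P.code_a], ((P.code_fst_iff y).1 (by rw [h]; rfl)).symm⟩
    · obtain ⟨x, hx, hyx⟩ := P.exists_adj_of_BC hG hs h
      exact ⟨x, by simp [basketTypes, hx], hyx.symm⟩
  · intro x hx y hy
    rcases hB k _ hx with h | ⟨h, -⟩
    · exact hBC x y k h (List.mem_singleton.1 hy)
    · exact adj_of hG h (List.mem_singleton.1 hy) ((by decide +kernel : ∀ k,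
        SimpleGraph.good (.BC k) (.C k) (.C k) false true false = false) k)
  · intro x hx y hy
    rcases hB k _ hy with h | ⟨h, h'⟩
    · exact adj_of hG (List.mem_singleton.1 hx) h ((by decide +kernel : ∀ j k : Fin 3, k ≠ j →
        SimpleGraph.good (.F j) (.B k) (.B k) false true false = false) j k hk)
    · subst h'
      exact hFBC x y (List.mem_singleton.1 hx) h hk
  · intro x hx y hy
    exact adj_of hG (List.mem_singleton.1 hx) (List.mem_singleton.1 hy)
      ((by decide +kernel : ∀ j k : Fin 3, k ≠ j →
        SimpleGraph.good (.F j) (.C k) (.C k) false true false = false) j k hk)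
  · intro x hx y hy
    rcases hB j _ hy with h | ⟨h, -⟩
    · exact not_adj_of hG (List.mem_singleton.1 hx) h ((by decide +kernel : ∀ j : Fin 3,
        SimpleGraph.good (.F j) (.B j) (.B j) true true true = false) j)
    · exact not_adj_of hG (List.mem_singleton.1 hx) h ((by decide +kernel : ∀ j : Fin 3,
        SimpleGraph.good (.F j) (.BC j) (.BC j) true true true = false) j)
  · intro x hx y hy
    exact not_adj_of hG (List.mem_singleton.1 hx) (List.mem_singleton.1 hy)
      ((by decide +kernel : ∀ j : Fin 3,
        SimpleGraph.good (.F j) (.C j) (.C j) true true true = false) j)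

end
end Pent
end
section
variable {V : Type*} {G : SimpleGraph V}
namespace Pent
variable {P : Pent G (Fin 3)} {w x y z : V} {s t u : Code (Fin 3)} {i j : Fin 3}

/-! ### Graphs in which no vertex has type `AA i` -/

section
variable [Finite V] (hG : G.PatternFree) (hs : ∀ v, ¬ G.IsSimplicialVertex v)
  (hno : ∀ (P : Pent G (Fin 3)) v i, P.code v ≠ .AA i)
include hG hs hno

/-- With `x` of type `A` adjacent to `v`, the vertices `x` and `v` can replace `a` and `b i`. In the
new pentagon the old `a` has type `AA i`, since it misses `v`. -/
theorem code_ne_BC (P : Pent G (Fin 3)) (v : V) (i : Fin 3) : P.code v ≠ .BC i := by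
  intro hv
  obtain ⟨x, hx, hvx⟩ := P.exists_adj_of_BC hG hs hv
  obtain ⟨-, hx1, hx2⟩ := (P.code_eq_iff _ _).1 hx
  obtain ⟨hv0, hv1, hv2⟩ := (P.code_eq_iff _ _).1 hv
  let Q := P.replace i x v (fun j _ => (hx1 j).2 rfl) (fun j => by simp [hx2, Code.A]) hvx.symm
    (fun j hj => by simp [hv1, Code.BC, hj]) (by simp [hv2, Code.BC])
    (fun j hj => by simp [hv2, Code.BC, hj])
  refine hno Q P.a i ((Q.code_eq_iff _ _).2 ⟨iff_of_true ?_ rfl, fun j => ?_, fun j => ?_⟩)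
  · exact adj_of hG P.code_a hx (by decide +kernel)
  · change G.CAdj P.a (Function.update P.b i v j) ↔ _
    by_cases h : j = i
    · subst h
      simpa [Code.AA, Code.BC] using mt CAdj.symm (fun h => Bool.false_ne_true (hv0.1 h))
    · simpa [Code.AA, h] using P.ab j
  · exact iff_of_false (P.ac j) Bool.false_ne_true

theorem code_mem_types₄ (P : Pent G (Fin 3)) (v : V) : P.code v ∈ types₄ := by
  have key : ∀ s ∈ types₂, s ∈ types₄ ∨ ∃ i, s = .AA i ∨ s = .BC i := by
    decide +kernel
  rcases key _ (P.code_mem_types₂ hG hs v) with h | ⟨i, h | h⟩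
  · exact h
  · exact absurd h (hno P v i)
  · exact absurd h (P.code_ne_BC hG hs hno v i)

omit hG hs [Finite V] in
-- If they were nonadjacent, replacing `b i` by `y` would give `x` the type `AA i`.
theorem adj_A_B (hx : P.code x = .A) (hy : P.code y = .B i) : G.CAdj x y := by
  obtain ⟨hx0, hx1, hx2⟩ := (P.code_eq_iff _ _).1 hx
  obtain ⟨hy0, hy1, hy2⟩ := (P.code_eq_iff _ _).1 hy
  let Q := P.replace i P.a y (fun j _ => P.ab j) P.ac (CAdj.symm (hy0.2 rfl))
    (fun j hj => by simp [hy1, Code.B, hj]) (by simp [hy2, Code.B])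
    (fun j hj => by simp [hy2, Code.B, hj])
  by_contra hxy
  refine hno Q x i ((Q.code_eq_iff _ _).2 ⟨hx0, fun j => ?_, hx2⟩)
  change G.CAdj x (Function.update P.b i y j) ↔ _
  by_cases h : j = i
  · subst h
    simpa [Code.AA] using hxy
  · simpa [Code.AA, h] using (hx1 j).2 rfl

omit hno in
-- If they were nonadjacent, replacing `a` by `x` would give `y` the excluded type `Zb i`.
theorem adj_A_AB (hx : P.code x = .A) (hy : P.code y = .AB i) : G.CAdj x y := by
  obtain ⟨hx0, hx1, hx2⟩ := (P.code_eq_iff _ _).1 hx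
  obtain ⟨hy0, hy1, hy2⟩ := (P.code_eq_iff _ _).1 hy
  let Q := P.replace i x (P.b i) (fun j _ => (hx1 j).2 rfl) (fun j => by simp [hx2, Code.A])
    ((hx1 i).2 rfl) (fun j hj => P.bb i j hj.symm) (P.bc i) (fun j hj => P.bc_ne i j hj.symm)
  by_contra hxy
  refine Q.code_ne_Zb hG hs y i ((Q.code_eq_iff _ _).2 ⟨?_, fun j => ?_, hy2⟩)
  · exact iff_of_false (mt CAdj.symm hxy) Bool.false_ne_true
  · change G.CAdj y (Function.update P.b i (P.b i) j) ↔ _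
    rw [Function.update_eq_self]
    exact hy1 j

omit hs hno [Finite V] in
theorem adj_of_C_AB_UF (hy : P.code y = .AB i) (hz : P.code z = .C i) (hyz : G.CAdj y z)
    (hx : P.code x = .U ∨ ∃ j ≠ i, P.code x = .F j) : G.CAdj y x := by
  have key : ∀ i : Fin 3, ∀ s ∈ [.U] ++ typesF' i,
      SimpleGraph.good (.C i) (.AB i) s true false true = false ∧
      SimpleGraph.good (.C i) s s false true false = false := by
    decide +kernel
  have hmem : P.code x ∈ [.U] ++ typesF' i := by
    rcases hx with h | ⟨j, hj, h⟩ <;> rw [h]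
    · simp
    · clear * - hj; revert i j; decide +kernel
  obtain ⟨k1, k2⟩ := key i _ hmem
  by_contra hyx
  exact false_of hG hz hy rfl (bit_true hyz.symm) (bit_false hyx) (bit_true (adj_of hG hz rfl k2)) k1

/-- Without type `F i`, the vertices of type `AB i` with no neighbour of type `C i` could be
eliminated. The other vertices of type `AB i` satisfy `hl` by `adj_of_C_AB_UF`, and `isAAndB`
records adjacencies that were obtained by changing the pentagon and are not visible to `good`. -/
theorem exists_F_of_AB (hy : P.code y = .AB i) (hyC : ∀ z, P.code z = .C i → ¬ G.CAdj y z) :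
    ∃ f, P.code f = .F i := by
  by_contra! hF
  refine P.elim hG hs (κ := [.AB i]) (ν := [.AB i, .B i, .A, .U] ++ typesF' i)
    (l := [.U] ++ typesF' i) (known := isAAndB) (by clear * -; revert i; decide +kernel)
    ?_ (fun v => P.code v = .AB i ∧ ∀ z, P.code z = .C i → ¬ G.CAdj v z)
    (fun v hv => by simp [hv]) ?_ ?_ y ⟨hy, hyC⟩
  · intro x y h
    simp only [isAAndB, Bool.and_eq_true, beq_iff_eq, List.contains_iff_mem] at h
    have h2 : ∃ i, P.code y = .AB i ∨ P.code y = .B i := by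
      have h2 := h.2
      simp only [List.mem_cons, List.not_mem_nil, or_false] at h2
      rcases h2 with h | h | h | h | h | h
      exacts [⟨_, Or.inl h⟩, ⟨_, Or.inl h⟩, ⟨_, Or.inl h⟩, ⟨_, Or.inr h⟩, ⟨_, Or.inr h⟩,
        ⟨_, Or.inr h⟩]
    obtain ⟨k, hk | hk⟩ := h2
    · exact adj_A_AB hG hs h.1 hk
    · exact adj_A_B hno h.1 hk
  · rintro k ⟨hk, hk'⟩ y hky
    have key : nbrCheck types₄ [.AB i] ([.C i, .F i, .AB i, .B i, .A, .U] ++ typesF' i) = true := by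
      clear * -; revert i; decide +kernel
    have h := P.mem_of_nbrCheck hG key (by simp [hk]) (P.code_mem_types₄ hG hs hno y) hky
    rcases List.mem_cons.1 h with h | h
    · exact absurd hky (hk' y h)
    · exact (List.mem_cons.1 h).resolve_left (hF y)
  · rintro k - x z - hx hx' hz
    have hx := List.mem_singleton.1 hx
    have : ∃ c, P.code c = .C i ∧ G.CAdj x c := by
      by_contra! h
      exact hx' ⟨hx, h⟩
    obtain ⟨c, hc, hxc⟩ := this
    refine adj_of_C_AB_UF hG hx hc hxc ?_
    exact (by clear * -; revert i; decide +kernel : ∀ s ∈ [.U] ++ typesF' i, s = .U ∨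
      ∃ j ≠ i, s = .F j) _ hz

/-- A third vertex forces the adjacency: a neighbour of `y` of type `C i` if there is one, and
otherwise a vertex of type `F i`. -/
theorem adj_U_AB (hx : P.code x = .U) (hy : P.code y = .AB i) : G.CAdj x y := by
  by_cases h : ∃ z, P.code z = .C i ∧ G.CAdj y z
  · obtain ⟨z, hz, hyz⟩ := h
    exact (adj_of_C_AB_UF hG hy hz hyz (Or.inl hx)).symm
  · push Not at h
    obtain ⟨f, hf⟩ := exists_F_of_AB hG hs hno hy h
    have key : ∀ i, SimpleGraph.good .U (.AB i) (.F i) false true true = false ∧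
        SimpleGraph.good (.AB i) (.F i) (.F i) false true false = false ∧
        SimpleGraph.good .U (.F i) (.F i) false true false = false := by
      decide +kernel
    obtain ⟨k1, k2, k3⟩ := key i
    by_contra hxy
    exact false_of hG hx hy hf (bit_false hxy) (bit_true (adj_of hG hy hf k2))
      (bit_true (adj_of hG hx hf k3)) k1

end
end Pent
end
/-! ### Larger pentagons -/

/-- The restriction of a type to a smaller pentagon. -/
def Code.comp {ι κ : Type*} (s : Code ι) (e : κ → ι) : Code κ := (s.1, s.2.1 ∘ e, s.2.2 ∘ e)

/-- A family of types, defined for all pentagons and compatible with restrictions. -/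
structure CodeFamily where
  toFun : (ι : Type) → [DecidableEq ι] → ι → Code ι
  comp_eq : ∀ (ι κ : Type) [DecidableEq ι] [DecidableEq κ] (e : κ → ι) (k : κ),
    Function.Injective e → (toFun ι (e k)).comp e = toFun κ k

namespace CodeFamily
def Za : CodeFamily := ⟨fun _ _ _ => .Za, fun _ _ _ _ _ _ _ => rfl⟩
def A : CodeFamily := ⟨fun _ _ _ => .A, fun _ _ _ _ _ _ _ => rfl⟩
def C0 : CodeFamily := ⟨fun _ _ _ => .C0, fun _ _ _ _ _ _ _ => rfl⟩
def U : CodeFamily := ⟨fun _ _ _ => .U, fun _ _ _ _ _ _ _ => rfl⟩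
def AB : CodeFamily := ⟨fun _ _ => .AB, fun _ _ _ _ e k he => by
  simp [Code.comp, Code.AB, Function.comp_def, he.eq_iff]⟩
def B : CodeFamily := ⟨fun _ _ => .B, fun _ _ _ _ e k he => by
  simp [Code.comp, Code.B, Function.comp_def, he.eq_iff]⟩
def F : CodeFamily := ⟨fun _ _ => .F, fun _ _ _ _ e k he => by
  simp [Code.comp, Code.F, Function.comp_def, he.eq_iff]⟩
def C : CodeFamily := ⟨fun _ _ => .C, fun _ _ _ _ e k he => by
  simp [Code.comp, Code.C, Function.comp_def, he.eq_iff]⟩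
end CodeFamily

/-- Three attached vertices with indexed types involve at most three indices, so statements about
them can be checked in a 3-pentagon. -/
theorem exists_fin_three_embedding {t : ℕ} (ht : 3 ≤ t) (i j m : Fin t) :
    ∃ e : Fin 3 → Fin t, Function.Injective e ∧ ∃ k l n, e k = i ∧ e l = j ∧ e n = m := by
  classical
  obtain ⟨s, hs, hcard⟩ := Finset.exists_superset_card_eq
    (s := ({i, j, m} : Finset (Fin t))) (n := 3) Finset.card_le_three (by simpa using ht)
  have e := s.equivFinOfCardEq hcard
  refine ⟨fun k => e.symm k, fun k l h => e.symm.injective (Subtype.ext h),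
    e ⟨i, hs (by simp)⟩, e ⟨j, hs (by simp)⟩, e ⟨m, hs (by simp)⟩, ?_⟩
  simp

section
variable {V : Type*} {G : SimpleGraph V}

theorem PatternFree.twoP3 (hG : G.PatternFree) {x y z x' y' z' : V} (hxy : G.CAdj x y)
    (hyz : G.CAdj y z) (hxz : ¬ G.CAdj x z) (hxy' : G.CAdj x' y') (hyz' : G.CAdj y' z')
    (hxz' : ¬ G.CAdj x' z') (h : ∀ u ∈ [x, y, z], ∀ v ∈ [x', y', z'], ¬ G.CAdj u v) : False := by
  refine hG patternTwoP3 (by simp [patterns]) ⟨fun i => [x, y, z, x', y', z'].getD i x, ?_⟩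
  have h' : ∀ v ∈ [x', y', z'], ∀ u ∈ [x, y, z], ¬ G.CAdj v u :=
    fun v hv u hu => mt CAdj.symm (h u hu v hv)
  have hxz1 := mt CAdj.symm hxz
  have hxz1' := mt CAdj.symm hxz'
  simp only [List.mem_cons, List.not_mem_nil, or_false, forall_eq_or_imp, forall_eq] at h h'
  intro i hi j hj
  simp only [patternTwoP3, List.length_cons, List.length_nil] at hi hj
  interval_cases i <;> interval_cases j <;>
    simp [entry, patternTwoP3, Nat.testBit, CAdj.refl, hxy.symm, hyz.symm, hxy'.symm, hyz'.symm, *]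

namespace Pent
/-- The pentagon obtained by restricting the index set. -/
def sub {ι κ : Type*} (P : Pent G ι) (e : κ → ι) (he : Function.Injective e) : Pent G κ where
  a := P.a
  b := P.b ∘ e
  c := P.c ∘ e
  ab _ := P.ab _
  ac _ := P.ac _
  bb _ _ h := P.bb _ _ (he.ne h)
  cc _ _ := P.cc _ _
  bc _ := P.bc _
  bc_ne _ _ h := P.bc_ne _ _ (he.ne h)

theorem code_sub {ι κ : Type*} (P : Pent G ι) (e : κ → ι) (he : Function.Injective e) (v : V) :
    (P.sub e he).code v = (P.code v).comp e := rfl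

/-- Add an index to a pentagon. -/
def cons {t : ℕ} (P : Pent G (Fin t)) (y z : V) (hy : P.code y = .Za) (hz : P.code z = .C0)
    (hyz : G.CAdj y z) : Pent G (Fin (t + 1)) where
  a := P.a
  b := Fin.cons y P.b
  c := Fin.cons z P.c
  ab i := by
    refine Fin.cases ?_ (fun i => ?_) i
    · exact CAdj.symm (((P.code_eq_iff _ _).1 hy).1.2 rfl)
    · simpa using P.ab i
  ac i := by
    refine Fin.cases ?_ (fun i => ?_) i
    · exact mt CAdj.symm fun h => Bool.false_ne_true (((P.code_eq_iff _ _).1 hz).1.1 h)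
    · simpa using P.ac i
  bb i j := by
    have h : ∀ i, ¬ G.CAdj y (P.b i) := fun i h =>
      Bool.false_ne_true ((((P.code_eq_iff _ _).1 hy).2.1 i).1 h)
    refine Fin.cases (Fin.cases (by simp) (fun j _ => by simpa using h j) j)
      (fun i => Fin.cases (fun _ => by simpa using mt CAdj.symm (h i))
        (fun j hij => by simpa using P.bb i j (by simpa using hij)) j) i
  cc i j := by
    have h : ∀ i, G.CAdj z (P.c i) := fun i => (((P.code_eq_iff _ _).1 hz).2.2 i).2 rfl
    refine Fin.cases (Fin.cases (CAdj.refl _) (fun j => by simpa using h j) j)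
      (fun i => Fin.cases (by simpa using (h i).symm) (fun j => by simpa using P.cc i j) j) i
  bc i := by
    refine Fin.cases ?_ (fun i => ?_) i
    · exact hyz
    · simpa using P.bc i
  bc_ne i j := by
    have h : ∀ i, ¬ G.CAdj y (P.c i) := fun i h =>
      Bool.false_ne_true ((((P.code_eq_iff _ _).1 hy).2.2 i).1 h)
    have h' : ∀ i, ¬ G.CAdj (P.b i) z := fun i h =>
      Bool.false_ne_true ((((P.code_eq_iff _ _).1 hz).2.1 i).1 h.symm)
    refine Fin.cases (Fin.cases (by simp) (fun j _ => by simpa using h j) j)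
      (fun i => Fin.cases (fun _ => by simpa using h' i)
        (fun j hij => by simpa using P.bc_ne i j (by simpa using hij)) j) i

section
variable {t : ℕ} {P : Pent G (Fin t)} {x y z : V} {i j m : Fin t}

/-- Restricting to a 3-pentagon replaces `i, j, m` by some `k, l, n` in `Fin 3`. The finite check
covers all such triples with the same coincidences between consecutive indices. -/
theorem false_of_family (hG : G.PatternFree) (ht : 3 ≤ t) (f g h : CodeFamily) (i j m : Fin t)
    (hx : P.code x = f.toFun _ i) (hy : P.code y = g.toFun _ j) (hz : P.code z = h.toFun _ m)
    {st tu su : Bool} (hst : st = true ↔ G.CAdj x y) (htu : tu = true ↔ G.CAdj y z)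
    (hsu : su = true ↔ G.CAdj x z)
    (hbad : ∀ k l n : Fin 3, (k = l ↔ i = j) → (l = n ↔ j = m) →
      SimpleGraph.good (f.toFun _ k) (g.toFun _ l) (h.toFun _ n) st tu su = false) : False := by
  obtain ⟨e, he, k, l, n, rfl, rfl, rfl⟩ := exists_fin_three_embedding ht i j m
  refine false_of hG (P := P.sub e he) (s := f.toFun _ k) (t := g.toFun _ l) (u := h.toFun _ n)
    ?_ ?_ ?_ hst htu hsu (hbad k l n he.eq_iff.symm he.eq_iff.symm)
  · rw [code_sub, hx, f.comp_eq _ _ _ _ he]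
  · rw [code_sub, hy, g.comp_eq _ _ _ _ he]
  · rw [code_sub, hz, h.comp_eq _ _ _ _ he]

theorem adj_fam (hG : G.PatternFree) (ht : 3 ≤ t) (f g : CodeFamily) (i j : Fin t)
    (hx : P.code x = f.toFun _ i) (hy : P.code y = g.toFun _ j)
    (h : ∀ k l : Fin 3, SimpleGraph.good (f.toFun _ k) (g.toFun _ l) (g.toFun _ l)
      false true false = false) : G.CAdj x y := by
  by_contra hxy
  refine false_of_family hG ht f g g i j j hx hy hy (bit_false hxy) (bit_true (.refl y))
    (bit_false hxy) fun k l n _ h2 => ?_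
  obtain rfl := h2.2 rfl
  exact h k l

theorem adj_fam_eq (hG : G.PatternFree) (ht : 3 ≤ t) (f g : CodeFamily) (i : Fin t)
    (hx : P.code x = f.toFun _ i) (hy : P.code y = g.toFun _ i)
    (h : ∀ k : Fin 3, SimpleGraph.good (f.toFun _ k) (g.toFun _ k) (g.toFun _ k)
      false true false = false) : G.CAdj x y := by
  by_contra hxy
  refine false_of_family hG ht f g g i i i hx hy hy (bit_false hxy) (bit_true (.refl y))
    (bit_false hxy) fun k l n h1 h2 => ?_
  obtain rfl := h1.2 rfl
  obtain rfl := h2.2 rfl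
  exact h k

theorem adj_fam_ne (hG : G.PatternFree) (ht : 3 ≤ t) (f g : CodeFamily) {i j : Fin t} (hij : i ≠ j)
    (hx : P.code x = f.toFun _ i) (hy : P.code y = g.toFun _ j)
    (h : ∀ k l : Fin 3, k ≠ l → SimpleGraph.good (f.toFun _ k) (g.toFun _ l) (g.toFun _ l)
      false true false = false) : G.CAdj x y := by
  by_contra hxy
  refine false_of_family hG ht f g g i j j hx hy hy (bit_false hxy) (bit_true (.refl y))
    (bit_false hxy) fun k l n h1 h2 => ?_
  obtain rfl := h2.2 rfl
  exact h k l (mt h1.1 hij)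

theorem not_adj_fam (hG : G.PatternFree) (ht : 3 ≤ t) (f g : CodeFamily) (i j : Fin t)
    (hx : P.code x = f.toFun _ i) (hy : P.code y = g.toFun _ j)
    (h : ∀ k l : Fin 3, SimpleGraph.good (f.toFun _ k) (g.toFun _ l) (g.toFun _ l)
      true true true = false) : ¬ G.CAdj x y := by
  intro hxy
  refine false_of_family hG ht f g g i j j hx hy hy (bit_true hxy) (bit_true (.refl y))
    (bit_true hxy) fun k l n _ h2 => ?_
  obtain rfl := h2.2 rfl
  exact h k l

theorem not_adj_fam_eq (hG : G.PatternFree) (ht : 3 ≤ t) (f g : CodeFamily) (i : Fin t)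
    (hx : P.code x = f.toFun _ i) (hy : P.code y = g.toFun _ i)
    (h : ∀ k : Fin 3, SimpleGraph.good (f.toFun _ k) (g.toFun _ k) (g.toFun _ k)
      true true true = false) : ¬ G.CAdj x y := by
  intro hxy
  refine false_of_family hG ht f g g i i i hx hy hy (bit_true hxy) (bit_true (.refl y))
    (bit_true hxy) fun k l n h1 h2 => ?_
  obtain rfl := h1.2 rfl
  obtain rfl := h2.2 rfl
  exact h k

theorem not_adj_fam_ne (hG : G.PatternFree) (ht : 3 ≤ t) (f g : CodeFamily) {i j : Fin t}
    (hij : i ≠ j) (hx : P.code x = f.toFun _ i) (hy : P.code y = g.toFun _ j)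
    (h : ∀ k l : Fin 3, k ≠ l → SimpleGraph.good (f.toFun _ k) (g.toFun _ l) (g.toFun _ l)
      true true true = false) : ¬ G.CAdj x y := by
  intro hxy
  refine false_of_family hG ht f g g i j j hx hy hy (bit_true hxy) (bit_true (.refl y))
    (bit_true hxy) fun k l n h1 h2 => ?_
  obtain rfl := h2.2 rfl
  exact h k l (mt h1.1 hij)

/-! ### Types with respect to a t-pentagon -/

section
variable [Finite V] (hG : G.PatternFree) (hs : ∀ v, ¬ G.IsSimplicialVertex v)
  (hno : ∀ (P : Pent G (Fin 3)) v i, P.code v ≠ .AA i)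
include hG hs hno

-- The restriction of the type to any three indices is in `types₄`. These local conditions determine
-- the global type, except that they allow type `F` to miss several indices.
set_option synthInstance.maxSize 1000 in
theorem code_cases (ht : 3 ≤ t) (P : Pent G (Fin t)) (v : V) :
    (P.code v = .Za ∨ P.code v = .A ∨ P.code v = .C0 ∨ P.code v = .U) ∨
      ∃ i, P.code v = .AB i ∨ P.code v = .B i ∨ P.code v = .F i ∨ P.code v = .C i := by
  rcases hc : P.code v with ⟨p, S, T⟩
  have h3 : ∀ i j : Fin t, ∃ k, k ≠ i ∧ k ≠ j := by
    intro i j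
    obtain ⟨e, he, k, l, -, rfl, rfl, -⟩ := exists_fin_three_embedding ht i j j
    obtain ⟨n, hn, hn'⟩ := (by decide : ∀ k l : Fin 3, ∃ n, n ≠ k ∧ n ≠ l) k l
    exact ⟨e n, he.ne hn, he.ne hn'⟩
  have hmem : ∀ i j k, i ≠ j → i ≠ k → j ≠ k →
      (p, ![S i, S j, S k], ![T i, T j, T k]) ∈ types₄ := by
    intro i j k hij hik hjk
    have hinj : Function.Injective ![i, j, k] := by
      intro a b hab
      fin_cases a <;> fin_cases b <;> simp_all
    have h := (P.sub _ hinj).code_mem_types₄ hG hs hno v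
    rw [code_sub, hc] at h
    convert h using 1
    refine Prod.ext rfl (Prod.ext ?_ ?_) <;> funext a <;> fin_cases a <;> rfl
  -- If `a` is missed, every `c` is seen and at most one `b`. If `a` and some `c i` are seen, then
  -- so is `b i`, and the same indices occur among the `b` and the `c`. If `a` is seen but not the
  -- first `c`, seeing the first two `b` implies seeing the third.
  have key : ∀ p s s' s'' t t' t'' : Bool, ((p, ![s, s', s''], ![t, t', t'']) : Code _) ∈ types₄ →
      (p = false → t = true ∧ (s = true → s' = false)) ∧
      (p = true → t = true → s = true ∧ s' = t') ∧
      (p = true → t = false → s = true → s' = true → s'' = true) := by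
    decide +kernel
  have key' : ∀ i j k, i ≠ j → i ≠ k → j ≠ k → _ :=
    fun i j k h1 h2 h3 => key _ _ _ _ _ _ _ (hmem i j k h1 h2 h3)
  clear key hmem
  rcases p with _ | _
  · have hT : T = fun _ => true := by
      funext i
      obtain ⟨j, hj, -⟩ := h3 i i
      obtain ⟨k, hk, hk'⟩ := h3 i j
      exact ((key' i j k hj.symm hk.symm hk'.symm).1 rfl).1
    subst hT
    by_cases hS : ∃ i, S i = true
    · obtain ⟨i, hi⟩ := hS
      refine Or.inr ⟨i, Or.inr (Or.inr (Or.inr (Prod.ext rfl (Prod.ext ?_ rfl))))⟩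
      funext j
      by_cases hji : j = i
      · simp [hji, hi, Code.C]
      · obtain ⟨k, hk, hk'⟩ := h3 i j
        simpa [hji, Code.C] using ((key' i j k (Ne.symm hji) hk.symm hk'.symm).1 rfl).2 hi
    · push Not at hS
      refine Or.inl (Or.inr (Or.inr (Or.inl (Prod.ext rfl (Prod.ext ?_ rfl)))))
      funext j
      simpa [Code.C0] using hS j
  · by_cases hT : ∃ i, T i = true
    · obtain ⟨i, hi⟩ := hT
      have hSi : S i = true := by
        obtain ⟨j, hj, -⟩ := h3 i i
        obtain ⟨k, hk, hk'⟩ := h3 i j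
        exact ((key' i j k hj.symm hk.symm hk'.symm).2.1 rfl hi).1
      have hST : S = T := by
        funext j
        by_cases hji : j = i
        · rw [hji, hi, hSi]
        · obtain ⟨k, hk, hk'⟩ := h3 i j
          exact ((key' i j k (Ne.symm hji) hk.symm hk'.symm).2.1 rfl hi).2
      subst hST
      by_cases hk : ∃ k, S k = false
      · obtain ⟨k, hk⟩ := hk
        refine Or.inr ?_
        by_cases hj : ∃ j, j ≠ i ∧ S j = true
        · obtain ⟨j, hji, hj⟩ := hj
          have hl : S = fun l => decide (l ≠ k) := by
            funext l
            by_cases hlk : l = k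
            · simp [hlk, hk]
            -- Two present indices `i, j` and two missing ones `k, l` are consistent on every
            -- triple, but the paths `b i, v, b j` and `b k, c k, c l` form a `2P₃`.
            · by_contra hl
              have hl : S l = false := by simpa [hlk] using hl
              have hb := P.code_b_iff v
              have hcc := P.code_c_iff v
              rw [hc] at hb hcc
              have hne : ∀ a b, S a = true → S b = false → a ≠ b := by
                rintro a b ha hb rfl
                simp [ha] at hb
              refine hG.twoP3 (x := P.b i) (y := v) (z := P.b j) (x' := P.b k) (y' := P.c k)
                (z' := P.c l) ((hb i).1 hSi).symm ((hb j).1 hj) (P.bb i j hji.symm) (P.bc k)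
                (P.cc k l) (P.bc_ne k l (Ne.symm hlk)) ?_
              simp only [List.mem_cons, List.not_mem_nil, or_false, forall_eq_or_imp, forall_eq,
                ← hb, ← hcc, hk, hl]
              exact ⟨⟨P.bb _ _ (hne _ _ hSi hk), P.bc_ne _ _ (hne _ _ hSi hk),
                P.bc_ne _ _ (hne _ _ hSi hl)⟩, by simp, P.bb _ _ (hne _ _ hj hk),
                P.bc_ne _ _ (hne _ _ hj hk), P.bc_ne _ _ (hne _ _ hj hl)⟩
          exact ⟨k, Or.inr (Or.inr (Or.inl (Prod.ext rfl (Prod.ext hl hl))))⟩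
        · push Not at hj
          have hl : S = fun l => decide (l = i) := by
            funext l
            by_cases hli : l = i
            · simp [hli, hSi]
            · simpa [hli] using hj l hli
          exact ⟨i, Or.inr (Or.inl (Prod.ext rfl (Prod.ext hl hl)))⟩
      · push Not at hk
        have hS : S = fun _ => true := by funext l; simpa using hk l
        exact Or.inl (Or.inr (Or.inr (Or.inr (Prod.ext rfl (Prod.ext hS hS)))))
    · push Not at hT
      have hT' : T = fun _ => false := by funext l; simpa using hT l
      subst hT'
      by_cases hS : ∃ i, S i = true
      · obtain ⟨i, hi⟩ := hS
        by_cases hj : ∃ j, j ≠ i ∧ S j = true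
        · obtain ⟨j, hji, hj⟩ := hj
          refine Or.inl (Or.inr (Or.inl (Prod.ext rfl (Prod.ext ?_ rfl))))
          funext k
          change S k = true
          by_cases hki : k = i
          · rw [hki, hi]
          by_cases hkj : k = j
          · rw [hkj, hj]
          exact (key' i j k hji.symm (Ne.symm hki) (Ne.symm hkj)).2.2 rfl rfl hi hj
        · push Not at hj
          refine Or.inr ⟨i, Or.inl (Prod.ext rfl (Prod.ext ?_ rfl))⟩
          funext l
          by_cases hli : l = i
          · simp [hli, hi, Code.AB]
          · simpa [hli, Code.AB] using hj l hli
      · push Not at hS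
        refine Or.inl (Or.inl (Prod.ext rfl (Prod.ext ?_ rfl)))
        funext l
        simpa [Code.Za] using hS l

end
end
end Pent
end
section
variable {V : Type*} {G : SimpleGraph V}
namespace Pent
variable {t : ℕ} {P : Pent G (Fin t)} {x y z : V} {i j m : Fin t}

/-! ### Vertices attached to a largest pentagon -/

theorem false_of_code_eq (ht : 3 ≤ t) (f g : CodeFamily) (i j : Fin t)
    (hx : P.code x = f.toFun _ i) (hy : P.code x = g.toFun _ j)
    (h : ∀ k l : Fin 3, f.toFun _ k ≠ g.toFun _ l) : False := by
  obtain ⟨e, he, k, l, -, rfl, rfl, -⟩ := exists_fin_three_embedding ht i j j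
  apply h k l
  rw [← f.comp_eq _ _ e k he, ← g.comp_eq _ _ e l he, ← hx, ← hy]

theorem exists_forall_F_fin (hG : G.PatternFree) (ht : 3 ≤ t) (P : Pent G (Fin t)) :
    ∃ j, ∀ v k, P.code v = .F k → k = j := by
  by_cases h : ∃ v j, P.code v = .F j
  · obtain ⟨v, j, hv⟩ := h
    refine ⟨j, fun v' k hv' => ?_⟩
    by_contra hkj
    exact not_adj_fam_ne hG ht .F .F hkj hv' hv (by decide +kernel)
      (adj_fam_ne hG ht .F .F hkj hv' hv (by decide +kernel))
  · push Not at h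
    exact ⟨⟨0, by omega⟩, fun v k hv => absurd hv (h v k)⟩

section
variable [Finite V] (hG : G.PatternFree) (hs : ∀ v, ¬ G.IsSimplicialVertex v)
  (hno : ∀ (P : Pent G (Fin 3)) v i, P.code v ≠ .AA i) (ht : 3 ≤ t)
include hG hs hno ht

omit hno in
theorem adj_A_AB_fin (hx : P.code x = .A) (hy : P.code y = .AB i) : G.CAdj x y := by
  obtain ⟨e, he, k, -, -, rfl, -, -⟩ := exists_fin_three_embedding ht i i i
  refine adj_A_AB (P := P.sub e he) (i := k) hG hs ?_ ?_
  · rw [code_sub, hx]; rfl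
  · rw [code_sub, hy]; exact CodeFamily.AB.comp_eq _ _ _ _ he

omit [Finite V] hG hs in
theorem adj_A_B_fin (hx : P.code x = .A) (hy : P.code y = .B i) : G.CAdj x y := by
  obtain ⟨e, he, k, -, -, rfl, -, -⟩ := exists_fin_three_embedding ht i i i
  refine adj_A_B (P := P.sub e he) (i := k) hno ?_ ?_
  · rw [code_sub, hx]; rfl
  · rw [code_sub, hy]; exact CodeFamily.B.comp_eq _ _ _ _ he

theorem adj_U_AB_fin (hx : P.code x = .U) (hy : P.code y = .AB i) : G.CAdj x y := by
  obtain ⟨e, he, k, -, -, rfl, -, -⟩ := exists_fin_three_embedding ht i i i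
  refine adj_U_AB (P := P.sub e he) (i := k) hG hs hno ?_ ?_
  · rw [code_sub, hx]; rfl
  · rw [code_sub, hy]; exact CodeFamily.AB.comp_eq _ _ _ _ he

theorem exists_F_of_AB_fin (hy : P.code y = .AB i)
    (hyC : ∀ z, P.code z = .C i → ¬ G.CAdj y z) : ∃ f, P.code f = .F i := by
  obtain ⟨e, he, k, -, -, rfl, -, -⟩ := exists_fin_three_embedding ht i i i
  obtain ⟨l, n, hkl, hkn, hln⟩ :=
    (by decide : ∀ k : Fin 3, ∃ l n, k ≠ l ∧ k ≠ n ∧ l ≠ n) k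
  obtain ⟨f, hf⟩ := exists_F_of_AB (P := P.sub e he) (y := y) (i := k) hG hs hno
    (by rw [code_sub, hy]; exact CodeFamily.AB.comp_eq _ _ _ _ he) (by
      intro z hz
      rcases P.code_cases hG hs hno ht z with (h | h | h | h) | ⟨m, h | h | h | h⟩ <;>
        rw [code_sub, h] at hz <;> have h1 := congrArg Prod.fst hz <;>
        have h2 := congrFun (congrArg (fun s => s.2.1) hz) k <;>
        simp [Code.comp, Code.Za, Code.A, Code.C0, Code.U, Code.AB, Code.B, Code.F, Code.C] at h1 h2
      rw [← h2] at h
      exact hyC z h)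
  refine ⟨f, ?_⟩
  rcases P.code_cases hG hs hno ht f with (h | h | h | h) | ⟨m, h | h | h | h⟩ <;>
    rw [code_sub, h] at hf <;> have h1 := congrArg Prod.fst hf <;>
    have h2 := congrFun (congrArg (fun s => s.2.1) hf) k <;>
    have h3 := congrFun (congrArg (fun s => s.2.2) hf) l <;>
    have h4 := congrFun (congrArg (fun s => s.2.2) hf) n <;>
    simp [Code.comp, Code.Za, Code.A, Code.C0, Code.U, Code.AB, Code.B, Code.F, Code.C, hkl.symm,
      hkn.symm] at h1 h2 h3 h4
  -- This is type `B m`, whose only index would have to be both `e l` and `e n`.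
  · exact absurd (he (h3.trans h4.symm)) hln
  · rw [h, h2]

/-- A neighbour of type `C0` would extend the pentagon by `cons`, contrary to maximality. The
remaining possible neighbours have type `Za`, `A`, `U` or `F`, and the last three kinds form a
clique, so a simplicial vertex would exist. -/
theorem code_ne_Za (hmax : IsEmpty (Pent G (Fin (t + 1)))) (P : Pent G (Fin t)) (v : V) :
    P.code v ≠ .Za := by
  intro hv
  let i₀ : Fin t := ⟨0, by omega⟩
  have hL : ∀ x y, (P.code x = .A ∨ P.code x = .U ∨ ∃ i, P.code x = .F i) →
      (P.code y = .A ∨ P.code y = .U ∨ ∃ i, P.code y = .F i) → G.CAdj x y := by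
    obtain ⟨j, hj⟩ := P.exists_forall_F_fin hG ht
    rintro x y (hx | hx | ⟨i, hx⟩) (hy | hy | ⟨k, hy⟩)
    · exact adj_fam hG ht .A .A i₀ i₀ hx hy (by decide +kernel)
    · exact adj_fam hG ht .A .U i₀ i₀ hx hy (by decide +kernel)
    · exact adj_fam hG ht .A .F i₀ k hx hy (by decide +kernel)
    · exact adj_fam hG ht .U .A i₀ i₀ hx hy (by decide +kernel)
    · exact adj_fam hG ht .U .U i₀ i₀ hx hy (by decide +kernel)
    · exact adj_fam hG ht .U .F i₀ k hx hy (by decide +kernel)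
    · exact adj_fam hG ht .F .A i i₀ hx hy (by decide +kernel)
    · exact adj_fam hG ht .F .U i i₀ hx hy (by decide +kernel)
    · obtain rfl := hj x i hx
      obtain rfl := hj y k hy
      exact adj_fam_eq hG ht .F .F k hx hy (by decide +kernel)
  have hN : ∀ k, P.code k = .Za → ∀ x, G.CAdj k x → P.code x = .Za ∨
      (P.code x = .A ∨ P.code x = .U ∨ ∃ i, P.code x = .F i) := by
    intro k hk x hkx
    rcases P.code_cases hG hs hno ht x with (h | h | h | h) | ⟨m, h | h | h | h⟩
    · exact Or.inl h
    · exact Or.inr (Or.inl h)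
    · exact (hmax.false (P.cons k x hk h hkx)).elim
    · exact Or.inr (Or.inr (Or.inl h))
    · exact absurd hkx (not_adj_fam hG ht .Za .AB i₀ m hk h (by decide +kernel))
    · exact absurd hkx (not_adj_fam hG ht .Za .B i₀ m hk h (by decide +kernel))
    · exact Or.inr (Or.inr (Or.inr ⟨m, h⟩))
    · exact absurd hkx (not_adj_fam hG ht .Za .C i₀ m hk h (by decide +kernel))
  obtain ⟨u, hu⟩ := hG.exists_isSimplicialVertex {v | P.code v = .Za}
    {v | P.code v = .A ∨ P.code v = .U ∨ ∃ i, P.code v = .F i} ⟨v, hv⟩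
    (fun x hx y hy => hL x y hx hy) (fun k hk x y hkx hky => by
      rcases hN k hk x hkx with hx | hx <;> rcases hN k hk y hky with hy | hy
      · left
        by_contra hxy
        exact false_of_family hG ht .Za .Za .Za i₀ i₀ i₀ hk hx hy (bit_true hkx) (bit_false hxy)
          (bit_true hky) (fun k l n _ _ => (by decide +kernel :
            SimpleGraph.good .Za .Za .Za true false true = false))
      · exact Or.inr (Or.inl ⟨hx, hy⟩)
      · exact Or.inr (Or.inr ⟨hx, hy⟩)
      · exact Or.inl (hL x y hx hy))
  exact hs u hu

omit [Finite V] hs hno in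
theorem adj_U_C0_of_B (hx : P.code x = .U) (hy : P.code y = .C0) (hz : P.code z = .B i)
    (hyz : G.CAdj y z) : G.CAdj x y := by
  by_contra hxy
  exact false_of_family hG ht .U .C0 .B i i i hx hy hz (bit_false hxy) (bit_true hyz)
    (bit_true (adj_fam hG ht .U .B i i hx hz (by decide +kernel)))
    (fun k l n _ _ => (by decide +kernel : ∀ n,
      SimpleGraph.good .U .C0 (.B n) false true true = false) n)

/-- Without type `F`, take as `K` the vertices of type `C0` with no neighbour of type `B`, and as
`L` those of type `U`. Vertices of type `C0` with a neighbour of type `B` are complete to `L`, so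
the simplicial vertex argument applies. -/
theorem exists_F_of_C0 (hmax : IsEmpty (Pent G (Fin (t + 1)))) (hy : P.code y = .C0)
    (hyB : ∀ z i, P.code z = .B i → ¬ G.CAdj y z) : ∃ f i, P.code f = .F i := by
  by_contra! hF
  let i₀ : Fin t := ⟨0, by omega⟩
  have hN : ∀ k, (P.code k = .C0 ∧ ∀ z i, P.code z = .B i → ¬ G.CAdj k z) → ∀ x, G.CAdj k x →
      P.code x = .C0 ∨ P.code x = .U ∨ ∃ i, P.code x = .C i := by
    rintro k ⟨hk, hkB⟩ x hkx
    rcases P.code_cases hG hs hno ht x with (h | h | h | h) | ⟨m, h | h | h | h⟩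
    · exact absurd h (P.code_ne_Za hG hs hno ht hmax x)
    · exact absurd hkx (not_adj_fam hG ht .C0 .A i₀ i₀ hk h (by decide +kernel))
    · exact Or.inl h
    · exact Or.inr (Or.inl h)
    · exact absurd hkx (not_adj_fam hG ht .C0 .AB i₀ m hk h (by decide +kernel))
    · exact absurd hkx (hkB x m h)
    · exact absurd h (hF x m)
    · exact Or.inr (Or.inr ⟨m, h⟩)
  have hU : ∀ x y, (P.code x = .U ∨ ∃ i, P.code x = .C i) →
      (P.code y = .U ∨ ∃ i, P.code y = .C i) → G.CAdj x y := by
    rintro x y (hx | ⟨i, hx⟩) (hy | ⟨j, hy⟩)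
    · exact adj_fam hG ht .U .U i₀ i₀ hx hy (by decide +kernel)
    · exact adj_fam hG ht .U .C i₀ j hx hy (by decide +kernel)
    · exact adj_fam hG ht .C .U i i₀ hx hy (by decide +kernel)
    · exact adj_fam hG ht .C .C i j hx hy (by decide +kernel)
  have key : ∀ x y, P.code x = .C0 → (P.code y = .U ∨ ∃ i, P.code y = .C i) → G.CAdj x y ∨
      ((P.code x = .C0 ∧ ∀ z i, P.code z = .B i → ¬ G.CAdj x z) ∧ P.code y = .U) := by
    rintro x y hx (hy | ⟨i, hy⟩)
    · by_cases h : ∃ z i, P.code z = .B i ∧ G.CAdj x z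
      · obtain ⟨z, i, hz, hxz⟩ := h
        exact Or.inl (adj_U_C0_of_B hG ht hy hx hz hxz).symm
      · push Not at h
        exact Or.inr ⟨⟨hx, h⟩, hy⟩
    · exact Or.inl (adj_fam hG ht .C0 .C i i hx hy (by decide +kernel))
  obtain ⟨u, hu⟩ := hG.exists_isSimplicialVertex
    {v | P.code v = .C0 ∧ ∀ z i, P.code z = .B i → ¬ G.CAdj v z}
    {v | P.code v = .U} ⟨y, hy, hyB⟩
    (fun x hx y hy => adj_fam hG ht .U .U i₀ i₀ hx hy (by decide +kernel))
    (fun k hk x y hkx hky => by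
      rcases hN k hk x hkx with hx | hx <;> rcases hN k hk y hky with hy | hy
      · exact Or.inl (adj_fam hG ht .C0 .C0 i₀ i₀ hx hy (by decide +kernel))
      · exact (key x y hx hy).imp_right Or.inl
      · exact (key y x hy hx).imp CAdj.symm fun h => Or.inr h.symm
      · exact Or.inl (hU x y hx hy))
  exact hs u hu

/-- A vertex of type `U` would be universal. For type `C0` the adjacency is forced by a neighbour of
type `B` or, failing that, by a vertex of type `F`. -/
theorem code_ne_U (hu : ∀ v, ∃ w, ¬ G.CAdj v w) (hmax : IsEmpty (Pent G (Fin (t + 1))))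
    (P : Pent G (Fin t)) (v : V) : P.code v ≠ .U := by
  intro hv
  let i₀ : Fin t := ⟨0, by omega⟩
  obtain ⟨x, hx⟩ := hu v
  apply hx
  rcases P.code_cases hG hs hno ht x with (h | h | h | h) | ⟨m, h | h | h | h⟩
  · exact absurd h (P.code_ne_Za hG hs hno ht hmax x)
  · exact adj_fam hG ht .U .A i₀ i₀ hv h (by decide +kernel)
  · by_cases hB : ∃ z i, P.code z = .B i ∧ G.CAdj x z
    · obtain ⟨z, i, hz, hxz⟩ := hB
      exact adj_U_C0_of_B hG ht hv h hz hxz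
    · push Not at hB
      obtain ⟨f, i, hf⟩ := exists_F_of_C0 hG hs hno ht hmax h hB
      by_contra hvx
      exact false_of_family hG ht .U .C0 .F i i i hv h hf (bit_false hvx)
        (bit_true (adj_fam hG ht .C0 .F i i h hf (by decide +kernel)))
        (bit_true (adj_fam hG ht .U .F i i hv hf (by decide +kernel)))
        (fun k l n _ _ => (by decide +kernel : ∀ n,
          SimpleGraph.good .U .C0 (.F n) false true true = false) n)
  · exact adj_fam hG ht .U .U i₀ i₀ hv h (by decide +kernel)
  · exact adj_U_AB_fin hG hs hno ht hv h
  · exact adj_fam hG ht .U .B i₀ m hv h (by decide +kernel)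
  · exact adj_fam hG ht .U .F i₀ m hv h (by decide +kernel)
  · exact adj_fam hG ht .U .C i₀ m hv h (by decide +kernel)

end
end Pent
end
section
variable {V : Type*} {G : SimpleGraph V}
namespace Pent
variable {t : ℕ} {P : Pent G (Fin t)} {x y z : V} {i j m : Fin t}

/-! ### Villas and mansions from a largest pentagon -/

/-- The parts of the villa or mansion around a largest pentagon. -/
def Part (P : Pent G (Fin t)) (j : Fin t) : Fin 4 ⊕ (Fin t ⊕ Fin t) → V → Prop
  | .inl 0, v => P.code v = .A
  | .inl 1, v => P.code v = .F j
  | .inl 2, v => ∃ i, P.code v = .AB i ∧ ∀ z, P.code z = .C i → ¬ G.CAdj v z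
  | .inl 3, v => P.code v = .C0 ∧ ∀ y i, P.code y = .B i → ¬ G.CAdj v y
  | .inr (.inl i), v => P.code v = .B i ∨ P.code v = .AB i ∧ ∃ z, P.code z = .C i ∧ G.CAdj v z
  | .inr (.inr i), v => P.code v = .C i ∨ P.code v = .C0 ∧ ∃ y, P.code y = .B i ∧ G.CAdj v y

section
variable (hG : G.PatternFree) (ht : 3 ≤ t)
include hG ht

theorem adj_A_A (hx : P.Part j (.inl 0) x) (hy : P.Part j (.inl 0) y) : G.CAdj x y :=
  adj_fam hG ht .A .A j j hx hy (by decide +kernel)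

theorem adj_A_F (hx : P.Part j (.inl 0) x) (hy : P.Part j (.inl 1) y) : G.CAdj x y :=
  adj_fam hG ht .A .F j j hx hy (by decide +kernel)

theorem not_adj_A_Y (hx : P.Part j (.inl 0) x) (hy : P.Part j (.inl 3) y) : ¬ G.CAdj x y :=
  not_adj_fam hG ht .A .C0 j j hx hy.1 (by decide +kernel)

theorem not_adj_A_C (hx : P.Part j (.inl 0) x) (hy : P.Part j (.inr (.inr i)) y) :
    ¬ G.CAdj x y := by
  rcases hy with hy | ⟨hy, -⟩
  · exact not_adj_fam hG ht .A .C i i hx hy (by decide +kernel)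
  · exact not_adj_fam hG ht .A .C0 i i hx hy (by decide +kernel)

theorem adj_F_F (hx : P.Part j (.inl 1) x) (hy : P.Part j (.inl 1) y) : G.CAdj x y :=
  adj_fam_eq hG ht .F .F j hx hy (by decide +kernel)

theorem adj_F_Y (hx : P.Part j (.inl 1) x) (hy : P.Part j (.inl 3) y) : G.CAdj x y :=
  adj_fam hG ht .F .C0 j j hx hy.1 (by decide +kernel)

theorem adj_F_B (hx : P.Part j (.inl 1) x) (hy : P.Part j (.inr (.inl i)) y) (hij : i ≠ j) :
    G.CAdj x y := by
  rcases hy with hy | ⟨hy, z, hz, hyz⟩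
  · exact adj_fam_ne hG ht .F .B hij.symm hx hy (by decide +kernel)
  · have hxz : G.CAdj x z := adj_fam_ne hG ht .F .C hij.symm hx hz (by decide +kernel)
    by_contra hxy
    refine false_of_family hG ht .C .AB .F i i j hz hy hx (bit_true hyz.symm)
      (bit_false (mt CAdj.symm hxy)) (bit_true hxz.symm) fun k l n h1 h2 => ?_
    obtain rfl := h1.2 rfl
    exact (by decide +kernel : ∀ k n : Fin 3, k ≠ n →
      SimpleGraph.good (.C k) (.AB k) (.F n) true false true = false) k n (mt h2.1 hij)

theorem not_adj_F_B (hx : P.Part j (.inl 1) x) (hy : P.Part j (.inr (.inl j)) y) :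
    ¬ G.CAdj x y := by
  rcases hy with hy | ⟨hy, z, hz, hyz⟩
  · exact not_adj_fam_eq hG ht .F .B j hx hy (by decide +kernel)
  · have hxz : ¬ G.CAdj x z := not_adj_fam_eq hG ht .F .C j hx hz (by decide +kernel)
    have hxy : G.CAdj x y := adj_fam_eq hG ht .F .AB j hx hy (by decide +kernel)
    -- Since type `F j` is complete to type `AB j`, the triple `z, y, x` is contradictory: once `F
    -- j` occurs, no vertex of type `AB j` has a neighbour of type `C j`.
    refine fun _ => false_of_family hG ht .C .AB .F j j j hz hy hx (bit_true hyz.symm)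
      (bit_true hxy.symm) (bit_false (mt CAdj.symm hxz)) fun k l n h1 h2 => ?_
    obtain rfl := h1.2 rfl
    obtain rfl := h2.2 rfl
    clear h1 h2
    revert k
    decide +kernel

theorem adj_F_C (hx : P.Part j (.inl 1) x) (hy : P.Part j (.inr (.inr i)) y) (hij : i ≠ j) :
    G.CAdj x y := by
  rcases hy with hy | ⟨hy, -⟩
  · exact adj_fam_ne hG ht .F .C hij.symm hx hy (by decide +kernel)
  · exact adj_fam hG ht .F .C0 j j hx hy (by decide +kernel)

/-- A vertex of type `C0` sees `x`, while a vertex of type `B j` misses it. If these two were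
adjacent, a forbidden pattern would arise. -/
theorem code_of_F_C (hx : P.Part j (.inl 1) x) (hy : P.Part j (.inr (.inr j)) y) :
    P.code y = .C j := by
  rcases hy with hy | ⟨hy, z, hz, hyz⟩
  · exact hy
  · have hxz : ¬ G.CAdj x z := not_adj_fam_eq hG ht .F .B j hx hz (by decide +kernel)
    have hxy : G.CAdj x y := adj_fam hG ht .F .C0 j j hx hy (by decide +kernel)
    refine (false_of_family hG ht .F .C0 .B j j j hx hy hz (bit_true hxy)
      (bit_true hyz) (bit_false hxz) fun k l n h1 h2 => ?_).elim
    obtain rfl := h1.2 rfl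
    obtain rfl := h2.2 rfl
    clear h1 h2
    revert k
    decide +kernel

theorem not_adj_F_C (hx : P.Part j (.inl 1) x) (hy : P.Part j (.inr (.inr j)) y) :
    ¬ G.CAdj x y :=
  not_adj_fam_eq hG ht .F .C j hx (code_of_F_C hG ht hx hy) (by decide +kernel)

theorem not_adj_X_Y (hx : P.Part j (.inl 2) x) (hy : P.Part j (.inl 3) y) : ¬ G.CAdj x y := by
  obtain ⟨k, hx, -⟩ := hx
  exact not_adj_fam hG ht .AB .C0 k k hx hy.1 (by decide +kernel)

theorem not_adj_X_C (hx : P.Part j (.inl 2) x) (hy : P.Part j (.inr (.inr i)) y) :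
    ¬ G.CAdj x y := by
  obtain ⟨k, hx, hx'⟩ := hx
  rcases hy with hy | ⟨hy, -⟩
  · by_cases hki : k = i
    · exact hx' y (hki ▸ hy)
    · exact not_adj_fam_ne hG ht .AB .C hki hx hy (by decide +kernel)
  · exact not_adj_fam hG ht .AB .C0 k k hx hy (by decide +kernel)

theorem adj_Y_Y (hx : P.Part j (.inl 3) x) (hy : P.Part j (.inl 3) y) : G.CAdj x y :=
  adj_fam hG ht .C0 .C0 j j hx.1 hy.1 (by decide +kernel)

theorem not_adj_Y_B (hx : P.Part j (.inl 3) x) (hy : P.Part j (.inr (.inl i)) y) :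
    ¬ G.CAdj x y := by
  rcases hy with hy | ⟨hy, -⟩
  · exact hx.2 y i hy
  · exact not_adj_fam hG ht .C0 .AB i i hx.1 hy (by decide +kernel)

theorem adj_Y_C (hx : P.Part j (.inl 3) x) (hy : P.Part j (.inr (.inr i)) y) : G.CAdj x y := by
  rcases hy with hy | ⟨hy, -⟩
  · exact adj_fam hG ht .C0 .C i i hx.1 hy (by decide +kernel)
  · exact adj_fam hG ht .C0 .C0 i i hx.1 hy (by decide +kernel)

theorem adj_B_B (hx : P.Part j (.inr (.inl i)) x) (hy : P.Part j (.inr (.inl i)) y) :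
    G.CAdj x y := by
  rcases hx with hx | ⟨hx, -⟩ <;> rcases hy with hy | ⟨hy, -⟩
  · exact adj_fam_eq hG ht .B .B i hx hy (by decide +kernel)
  · exact adj_fam_eq hG ht .B .AB i hx hy (by decide +kernel)
  · exact adj_fam_eq hG ht .AB .B i hx hy (by decide +kernel)
  · exact adj_fam_eq hG ht .AB .AB i hx hy (by decide +kernel)

theorem not_adj_B_B (hij : i ≠ m) (hx : P.Part j (.inr (.inl i)) x)
    (hy : P.Part j (.inr (.inl m)) y) : ¬ G.CAdj x y := by
  rcases hx with hx | ⟨hx, -⟩ <;> rcases hy with hy | ⟨hy, -⟩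
  · exact not_adj_fam_ne hG ht .B .B hij hx hy (by decide +kernel)
  · exact not_adj_fam_ne hG ht .B .AB hij hx hy (by decide +kernel)
  · exact not_adj_fam_ne hG ht .AB .B hij hx hy (by decide +kernel)
  · exact not_adj_fam_ne hG ht .AB .AB hij hx hy (by decide +kernel)

theorem adj_C_C (hx : P.Part j (.inr (.inr i)) x) (hy : P.Part j (.inr (.inr m)) y) :
    G.CAdj x y := by
  rcases hx with hx | ⟨hx, -⟩ <;> rcases hy with hy | ⟨hy, -⟩
  · exact adj_fam hG ht .C .C i m hx hy (by decide +kernel)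
  · exact adj_fam hG ht .C .C0 i m hx hy (by decide +kernel)
  · exact adj_fam hG ht .C0 .C i m hx hy (by decide +kernel)
  · exact adj_fam hG ht .C0 .C0 i m hx hy (by decide +kernel)

theorem not_adj_B_C (hij : i ≠ m) (hx : P.Part j (.inr (.inl i)) x)
    (hy : P.Part j (.inr (.inr m)) y) : ¬ G.CAdj x y := by
  rcases hx with hx | ⟨hx, -⟩ <;> rcases hy with hy | ⟨hy, z, hz, hyz⟩
  · exact not_adj_fam_ne hG ht .B .C hij hx hy (by decide +kernel)
  · have hxz : ¬ G.CAdj x z := not_adj_fam_ne hG ht .B .B hij hx hz (by decide +kernel)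
    refine fun hxy => false_of_family hG ht .B .C0 .B i m m hx hy hz (bit_true hxy)
      (bit_true hyz) (bit_false hxz) fun k l n h1 h2 => ?_
    obtain rfl := h2.2 rfl
    exact (by decide +kernel : ∀ k n : Fin 3, k ≠ n →
      SimpleGraph.good (.B k) .C0 (.B n) true true false = false) k l (mt h1.1 hij)
  · exact not_adj_fam_ne hG ht .AB .C hij hx hy (by decide +kernel)
  · exact not_adj_fam hG ht .AB .C0 i i hx hy (by decide +kernel)

/-- The nested pair with index `j` becomes complete in a mansion: `z` misses both `x` and `y`, and
their nonadjacency would give a forbidden pattern. -/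
theorem adj_B_C_of_F (hz : P.Part j (.inl 1) z) (hx : P.Part j (.inr (.inl j)) x)
    (hy : P.Part j (.inr (.inr j)) y) : G.CAdj x y := by
  have hzx := not_adj_F_B hG ht hz hx
  have hzy := not_adj_F_C hG ht hz hy
  have hy' := code_of_F_C hG ht hz hy
  rcases hx with hx | ⟨hx, -⟩
  · by_contra hxy
    refine false_of_family hG ht .F .B .C j j j hz hx hy' (bit_false hzx)
      (bit_false hxy) (bit_false hzy) fun k l n h1 h2 => ?_
    obtain rfl := h1.2 rfl
    obtain rfl := h2.2 rfl
    clear h1 h2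
    revert k
    decide +kernel
  · exact absurd (adj_fam_eq hG ht .F .AB j hz hx (by decide +kernel)) hzx
end

section
variable [Finite V] (hG : G.PatternFree) (hs : ∀ v, ¬ G.IsSimplicialVertex v)
  (hno : ∀ (P : Pent G (Fin 3)) v i, P.code v ≠ .AA i) (ht : 3 ≤ t)
include hG hs hno ht

omit hno in
theorem adj_A_X (hx : P.Part j (.inl 0) x) (hy : P.Part j (.inl 2) y) : G.CAdj x y := by
  obtain ⟨k, hy, -⟩ := hy
  exact adj_A_AB_fin hG hs ht hx hy

theorem adj_A_Bpart (hx : P.Part j (.inl 0) x) (hy : P.Part j (.inr (.inl i)) y) :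
    G.CAdj x y := by
  rcases hy with hy | ⟨hy, -⟩
  · exact adj_A_B_fin hno ht hx hy
  · exact adj_A_AB_fin hG hs ht hx hy

variable (hj : ∀ v k, P.code v = .F k → k = j)
include hj

/-- A vertex of type `AB k` without a neighbour of type `C k` forces a vertex of type `F k`, and `j`
is the only index of such vertices. -/
theorem code_of_X (hx : P.Part j (.inl 2) x) : P.code x = .AB j := by
  obtain ⟨k, hx, hx'⟩ := hx
  obtain ⟨f, hf⟩ := exists_F_of_AB_fin hG hs hno ht hx hx'
  rw [hx, hj f k hf]

theorem adj_F_X (hx : P.Part j (.inl 1) x) (hy : P.Part j (.inl 2) y) : G.CAdj x y :=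
  adj_fam_eq hG ht .F .AB j hx (code_of_X hG hs hno ht hj hy) (by decide +kernel)

theorem adj_X_X (hx : P.Part j (.inl 2) x) (hy : P.Part j (.inl 2) y) : G.CAdj x y :=
  adj_fam_eq hG ht .AB .AB j (code_of_X hG hs hno ht hj hx) (code_of_X hG hs hno ht hj hy)
    (by decide +kernel)

theorem adj_X_B (hx : P.Part j (.inl 2) x) (hy : P.Part j (.inr (.inl j)) y) : G.CAdj x y := by
  have hx := code_of_X hG hs hno ht hj hx
  rcases hy with hy | ⟨hy, -⟩
  · exact adj_fam_eq hG ht .AB .B j hx hy (by decide +kernel)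
  · exact adj_fam_eq hG ht .AB .AB j hx hy (by decide +kernel)

theorem not_adj_X_B (hx : P.Part j (.inl 2) x) (hy : P.Part j (.inr (.inl i)) y) (hij : i ≠ j) :
    ¬ G.CAdj x y := by
  have hx := code_of_X hG hs hno ht hj hx
  rcases hy with hy | ⟨hy, -⟩
  · exact not_adj_fam_ne hG ht .AB .B hij.symm hx hy (by decide +kernel)
  · exact not_adj_fam_ne hG ht .AB .AB hij.symm hx hy (by decide +kernel)

end
end Pent
end
-- Assembling the partition of a villa or mansion
section
variable {V : Type*} {G : SimpleGraph V}
namespace Pent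
variable {t : ℕ} {P : Pent G (Fin t)} {x y z v : V} {i j m : Fin t}
  {k : Fin 4 ⊕ (Fin t ⊕ Fin t)}

/-- Each vertex will be labelled with some part that contains it. For types `A`, `F j`, `B i` and `C
i` the label is forced, which is used for nonemptiness and for the nested orderings. -/
theorem eq_of_part_of_A (ht : 3 ≤ t) (hv : P.code v = .A) (hk : P.Part j k v) : k = .inl 0 := by
  rcases k with k | k | k
  · fin_cases k
    · rfl
    · exact (false_of_code_eq ht .A .F j j hv hk (by decide)).elim
    · obtain ⟨i, hk, -⟩ := hk
      exact (false_of_code_eq ht .A .AB j i hv hk (by decide)).elim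
    · exact (false_of_code_eq ht .A .C0 j j hv hk.1 (by decide)).elim
  · rcases hk with hk | ⟨hk, -⟩
    · exact (false_of_code_eq ht .A .B j k hv hk (by decide)).elim
    · exact (false_of_code_eq ht .A .AB j k hv hk (by decide)).elim
  · rcases hk with hk | ⟨hk, -⟩
    · exact (false_of_code_eq ht .A .C j k hv hk (by decide)).elim
    · exact (false_of_code_eq ht .A .C0 j j hv hk (by decide)).elim

theorem eq_of_part_of_F (ht : 3 ≤ t) (hv : P.code v = .F j) (hk : P.Part j k v) : k = .inl 1 := by
  rcases k with k | k | k
  · fin_cases k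
    · exact (false_of_code_eq ht .F .A j j hv hk (by decide)).elim
    · rfl
    · obtain ⟨i, hk, -⟩ := hk
      exact (false_of_code_eq ht .F .AB j i hv hk (by decide)).elim
    · exact (false_of_code_eq ht .F .C0 j j hv hk.1 (by decide)).elim
  · rcases hk with hk | ⟨hk, -⟩
    · exact (false_of_code_eq ht .F .B j k hv hk (by decide)).elim
    · exact (false_of_code_eq ht .F .AB j k hv hk (by decide)).elim
  · rcases hk with hk | ⟨hk, -⟩
    · exact (false_of_code_eq ht .F .C j k hv hk (by decide)).elim
    · exact (false_of_code_eq ht .F .C0 j j hv hk (by decide)).elim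

theorem eq_of_part_of_B (ht : 3 ≤ t) (hv : P.code v = .B i) (hk : P.Part j k v) :
    k = .inr (.inl i) := by
  rcases k with k | k | k
  · fin_cases k
    · exact (false_of_code_eq ht .B .A i j hv hk (by decide)).elim
    · exact (false_of_code_eq ht .B .F i j hv hk (by decide)).elim
    · obtain ⟨l, hk, -⟩ := hk
      exact (false_of_code_eq ht .B .AB i l hv hk (by decide)).elim
    · exact (false_of_code_eq ht .B .C0 i j hv hk.1 (by decide)).elim
  · rcases hk with hk | ⟨hk, -⟩
    · have h := congrFun (congrArg (fun s => s.2.1) (hv.symm.trans hk)) i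
      simp only [Code.B, decide_true, eq_comm (a := true), decide_eq_true_eq] at h
      rw [h]
    · exact (false_of_code_eq ht .B .AB i k hv hk (by decide)).elim
  · rcases hk with hk | ⟨hk, -⟩
    · exact (false_of_code_eq ht .B .C i k hv hk (by decide)).elim
    · exact (false_of_code_eq ht .B .C0 i j hv hk (by decide)).elim

theorem eq_of_part_of_C (ht : 3 ≤ t) (hv : P.code v = .C i) (hk : P.Part j k v) :
    k = .inr (.inr i) := by
  rcases k with k | k | k
  · fin_cases k
    · exact (false_of_code_eq ht .C .A i j hv hk (by decide)).elim
    · exact (false_of_code_eq ht .C .F i j hv hk (by decide)).elim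
    · obtain ⟨l, hk, -⟩ := hk
      exact (false_of_code_eq ht .C .AB i l hv hk (by decide)).elim
    · exact (false_of_code_eq ht .C .C0 i j hv hk.1 (by decide)).elim
  · rcases hk with hk | ⟨hk, -⟩
    · exact (false_of_code_eq ht .C .B i k hv hk (by decide)).elim
    · exact (false_of_code_eq ht .C .AB i k hv hk (by decide)).elim
  · rcases hk with hk | ⟨hk, -⟩
    · have h := congrFun (congrArg (fun s => s.2.1) (hv.symm.trans hk)) i
      simp only [Code.C, decide_true, eq_comm (a := true), decide_eq_true_eq] at h
      rw [h]
    · exact (false_of_code_eq ht .C .C0 i j hv hk (by decide)).elim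

variable [Finite V] (hG : G.PatternFree) (hs : ∀ v, ¬ G.IsSimplicialVertex v)
  (hno : ∀ (P : Pent G (Fin 3)) v i, P.code v ≠ .AA i) (ht : 3 ≤ t)
include hG hs hno ht

theorem exists_part (hu : ∀ v, ∃ w, ¬ G.CAdj v w) (hmax : IsEmpty (Pent G (Fin (t + 1))))
    (hj : ∀ v k, P.code v = .F k → k = j) (v : V) : ∃ k, P.Part j k v := by
  rcases P.code_cases hG hs hno ht v with (h | h | h | h) | ⟨m, h | h | h | h⟩
  · exact absurd h (P.code_ne_Za hG hs hno ht hmax v)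
  · exact ⟨.inl 0, h⟩
  · by_cases h' : ∃ y i, P.code y = .B i ∧ G.CAdj v y
    · obtain ⟨y, i, h'⟩ := h'
      exact ⟨.inr (.inr i), Or.inr ⟨h, y, h'⟩⟩
    · exact ⟨.inl 3, h, fun y i hy hvy => h' ⟨y, i, hy, hvy⟩⟩
  · exact absurd h (P.code_ne_U hG hs hno ht hu hmax v)
  · by_cases h' : ∃ z, P.code z = .C m ∧ G.CAdj v z
    · exact ⟨.inr (.inl m), Or.inr ⟨h, h'⟩⟩
    · exact ⟨.inl 2, m, h, fun z hz hvz => h' ⟨z, hz, hvz⟩⟩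
  · exact ⟨.inr (.inl m), Or.inl h⟩
  · obtain rfl := hj v m h
    exact ⟨.inl 1, h⟩
  · exact ⟨.inr (.inr m), Or.inl h⟩

/-- The parts are level sets of the labelling and so are disjoint by construction. -/
theorem isVillaPartitionOn_of_part (lab : V → Fin 4 ⊕ (Fin t ⊕ Fin t))
    (hlab : ∀ v, P.Part j (lab v) v) :
    G.IsVillaPartitionOn ({v | lab v = .inl 1} ∪ {v | lab v = .inl 2} ∪ {v | lab v = .inl 3})ᶜ t
      {v | lab v = .inl 0} (fun i => {v | lab v = .inr (.inl i)})
      (fun i => {v | lab v = .inr (.inr i)}) := by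
  have hL : ∀ {v k}, lab v = k → P.Part j k v := fun h => h ▸ hlab _
  have hdisj : ∀ k l, k ≠ l → Disjoint {v | lab v = k} {v | lab v = l} :=
    fun k l hkl => Set.disjoint_left.2 fun v hv hv' => hkl (hv.symm.trans hv')
  have hb : ∀ i, lab (P.b i) = .inr (.inl i) :=
    fun i => eq_of_part_of_B ht (P.code_b i) (hlab _)
  have hc : ∀ i, lab (P.c i) = .inr (.inr i) :=
    fun i => eq_of_part_of_C ht (P.code_c i) (hlab _)
  have ha : lab P.a = .inl 0 := eq_of_part_of_A ht P.code_a (hlab _)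
  refine
    { three_le := ht
      partition := ⟨?_, ?_⟩
      nonempty_A := ⟨P.a, ha⟩
      nonempty_B := fun i => ⟨P.b i, hb i⟩
      nonempty_C := fun i => ⟨P.c i, hc i⟩
      clique_A := isClique_of_cadj fun x hx y hy => adj_A_A hG ht (hL hx) (hL hy)
      clique_B := fun i => isClique_of_cadj fun x hx y hy => adj_B_B hG ht (hL hx) (hL hy)
      clique_C := fun i => isClique_of_cadj fun x hx y hy => adj_C_C hG ht (hL hx) (hL hy)
      A_complete_B := fun i => completeTo_of_cadj (hdisj _ _ (by simp))
        fun x hx y hy => adj_A_Bpart hG hs hno ht (hL hx) (hL hy)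
      A_anticomplete_C := fun i => anticompleteTo_of_not_cadj
        fun x hx y hy => not_adj_A_C hG ht (hL hx) (hL hy)
      B_anticomplete_B := fun i m him => anticompleteTo_of_not_cadj
        fun x hx y hy => not_adj_B_B hG ht him (hL hx) (hL hy)
      C_complete_C := fun i m him => completeTo_of_cadj (hdisj _ _ (by simpa using him))
        fun x hx y hy => adj_C_C hG ht (hL hx) (hL hy)
      B_anticomplete_C := fun i m him => anticompleteTo_of_not_cadj
        fun x hx y hy => not_adj_B_C hG ht him (hL hx) (hL hy)
      nested := fun i => ?_ }
  · have h : (Sum.elim ![{v | lab v = .inl 0}] (Sum.elim (fun i => {v | lab v = .inr (.inl i)})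
        fun i => {v | lab v = .inr (.inr i)}) : Fin 1 ⊕ (Fin t ⊕ Fin t) → Set V) =
        fun k => {v | lab v = Sum.map (fun _ => 0) id k} := by
      funext k
      rcases k with k | k | k
      · fin_cases k; rfl
      · rfl
      · rfl
    rw [h]
    refine fun k l hkl => hdisj _ _ fun h => hkl ?_
    exact (Sum.map_injective.2 ⟨Function.injective_of_subsingleton _, Function.injective_id⟩) h
  · ext v
    simp only [Set.mem_iUnion, Sum.exists, Sum.elim_inl, Sum.elim_inr, Set.mem_ofPred_eq,
      Set.mem_compl_iff, Set.mem_union]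
    rcases h : lab v with k | k | k
    · fin_cases k <;> simp [h]
    · simp
    · simp
  · obtain ⟨n, x, hx⟩ := exists_isNestedOrdering hG (X := {v | lab v = .inr (.inl i)})
      (Y := {v | lab v = .inr (.inr i)}) (fun x hx y hy => adj_B_B hG ht (hL hx) (hL hy))
      (fun x hx y hy => adj_C_C hG ht (hL hx) (hL hy)) (hdisj _ _ (by simp)) ⟨P.b i, hb i⟩ (by
        intro y hy
        rcases hL hy with h | ⟨h, z, hz, hyz⟩
        · exact ⟨P.b i, hb i, ((P.code_b_iff y i).1 (by simp [h, Code.C])).symm⟩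
        · exact ⟨z, eq_of_part_of_B ht hz (hlab z), hyz.symm⟩)
    refine ⟨n, x, hx, ?_⟩
    have hmem : x (Fin.last n) ∈ {v | lab v = .inr (.inl i)} :=
      hx.2.1 ▸ Set.mem_range_self (Fin.last n)
    replace hmem : lab (x (Fin.last n)) = .inr (.inl i) := hmem
    -- Every vertex in the part B i has a neighbour in C i: `c i` for type `B i`, and one of type `C
    -- i` for type `AB i`.
    have key : ∃ z, lab z = .inr (.inr i) ∧ G.CAdj (x (Fin.last n)) z := by
      rcases hL hmem with h | ⟨-, z, hz, hz'⟩
      · exact ⟨P.c i, hc i, (P.code_c_iff _ i).1 (by simp [h, Code.B])⟩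
      · exact ⟨z, eq_of_part_of_C ht hz (hlab z), hz'⟩
    obtain ⟨z, hz, hz'⟩ := key
    exact ⟨z, hz'.adj fun h => by simp [← h, hmem] at hz, hz⟩

theorem isVilla_or_isMansion (P : Pent G (Fin t)) (hu : ∀ v, ∃ w, ¬ G.CAdj v w)
    (hmax : IsEmpty (Pent G (Fin (t + 1)))) : G.IsVilla ∨ G.IsMansion := by
  obtain ⟨j, hj⟩ := P.exists_forall_F_fin hG ht
  choose lab hlab using P.exists_part hG hs hno ht hu hmax hj
  have hL : ∀ {v k}, lab v = k → P.Part j k v := fun h => h ▸ hlab _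
  have hdisj : ∀ k l, k ≠ l → Disjoint {v | lab v = k} {v | lab v = l} :=
    fun k l hkl => Set.disjoint_left.2 fun v hv hv' => hkl (hv.symm.trans hv')
  have hvilla := isVillaPartitionOn_of_part hG hs hno ht lab hlab
  by_cases hF : ∃ f i, P.code f = .F i
  · obtain ⟨f, i, hf⟩ := hF
    obtain rfl := hj f i hf
    have hf' : lab f = .inl 1 := eq_of_part_of_F ht hf (hlab f)
    refine Or.inr ⟨t, _, _, _, {v | lab v = .inl 1}, {v | lab v = .inl 2}, {v | lab v = .inl 3},
      { partition := ⟨?_, ?_⟩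
        villa := hvilla
        nonempty_F := ⟨f, hf'⟩
        clique_F := isClique_of_cadj fun x hx y hy => adj_F_F hG ht (hL hx) (hL hy)
        clique_X := isClique_of_cadj fun x hx y hy => adj_X_X hG hs hno ht hj (hL hx) (hL hy)
        clique_Y := isClique_of_cadj fun x hx y hy => adj_Y_Y hG ht (hL hx) (hL hy)
        exists_j := ⟨i, completeTo_of_cadj (hdisj _ _ (by simp))
            fun x hx y hy => (adj_A_F hG ht (hL hy) (hL hx)).symm,
          fun m hm => ⟨completeTo_of_cadj (hdisj _ _ (by simp))
              fun x hx y hy => adj_F_B hG ht (hL hx) (hL hy) hm,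
            completeTo_of_cadj (hdisj _ _ (by simp))
              fun x hx y hy => adj_F_C hG ht (hL hx) (hL hy) hm⟩,
          anticompleteTo_of_not_cadj fun x hx y hy => not_adj_F_B hG ht (hL hx) (hL hy),
          anticompleteTo_of_not_cadj fun x hx y hy => not_adj_F_C hG ht (hL hx) (hL hy),
          completeTo_of_cadj (hdisj _ _ (by simp))
            fun x hx y hy => adj_B_C_of_F hG ht (hL hf') (hL hx) (hL hy),
          completeTo_of_cadj (hdisj _ _ (by simp))
            fun x hx y hy => (adj_A_X hG hs ht (hL hy) (hL hx)).symm,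
          completeTo_of_cadj (hdisj _ _ (by simp))
            fun x hx y hy => adj_X_B hG hs hno ht hj (hL hx) (hL hy),
          fun m hm => anticompleteTo_of_not_cadj
            fun x hx y hy => not_adj_X_B hG hs hno ht hj (hL hx) (hL hy) hm,
          fun m => anticompleteTo_of_not_cadj
            fun x hx y hy => not_adj_X_C hG ht (hL hx) (hL hy)⟩
        F_complete_X := completeTo_of_cadj (hdisj _ _ (by simp))
          fun x hx y hy => adj_F_X hG hs hno ht hj (hL hx) (hL hy)
        F_complete_Y := completeTo_of_cadj (hdisj _ _ (by simp))
          fun x hx y hy => adj_F_Y hG ht (hL hx) (hL hy)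
        X_anticomplete_Y := anticompleteTo_of_not_cadj
          fun x hx y hy => not_adj_X_Y hG ht (hL hx) (hL hy)
        Y_complete_C := fun m => completeTo_of_cadj (hdisj _ _ (by simp))
          fun x hx y hy => adj_Y_C hG ht (hL hx) (hL hy)
        Y_anticomplete_A := anticompleteTo_of_not_cadj
          fun x hx y hy => mt CAdj.symm (not_adj_A_Y hG ht (hL hy) (hL hx))
        Y_anticomplete_B := fun m => anticompleteTo_of_not_cadj
          fun x hx y hy => not_adj_Y_B hG ht (hL hx) (hL hy) }⟩
    · refine fun k l hkl => ?_
      convert hdisj k l hkl using 1 <;> [rcases k with k | k | k; rcases l with k | k | k] <;>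
        first | rfl | (fin_cases k <;> rfl)
    · refine Set.eq_univ_of_forall fun v => Set.mem_iUnion.2 ⟨lab v, ?_⟩
      rcases h : lab v with k | k | k
      · fin_cases k <;> exact h
      · exact h
      · exact h
  -- A vertex in X or Y would force a vertex of type `F`. With no such type, F, X and Y are empty
  -- and the villa is the whole graph.
  · push Not at hF
    refine Or.inl ⟨t, _, _, _, Eq.subst (motive := fun S => G.IsVillaPartitionOn S t _ _ _)
      (Set.compl_univ_iff.2 (Set.eq_empty_iff_forall_notMem.2 ?_)) hvilla⟩
    rintro v ((hv | hv) | hv)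
    · exact hF v _ (hL hv)
    · obtain ⟨i, h, h'⟩ := hL hv
      obtain ⟨f, hf⟩ := exists_F_of_AB_fin hG hs hno ht h h'
      exact hF f i hf
    · obtain ⟨h, h'⟩ := hL hv
      obtain ⟨f, i, hf⟩ := exists_F_of_C0 hG hs hno ht hmax h h'
      exact hF f i hf

end Pent
end
section
variable {V : Type*} {G : SimpleGraph V}

/-! ### From forbidden patterns to baskets, villas and mansions -/

theorem Pent.b_injective {ι : Type*} (P : Pent G ι) : Function.Injective P.b := by
  intro i j h
  by_contra hij
  exact P.bb i j hij (h ▸ CAdj.refl _)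

theorem nonempty_pent_iff : Nonempty (Pent G (Fin 3)) ↔ (pentagon 3).IsIndContained G := by
  constructor
  · rintro ⟨P⟩
    have hab : ∀ i, P.a ≠ P.b i := fun i h => P.bb i (i + 1) ((by decide : ∀ i : Fin 3, i ≠ i + 1) i) (h ▸ P.ab _)
    have hac : ∀ i, P.a ≠ P.c i := fun i => ne_of_not_cadj (P.ac i)
    have hbc : ∀ i j, P.b i ≠ P.c j := by
      intro i j h
      refine P.bc_ne i (i + 1) ((by decide : ∀ i : Fin 3, i ≠ i + 1) i) ?_
      rw [h]
      exact P.cc _ _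
    have hcc : ∀ i j, P.c i = P.c j → i = j := by
      intro i j h
      by_contra hij
      exact P.bc_ne i j hij (h ▸ P.bc i)
    refine ⟨⟨⟨fun
      | .inl _ => P.a
      | .inr (.inl i) => P.b i
      | .inr (.inr i) => P.c i, ?_⟩, ?_⟩⟩
    · rintro (_ | i | i) (_ | j | j) h
      · rfl
      · exact absurd h (hab j)
      · exact absurd h (hac j)
      · exact absurd h.symm (hab i)
      · rw [P.b_injective h]
      · exact absurd h (hbc i j)
      · exact absurd h.symm (hac i)
      · exact absurd h.symm (hbc j i)
      · rw [hcc i j h]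
    · rintro (_ | i | i) (_ | j | j)
      · exact iff_of_false (G.loopless.irrefl _) id
      · exact iff_of_true ((P.ab j).adj (hab j)) trivial
      · exact iff_of_false (not_adj_of_not_cadj (P.ac j)) id
      · exact iff_of_true ((P.ab i).adj (hab i)).symm trivial
      · refine iff_of_false (fun h => ?_) id
        exact P.bb i j (fun hij => h.ne (hij ▸ rfl)) (Or.inr h)
      · refine ⟨fun h => ?_, fun h => ?_⟩
        · by_contra hij
          exact P.bc_ne i j hij (Or.inr h)
        · obtain rfl : i = j := h
          exact (P.bc i).adj (hbc i i)
      · exact iff_of_false (fun h => P.ac i (Or.inr h.symm)) id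
      · refine ⟨fun h => ?_, fun h => ?_⟩
        · by_contra hij
          exact P.bc_ne j i (Ne.symm hij) (Or.inr h.symm)
        · obtain rfl : i = j := h
          exact ((P.bc i).adj (hbc i i)).symm
      · exact ⟨fun h hij => h.ne (hij ▸ rfl), fun h => (P.cc i j).adj fun h' => h (hcc i j h')⟩
  · rintro ⟨f⟩
    have hf : ∀ x y, G.CAdj (f x) (f y) ↔ (pentagon 3).CAdj x y := by
      intro x y
      simp [CAdj]
    exact ⟨{
      a := f (.inl ())
      b := fun i => f (.inr (.inl i))
      c := fun i => f (.inr (.inr i))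
      ab := fun i => (hf _ _).2 (Or.inr trivial)
      ac := fun i h => by
        rcases (hf _ _).1 h with h | h
        · cases h
        · exact h
      bb := fun i j hij h => by
        rcases (hf _ _).1 h with h | h
        · exact hij (by simpa using h)
        · exact h
      cc := fun i j => (hf _ _).2 (by
        by_cases h : i = j
        · exact Or.inl (by rw [h])
        · exact Or.inr h)
      bc := fun i => (hf _ _).2 (Or.inr rfl)
      bc_ne := fun i j hij h => by
        rcases (hf _ _).1 h with h | h
        · cases h
        · exact hij h }⟩

theorem exists_largest_pent [Finite V] (P : Pent G (Fin 3)) :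
    ∃ t, 3 ≤ t ∧ Nonempty (Pent G (Fin t)) ∧ IsEmpty (Pent G (Fin (t + 1))) := by
  by_contra! h
  have h' : ∀ n, Nonempty (Pent G (Fin (n + 3))) := by
    intro n
    induction n with
    | zero => exact ⟨P⟩
    | succ n ih => exact h (n + 3) (by omega) ih
  obtain ⟨Q⟩ := h' (Nat.card V)
  have := Nat.card_le_card_of_injective _ Q.b_injective
  simp at this

/-- The case distinction is over all 3-pentagons, because excluding type `AA` for every one of them
is what allows pentagons to be changed in the second case. -/
theorem PatternFree.isFiveBasket_or [Finite V] (hG : G.PatternFree)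
    (hs : ∀ v, ¬ G.IsSimplicialVertex v) (hu : ∀ v, ∃ w, ¬ G.CAdj v w) (P : Pent G (Fin 3)) :
    G.IsFiveBasket ∨ G.IsVilla ∨ G.IsMansion := by
  by_cases h : ∃ (P : Pent G (Fin 3)) (v : V) (i : Fin 3), P.code v = .AA i
  · obtain ⟨P, v, i, h⟩ := h
    exact Or.inl (Pent.isFiveBasket_of_AA hG hs hu h)
  · push Not at h
    obtain ⟨t, ht, ⟨Q⟩, hmax⟩ := exists_largest_pent P
    exact Or.inr (Q.isVilla_or_isMansion hG hs h ht hu hmax)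

/-- The set of vertices with a nonneighbour. -/
def nonuniversal (G : SimpleGraph V) : Set V := {v | ∃ w, ¬ G.CAdj v w}

theorem cadj_induce {S : Set V} {x y : S} : (G.induce S).CAdj x y ↔ G.CAdj x y := by
  simp [CAdj, Subtype.ext_iff]

theorem exists_isObtainedByAddingUniversal [Finite V] (hG : G.PatternFree)
    (hs : ∀ v, ¬ G.IsSimplicialVertex v) (hP : (pentagon 3).IsIndContained G) :
    ∃ S : Set V, G.IsObtainedByAddingUniversal S ∧
      ((G.induce S).IsFiveBasket ∨ (G.induce S).IsVilla ∨ (G.induce S).IsMansion) := by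
  obtain ⟨P⟩ := nonempty_pent_iff.2 hP
  have hS : ∀ v ∉ G.nonuniversal, ∀ w, G.CAdj v w := by
    intro v hv w
    by_contra h
    exact hv ⟨w, h⟩
  have hmem : ∀ {v w}, ¬ G.CAdj v w → v ∈ G.nonuniversal := fun h => ⟨_, h⟩
  have hmem' : ∀ {v w}, ¬ G.CAdj v w → w ∈ G.nonuniversal := fun h => ⟨_, mt CAdj.symm h⟩
  refine ⟨G.nonuniversal, ⟨fun v hv w hw hvw => (hS v hv w).adj hvw,
    fun v hv w hw => (hS v hv w).adj fun h => hv (h ▸ hw)⟩, ?_⟩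
  refine PatternFree.isFiveBasket_or ?_ ?_ ?_ ?_
  · rintro H hH ⟨f, hf⟩
    refine hG H hH ⟨fun i => f i, fun i hi j hj => ?_⟩
    rw [← cadj_induce]
    exact hf i hi j hj
  -- Two nonadjacent neighbours of `v` are both nonuniversal. So a vertex that is simplicial in the
  -- induced subgraph is simplicial in `G`.
  · rintro ⟨v, hv⟩ h
    refine hs v fun x hx y hy hxy => ?_
    by_contra hxy'
    have hxy'' : ¬ G.CAdj x y := fun h' => h'.elim hxy hxy'
    exact hxy' (h (x := ⟨x, hmem hxy''⟩) hx (y := ⟨y, hmem' hxy''⟩) hy (by simpa using hxy))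
  · rintro ⟨v, w, hw⟩
    exact ⟨⟨w, hmem' hw⟩, mt cadj_induce.1 hw⟩
  · exact {
      a := ⟨P.a, hmem (P.ac 0)⟩
      b := fun i => ⟨P.b i, hmem (P.bb i (i + 1) (by revert i; decide))⟩
      c := fun i => ⟨P.c i, hmem' (P.ac i)⟩
      ab := fun i => cadj_induce.2 (P.ab i)
      ac := fun i => mt cadj_induce.1 (P.ac i)
      bb := fun i j h => mt cadj_induce.1 (P.bb i j h)
      cc := fun i j => cadj_induce.2 (P.cc i j)
      bc := fun i => cadj_induce.2 (P.bc i)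
      bc_ne := fun i j h => mt cadj_induce.1 (P.bc_ne i j h) }

end
section
variable {V : Type*} {G : SimpleGraph V}

/-! ### Baskets, villas and mansions have no forbidden patterns -/

/-- Every value of `o` is the truth value of `p`. -/
def Agrees (o : Option Bool) (p : Prop) : Prop := ∀ b ∈ o, (p ↔ b = true)

theorem agrees_none {p : Prop} : Agrees none p := by simp [Agrees]

theorem agrees_true {p : Prop} (h : p) : Agrees (some true) p := by simp [Agrees, h]

theorem agrees_false {p : Prop} (h : ¬ p) : Agrees (some false) p := by simp [Agrees, h]

theorem IsNestedOrdering.adj_or_adj {X Y : Set V} {n : ℕ} {x : Fin (n + 1) → V}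
    (h : G.IsNestedOrdering X Y x) {b b' c c' : V} (hb : b ∈ X) (hb' : b' ∈ X) (hc : c ∈ Y)
    (hc' : c' ∈ Y) (hbc : G.Adj b c) (hbc' : G.Adj b' c') : G.Adj b c' ∨ G.Adj b' c := by
  obtain ⟨-, rfl, h, -⟩ := h
  obtain ⟨k, rfl⟩ := hb
  obtain ⟨l, rfl⟩ := hb'
  rcases le_total k l with hkl | hkl
  · exact Or.inl (h hkl ⟨hbc', hc'⟩).1
  · exact Or.inr (h hkl ⟨hbc, hc⟩).1

/-- Compatibility of labels of vertices `i` and `j` of the pattern `H`. -/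
def labelOk (rel : ℕ × ℕ → ℕ × ℕ → Option Bool) (can : ℕ → ℕ × ℕ → ℕ → ℕ × ℕ → Bool)
    (H : List ℕ) (i : ℕ) (l : ℕ × ℕ) (j : ℕ) (m : ℕ × ℕ) : Bool :=
  can i l j m && (rel l m).all (· == entry H i j)

/-- The labellings of a four-cycle with consecutive vertices labelled `p, p, q, q`. -/
def squareLabels (p q : ℕ × ℕ) : List (List (ℕ × ℕ × ℕ)) :=
  [[(3, q), (2, q), (1, p), (0, p)], [(3, p), (2, q), (1, q), (0, p)],
    [(3, q), (2, p), (1, p), (0, q)], [(3, p), (2, p), (1, q), (0, q)]]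

/-- Whether some pattern has a labelling that is not excluded by `squareLabels p q`. -/
def somePattern (rel : ℕ × ℕ → ℕ × ℕ → Option Bool) (can : ℕ → ℕ × ℕ → ℕ → ℕ × ℕ → Bool)
    (cand : ℕ → List (ℕ × ℕ)) (p q : ℕ × ℕ) : Bool :=
  patterns.any fun H => search (labelOk rel can H) cand
    (fun acc => !(squareLabels p q).contains acc) (List.range H.length) []

/-- The search leaves only four-cycles with consecutive labels `p, p, q, q`. The last clause of `hg`
expresses nestedness: two edges between the parts `p` and `q` force one of the two crossing edges,
which would be a diagonal. -/
theorem patternFree_of_somePattern {rel : ℕ × ℕ → ℕ × ℕ → Option Bool}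
    {can : ℕ → ℕ × ℕ → ℕ → ℕ × ℕ → Bool} {cand : ℕ → List (ℕ × ℕ)} {p q : ℕ × ℕ}
    (h : somePattern rel can cand p q = false)
    (hg : ∀ f : ℕ → V, ∃ g : ℕ → ℕ × ℕ, (∀ i, g i ∈ cand i) ∧
      (∀ i j, i ≠ j → can i (g i) j (g j) = true) ∧
      (∀ i j, Agrees (rel (g i) (g j)) (G.CAdj (f i) (f j))) ∧
      ∀ i j k l, g i = p → g j = p → g k = q → g l = q → G.CAdj (f i) (f k) →
        G.CAdj (f j) (f l) → ¬ G.CAdj (f i) (f l) → G.CAdj (f j) (f k)) :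
    G.PatternFree := by
  rintro H hH ⟨f, hf⟩
  obtain ⟨g, hcand, hcan, hrel, hkill⟩ := hg f
  simp only [somePattern, List.any_eq_false] at h
  apply h H hH
  refine search_of_exists (leaf := fun acc => !(squareLabels p q).contains acc) g hcand
    (List.range H.length) [] ?_ ?_ ?_
  · simpa using List.nodup_range
  · intro i hi j hj hij
    simp only [List.append_nil, List.mem_reverse, List.mem_range] at hi hj
    simp only [labelOk, Bool.and_eq_true, hcan i j hij, true_and, Option.all_eq_true, beq_iff_eq]
    intro b hb
    rw [Bool.eq_iff_iff, ← hf i hi j hj]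
    exact (hrel i j b hb).symm
  · simp only [List.append_nil, Bool.not_eq_true', ← Bool.not_eq_true, List.contains_iff_mem]
    intro hmem
    have hlen : H.length = 4 := by
      have : ∀ s ∈ squareLabels p q, s.length = 4 := by simp [squareLabels]
      simpa using this _ hmem
    -- The four-cycle is the only forbidden graph on four vertices.
    have hC4 : H = patternC4 := (by decide : ∀ H ∈ patterns, H.length = 4 → H = patternC4) H hH hlen
    subst hC4
    have h' : ∀ i < 4, ∀ j < 4, (G.CAdj (f i) (f j) ↔ entry patternC4 i j = true) := hf
    have e01 : G.CAdj (f 0) (f 1) := (h' _ (by decide) _ (by decide)).2 (by decide)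
    have e12 : G.CAdj (f 1) (f 2) := (h' _ (by decide) _ (by decide)).2 (by decide)
    have e23 : G.CAdj (f 2) (f 3) := (h' _ (by decide) _ (by decide)).2 (by decide)
    have e30 : G.CAdj (f 3) (f 0) := (h' _ (by decide) _ (by decide)).2 (by decide)
    have e02 : ¬ G.CAdj (f 0) (f 2) := fun h => absurd ((h' _ (by decide) _ (by decide)).1 h) (by decide)
    have e13 : ¬ G.CAdj (f 1) (f 3) := fun h => absurd ((h' _ (by decide) _ (by decide)).1 h) (by decide)
    simp [squareLabels, show patternC4.length = 4 from rfl, List.range_succ] at hmem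
    rcases hmem with ⟨h3, h2, h1, h0⟩ | ⟨h3, h2, h1, h0⟩ | ⟨h3, h2, h1, h0⟩ | ⟨h3, h2, h1, h0⟩
    · exact e02 (hkill 1 0 2 3 h1 h0 h2 h3 e12 e30.symm e13)
    · exact e13 (hkill 0 3 1 2 h0 h3 h1 h2 e01 e23.symm e02).symm
    · exact e13 (hkill 2 1 3 0 h2 h1 h3 h0 e23 e01.symm (mt CAdj.symm e02))
    · exact e02 (hkill 3 2 0 1 h3 h2 h0 h1 e30 e12.symm (mt CAdj.symm e13)).symm

/-- Adjacency between the parts of a villa or mansion; the parts `A, F, X, Y, B i, C i` are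
numbered from `0` to `5`, `s` says that the part numbered `l` has the index of the parts
anticomplete to `F`, and `e` says that both parts have the same index. -/
def villaTable : ℕ → ℕ → Bool → Bool → Option Bool
  | 0, 3, _, _ => some false
  | 0, 5, _, _ => some false
  | 1, 4, s, _ => some !s
  | 1, 5, s, _ => some !s
  | 2, 3, _, _ => some false
  | 2, 4, s, _ => some s
  | 2, 5, _, _ => some false
  | 3, 4, _, _ => some false
  | 4, 4, _, e => some e
  | 4, 5, _, false => some false
  | 4, 5, true, true => some true
  | 4, 5, false, true => none
  | _, _, _, _ => some true

def villaRel (l m : ℕ × ℕ) : Option Bool :=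
  if l.1 ≤ m.1 then villaTable l.1 m.1 (m.2 == 0) (l.2 == m.2)
  else villaTable m.1 l.1 (l.2 == 0) (l.2 == m.2)

/-- The index of a part is given as one plus its first occurrence. -/
def villaCan (_ : ℕ) (l : ℕ × ℕ) (j : ℕ) (m : ℕ × ℕ) : Bool := l.2 != j + 1 || m.2 == j + 1

/-- Index 0 is that of the parts anticomplete to `F`, shared with the parts without index. Any other
index is one plus a position at most `i`, so the bound is `i + 2`. -/
def villaCand (i : ℕ) : List (ℕ × ℕ) :=
  [(0, 0), (1, 0), (2, 0), (3, 0)] ++ (List.range (i + 2)).map (4, ·) ++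
    (List.range (i + 2)).map (5, ·)

/-- Numbering the indices by first occurrence keeps the search finite for all t at once. A
four-cycle inside one nested pair has all its indices equal to that of its first vertex, hence the
labels `(4, 1)` and `(5, 1)`. -/
theorem somePattern_villa : somePattern villaRel villaCan villaCand (4, 1) (5, 1) = false := by
  decide +kernel

/-- Adjacency between the parts of a 5-basket; the parts `A, F, B i, C i` are numbered
`0, 1, 4, 5`. -/
def basketTable (i₀ j₀ : ℕ) : ℕ × ℕ → ℕ × ℕ → Option Bool
  | (0, _), (4, i) => if i = i₀ then none else some true
  | (0, _), (5, _) => some false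
  | (1, _), (4, i) => some (i != j₀)
  | (1, _), (5, i) => some (i != j₀)
  | (4, i), (4, j) => some (i == j)
  | (4, i), (5, j) => some (i == j)
  | _, _ => some true

def basketRel (i₀ j₀ : ℕ) (l m : ℕ × ℕ) : Option Bool :=
  if l.1 ≤ m.1 then basketTable i₀ j₀ l m else basketTable i₀ j₀ m l

def basketCand (_ : ℕ) : List (ℕ × ℕ) :=
  [(0, 0), (1, 0), (4, 0), (4, 1), (4, 2), (5, 0), (5, 1), (5, 2)]

theorem somePattern_basket : ∀ i₀ j₀ : Fin 3,
    somePattern (basketRel i₀ j₀) (fun _ _ _ _ => true) basketCand (0, 0) (4, i₀) = false := by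
  decide +kernel

end
-- Labelling the vertices by the parts that contain them
section
variable {V : Type*} {G : SimpleGraph V} {x y : V} {S T : Set V} {o : Option Bool}

theorem Agrees.symm (h : Agrees o (G.CAdj x y)) : Agrees o (G.CAdj y x) :=
  fun b hb => cadj_comm.trans (h b hb)

theorem IsClique.agrees (h : G.IsClique S) (hx : x ∈ S) (hy : y ∈ S) :
    Agrees (some true) (G.CAdj x y) := by
  refine agrees_true ?_
  by_cases hxy : x = y
  · exact Or.inl hxy
  · exact Or.inr (h hx hy hxy)

theorem CompleteTo.agrees (h : G.CompleteTo S T) (hx : x ∈ S) (hy : y ∈ T) :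
    Agrees (some true) (G.CAdj x y) := agrees_true (Or.inr (h x hx y hy))

theorem CompleteTo.agrees_symm (h : G.CompleteTo S T) (hx : x ∈ T) (hy : y ∈ S) :
    Agrees (some true) (G.CAdj x y) := (h.agrees hy hx).symm

theorem AnticompleteTo.not_cadj (h : G.AnticompleteTo S T) (hd : Disjoint S T) (hx : x ∈ S)
    (hy : y ∈ T) : ¬ G.CAdj x y := by
  rintro (rfl | h')
  · exact Set.disjoint_left.1 hd hx hy
  · exact h x hx y hy h'

theorem AnticompleteTo.agrees (h : G.AnticompleteTo S T) (hd : Disjoint S T) (hx : x ∈ S)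
    (hy : y ∈ T) : Agrees (some false) (G.CAdj x y) := agrees_false (h.not_cadj hd hx hy)

theorem AnticompleteTo.agrees_symm (h : G.AnticompleteTo S T) (hd : Disjoint S T) (hx : x ∈ T)
    (hy : y ∈ S) : Agrees (some false) (G.CAdj x y) := (h.agrees hd hy hx).symm

theorem IsFiveBasket.patternFree (h : G.IsFiveBasket) : G.PatternFree := by
  obtain ⟨A, B, C, F, h⟩ := h
  obtain ⟨i₀, hAB, n, a, ha⟩ := h.exists_i
  obtain ⟨j₀, hFA, hFBC, hFB, hFC⟩ := h.exists_j
  obtain ⟨hdisj, huniv⟩ := h.partition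
  have hlab : ∀ v, ∃ k, v ∈ (Sum.elim ![A, F] (Sum.elim B C)) k :=
    fun v => Set.mem_iUnion.1 (huniv ▸ Set.mem_univ v)
  choose lab hlab using hlab
  let label : Fin 2 ⊕ (Fin 3 ⊕ Fin 3) → ℕ × ℕ
    | .inl k => (k, 0)
    | .inr (.inl i) => (4, i)
    | .inr (.inr i) => (5, i)
  have hd : ∀ k l, k ≠ l → Disjoint ((Sum.elim ![A, F] (Sum.elim B C)) k)
    ((Sum.elim ![A, F] (Sum.elim B C)) l) := fun k l hkl => hdisj hkl
  have key : ∀ k l x y, x ∈ (Sum.elim ![A, F] (Sum.elim B C)) k →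
      y ∈ (Sum.elim ![A, F] (Sum.elim B C)) l → (label k).1 ≤ (label l).1 →
      Agrees (basketTable i₀ j₀ (label k) (label l)) (G.CAdj x y) := by
    rintro (k | i | i) (l | j | j) x y hx hy hkl
    · fin_cases k <;> fin_cases l
      · exact h.clique_A.agrees hx hy
      · exact hFA.agrees_symm hx hy
      · simp [label] at hkl
      · exact h.clique_F.agrees hx hy
    · fin_cases k
      · by_cases hj : j = i₀
        · simp [label, basketTable, hj, agrees_none]
        · simpa [label, basketTable, Fin.val_inj, hj] using (hAB j hj).agrees hx hy
      · by_cases hj : j = j₀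
        · subst hj
          simpa [label, basketTable] using hFB.agrees (hd (.inl 1) (.inr (.inl j)) (by simp)) hx hy
        · simpa [label, basketTable, bne_iff_ne.2 (Fin.val_ne_iff.2 hj)] using (hFBC j hj).1.agrees hx hy
    · fin_cases k
      · exact (h.A_anticomplete_C j).agrees (hd (.inl 0) (.inr (.inr j)) (by simp)) hx hy
      · by_cases hj : j = j₀
        · subst hj
          simpa [label, basketTable] using hFC.agrees (hd (.inl 1) (.inr (.inr j)) (by simp)) hx hy
        · simpa [label, basketTable, bne_iff_ne.2 (Fin.val_ne_iff.2 hj)] using (hFBC j hj).2.agrees hx hy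
    · fin_cases l <;> simp [label] at hkl
    · by_cases hij : i = j
      · subst hij
        simpa [label, basketTable] using (h.clique_B i).agrees hx hy
      · simpa [label, basketTable, beq_eq_false_iff_ne.2 (Fin.val_ne_iff.2 hij)] using (h.B_anticomplete_B i j hij).agrees
          (hd (.inr (.inl i)) (.inr (.inl j)) (by simpa using hij)) hx hy
    · by_cases hij : i = j
      · subst hij
        simpa [label, basketTable] using (h.B_complete_C i).agrees hx hy
      · simpa [label, basketTable, beq_eq_false_iff_ne.2 (Fin.val_ne_iff.2 hij)] using (h.B_anticomplete_C i j hij).agrees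
          (hd (.inr (.inl i)) (.inr (.inr j)) (by simp)) hx hy
    · fin_cases l <;> simp [label] at hkl
    · simp [label] at hkl
    · by_cases hij : i = j
      · subst hij
        exact (h.clique_C i).agrees hx hy
      · exact (h.C_complete_C i j hij).agrees hx hy
  have hA : ∀ k, label k = (0, 0) → k = .inl 0 := by
    rintro (k | k | k) hk
    · fin_cases k
      · rfl
      · simp [label] at hk
    · simp [label] at hk
    · simp [label] at hk
  have hB : ∀ k, label k = (4, (i₀ : ℕ)) → k = .inr (.inl i₀) := by
    rintro (k | k | k) hk
    · fin_cases k <;> simp [label] at hk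
    · simp only [label, Prod.mk.injEq, true_and, Fin.val_inj] at hk
      rw [hk]
    · simp [label] at hk
  refine patternFree_of_somePattern (somePattern_basket i₀ j₀) fun f =>
    ⟨fun i => label (lab (f i)), fun i => ?_, fun i j _ => rfl, fun i j => ?_, ?_⟩
  · exact (by decide : ∀ k, label k ∈ basketCand 0) _
  · rw [basketRel]
    split_ifs with hij
    · exact key _ _ _ _ (hlab _) (hlab _) hij
    · exact (key _ _ _ _ (hlab _) (hlab _) (not_le.1 hij).le).symm
  · intro i j k l hi hj hk hl hik hjl hil
    have hi' := hlab (f i)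
    have hj' := hlab (f j)
    have hk' := hlab (f k)
    have hl' := hlab (f l)
    rw [hA _ hi] at hi'
    rw [hA _ hj] at hj'
    rw [hB _ hk] at hk'
    rw [hB _ hl] at hl'
    have hne := Set.disjoint_left.1 (hd (.inl 0) (.inr (.inl i₀)) (by simp))
    rcases ha.adj_or_adj hi' hj' hk' hl' (hik.adj fun h => hne hi' (h ▸ hk'))
      (hjl.adj fun h => hne hj' (h ▸ hl')) with h | h
    · exact absurd (Or.inr h) hil
    · exact Or.inr h

/-! ### Absence of forbidden patterns in villas and mansions -/

section
variable {t : ℕ}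

/-- The number of a part of a villa or mansion. -/
def partKind : Fin 4 ⊕ (Fin t ⊕ Fin t) → ℕ
  | .inl k => k
  | .inr (.inl _) => 4
  | .inr (.inr _) => 5

/-- The index of a part of a villa or mansion, if it is different from `j₀`. -/
def partIdx (j₀ : Option (Fin t)) : Fin 4 ⊕ (Fin t ⊕ Fin t) → Option (Fin t)
  | .inl _ => none
  | .inr (.inl i) => if some i = j₀ then none else some i
  | .inr (.inr i) => if some i = j₀ then none else some i

theorem ite_eq_none_inj {j₀ : Option (Fin t)} {i j : Fin t}
    (h : (if some i = j₀ then none else some i) = if some j = j₀ then none else some j) :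
    i = j := by
  split_ifs at h with hi hj
  · exact Option.some_injective _ (hi.trans hj.symm)
  · exact Option.some_injective _ h

theorem patternFree_of_villaTable (j₀ : Option (Fin t)) (lab : V → Fin 4 ⊕ (Fin t ⊕ Fin t))
    (hrel : ∀ x y, partKind (lab x) ≤ partKind (lab y) →
      Agrees (villaTable (partKind (lab x)) (partKind (lab y)) (partIdx j₀ (lab y)).isNone
        (partIdx j₀ (lab x) == partIdx j₀ (lab y))) (G.CAdj x y))
    (hnest : ∀ i b b' c c', lab b = .inr (.inl i) → lab b' = .inr (.inl i) →
      lab c = .inr (.inr i) → lab c' = .inr (.inr i) → G.CAdj b c → G.CAdj b' c' →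
      ¬ G.CAdj b c' → G.CAdj b' c) : G.PatternFree := by
  classical
  refine patternFree_of_somePattern somePattern_villa fun f => ?_
  let idx : ℕ → Option (Fin t) := fun i => partIdx j₀ (lab (f i))
  have hex : ∀ i, ∃ m, idx m = idx i := fun i => ⟨i, rfl⟩
  let first : ℕ → ℕ := fun i => Nat.find (hex i)
  have hfirst : ∀ i, idx (first i) = idx i := fun i => Nat.find_spec (hex i)
  have hle : ∀ i, first i ≤ i := fun i => Nat.find_min' (hex i) rfl
  have hcongr : ∀ i j, idx i = idx j → first i = first j := fun i j h => by
    simp only [first, h]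
  -- The number is 0 for the index `j₀` and for the parts without index, and otherwise one plus the
  -- first position at which the index occurs.
  let num : ℕ → ℕ := fun i => if idx i = none then 0 else first i + 1
  have hnum0 : ∀ i, (num i == 0) = (idx i).isNone := by
    intro i
    by_cases h : idx i = none
    · simp [num, h]
    · simp [num, h, Option.isSome_iff_ne_none]
  have hnum : ∀ i j, (num i == num j) = (idx i == idx j) := by
    intro i j
    rw [Bool.eq_iff_iff, beq_iff_eq, beq_iff_eq]
    constructor
    · intro h
      by_cases hi : idx i = none <;> by_cases hj : idx j = none
      · rw [hi, hj]
      · simp [num, hi, hj] at h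
      · simp [num, hi, hj] at h
      · simp only [num, hi, hj, if_false, Nat.add_right_cancel_iff] at h
        rw [← hfirst i, ← hfirst j, h]
    · intro h
      simp only [num, h, hcongr i j h]
  have hmemB : ∀ i, num i ∈ List.range (i + 2) := by
    intro i
    have := hle i
    simp only [num, List.mem_range]
    split_ifs <;> omega
  refine ⟨fun i => (partKind (lab (f i)), num i), fun i => ?_, fun i j _ => ?_, fun i j => ?_, ?_⟩
  · rcases h : lab (f i) with k | k | k
    · have : num i = 0 := by simp [num, idx, h, partIdx]
      simp only [this, h]
      simp only [partKind, villaCand]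
      fin_cases k <;> simp
    · simpa [h, partKind, villaCand] using hmemB i
    · simpa [h, partKind, villaCand] using hmemB i
  · simp only [villaCan, Bool.or_eq_true, bne_iff_ne, ne_eq, beq_iff_eq, ← imp_iff_not_or]
    intro h
    have hi : idx i ≠ none := by
      intro hi
      simp [num, hi] at h
    simp only [num, hi, if_false, Nat.add_right_cancel_iff] at h
    have hij : idx j = idx i := by rw [← h, hfirst]
    simp only [num, hij, hi, if_false, hcongr j i hij, h]
  · simp only [villaRel]
    split_ifs with hij
    · rw [hnum0, hnum]
      exact hrel _ _ hij
    · rw [hnum0, hnum]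
      have := (hrel _ _ (not_le.1 hij).le).symm
      rwa [show (partIdx j₀ (lab (f j)) == partIdx j₀ (lab (f i))) = (idx i == idx j) from
        Bool.beq_comm] at this
  · intro i j k l hi hj hk hl hik hjl hil
    simp only [Prod.mk.injEq] at hi hj hk hl
    have hB : ∀ i, partKind (lab (f i)) = 4 ∧ num i = 1 → ∃ m, lab (f i) = .inr (.inl m) ∧
        idx i = some m := by
      rintro i ⟨h, h'⟩
      rcases hk : lab (f i) with k | k | k
      · rw [hk] at h
        exact absurd h (by simp only [partKind]; omega)
      · refine ⟨k, rfl, ?_⟩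
        by_contra hne
        have : idx i = none := by
          simp only [idx, hk, partIdx] at hne ⊢
          split_ifs at hne ⊢
          · rfl
          · exact absurd rfl hne
        simp [num, this] at h'
      · rw [hk] at h
        simp [partKind] at h
    have hC : ∀ i, partKind (lab (f i)) = 5 ∧ num i = 1 → ∃ m, lab (f i) = .inr (.inr m) ∧
        idx i = some m := by
      rintro i ⟨h, h'⟩
      rcases hk : lab (f i) with k | k | k
      · rw [hk] at h
        exact absurd h (by simp only [partKind]; omega)
      · rw [hk] at h
        simp [partKind] at h
      · refine ⟨k, rfl, ?_⟩
        by_contra hne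
        have : idx i = none := by
          simp only [idx, hk, partIdx] at hne ⊢
          split_ifs at hne ⊢
          · rfl
          · exact absurd rfl hne
        simp [num, this] at h'
    obtain ⟨mi, hi1, hi2⟩ := hB i hi
    obtain ⟨mj, hj1, hj2⟩ := hB j hj
    obtain ⟨mk, hk1, hk2⟩ := hC k hk
    obtain ⟨ml, hl1, hl2⟩ := hC l hl
    -- All four vertices have number 1, so they lie in one and the same nested pair.
    have hidx : ∀ a b, num a = 1 → num b = 1 → idx a = idx b := by
      intro a b ha hb
      have := hnum a b
      rw [ha, hb] at this
      simpa using this.symm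
    have e1 : mj = mi := by simpa [hi2, hj2] using hidx j i hj.2 hi.2
    have e2 : mk = mi := by simpa [hi2, hk2] using hidx k i hk.2 hi.2
    have e3 : ml = mi := by simpa [hi2, hl2] using hidx l i hl.2 hi.2
    subst e1 e2 e3
    exact hnest _ _ _ _ _ hi1 hj1 hk1 hl1 hik hjl hil

/-- Common to villas and mansions: `P` lists all parts, including F, X and Y, and `hrel` is only
asked for pairs that involve one of these three. -/
theorem IsVillaPartitionOn.patternFree {S : Set V} {A : Set V} {B C : Fin t → Set V}
    (h : G.IsVillaPartitionOn S t A B C) (j₀ : Option (Fin t))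
    (P : Fin 4 ⊕ (Fin t ⊕ Fin t) → Set V) (hP0 : P (.inl 0) = A)
    (hPB : ∀ i, P (.inr (.inl i)) = B i) (hPC : ∀ i, P (.inr (.inr i)) = C i)
    (hcov : ∀ v, ∃ k, v ∈ P k) (hdisj : ∀ k l, k ≠ l → Disjoint (P k) (P l))
    (hBC : ∀ j, j₀ = some j → G.CompleteTo (B j) (C j))
    (hrel : ∀ (k : Fin 4) l, (k ≠ 0 ∨ ∃ l', l = .inl l' ∧ l' ≠ 0) → (k : ℕ) ≤ partKind l →
      ∀ x ∈ P (.inl k), ∀ y ∈ P l,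
      Agrees (villaTable k (partKind l) (partIdx j₀ l).isNone (none == partIdx j₀ l))
        (G.CAdj x y)) : G.PatternFree := by
  choose lab hlab using hcov
  refine patternFree_of_villaTable j₀ lab (fun x y => ?_) ?_
  · have hx := hlab x
    have hy := hlab y
    generalize lab x = k at *
    generalize lab y = l at *
    intro hkl
    by_cases hkl' : (∃ k', k = .inl k' ∧ k' ≠ 0) ∨ ∃ k', k = .inl k' ∧ ∃ l', l = .inl l' ∧ l' ≠ 0
    · obtain ⟨k, rfl, hk⟩ | ⟨k, rfl, hk⟩ := hkl'
      · exact hrel k l (Or.inl hk) hkl x hx y hy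
      · exact hrel k l (Or.inr hk) hkl x hx y hy
    · rcases k with k | i | i <;> rcases l with l | j | j
      · have hk : k = 0 := by by_contra hk; exact hkl' (Or.inl ⟨k, rfl, hk⟩)
        have hl : l = 0 := by by_contra hl; exact hkl' (Or.inr ⟨k, rfl, l, rfl, hl⟩)
        subst hk hl
        rw [hP0] at hx hy
        exact h.clique_A.agrees hx hy
      · have hk : k = 0 := by by_contra hk; exact hkl' (Or.inl ⟨k, rfl, hk⟩)
        subst hk
        rw [hP0] at hx
        rw [hPB] at hy
        exact (h.A_complete_B j).agrees hx hy
      · have hk : k = 0 := by by_contra hk; exact hkl' (Or.inl ⟨k, rfl, hk⟩)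
        subst hk
        have hd := hdisj _ _ (by simp) |>.mono_left hP0.ge |>.mono_right (hPC j).ge
        rw [hP0] at hx
        rw [hPC] at hy
        exact (h.A_anticomplete_C j).agrees hd hx hy
      · simp only [partKind] at hkl; omega
      · by_cases hij : i = j
        · subst hij
          rw [hPB] at hx hy
          simpa [partKind, villaTable] using (h.clique_B i).agrees hx hy
        · have hd := hdisj (.inr (.inl i)) (.inr (.inl j)) (by simpa using hij)
          rw [hPB, hPB] at hd
          rw [hPB] at hx hy
          simpa [partKind, villaTable, partIdx, beq_eq_false_iff_ne.2 (mt ite_eq_none_inj hij)]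
            using (h.B_anticomplete_B i j hij).agrees hd hx hy
      · have hd := hdisj (.inr (.inl i)) (.inr (.inr j)) (by simp)
        rw [hPB, hPC] at hd
        rw [hPB] at hx
        rw [hPC] at hy
        by_cases hij : i = j
        · subst hij
          by_cases hi : some i = j₀
          · simpa [partKind, villaTable, partIdx, hi] using (hBC i hi.symm).agrees hx hy
          · simp [partKind, villaTable, partIdx, hi, agrees_none]
        · simpa [partKind, villaTable, partIdx, beq_eq_false_iff_ne.2 (mt ite_eq_none_inj hij)]
            using (h.B_anticomplete_C i j hij).agrees hd hx hy
      · simp only [partKind] at hkl; omega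
      · simp [partKind] at hkl
      · rw [hPC] at hx hy
        by_cases hij : i = j
        · subst hij
          exact (h.clique_C i).agrees hx hy
        · exact (h.C_complete_C i j hij).agrees hx hy
  · intro i b b' c c' hb hb' hc hc' hbc hbc' hbc''
    have h1 := hlab b
    have h2 := hlab b'
    have h3 := hlab c
    have h4 := hlab c'
    have hd := hdisj (.inr (.inl i)) (.inr (.inr i)) (by simp)
    rw [hPB, hPC] at hd
    rw [hb, hPB] at h1
    rw [hb', hPB] at h2
    rw [hc, hPC] at h3
    rw [hc', hPC] at h4
    obtain ⟨n, x, hx, -⟩ := h.nested i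
    rcases hx.adj_or_adj h1 h2 h3 h4
      (hbc.adj fun h => Set.disjoint_left.1 hd h1 (h ▸ h3))
      (hbc'.adj fun h => Set.disjoint_left.1 hd h2 (h ▸ h4)) with h | h
    · exact absurd (Or.inr h) hbc''
    · exact Or.inr h

theorem IsVilla.patternFree (h : G.IsVilla) : G.PatternFree := by
  obtain ⟨t, A, B, C, h⟩ := h
  have hk0 : ∀ k : Fin 4, k ≠ 0 → (![A, ∅, ∅, ∅] : Fin 4 → Set V) k = ∅ := by
    intro k hk
    fin_cases k
    · exact absurd rfl hk
    all_goals rfl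
  obtain ⟨hdisj, huniv⟩ := h.partition
  -- A villa is treated like a mansion in which F, X and Y are empty and no index is special.
  refine h.patternFree none (Sum.elim ![A, ∅, ∅, ∅] (Sum.elim B C)) rfl (fun _ => rfl)
    (fun _ => rfl) (fun v => ?_) (fun k l hkl => ?_) (by simp) ?_
  · obtain ⟨k, hk⟩ := Set.mem_iUnion.1 (huniv ▸ Set.mem_univ v)
    rcases k with k | k
    · exact ⟨.inl 0, by simpa using hk⟩
    · exact ⟨.inr k, hk⟩
  · rcases k with k | k <;> rcases l with l | l
    · by_cases hk : k = 0
      · subst hk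
        simp [hk0 l fun h => hkl (h ▸ rfl)]
      · simp [hk0 k hk]
    · by_cases hk : k = 0
      · subst hk
        exact hdisj (i := .inl 0) (j := .inr l) (by simp)
      · simp [hk0 k hk]
    · by_cases hl : l = 0
      · subst hl
        exact hdisj (i := .inr k) (j := .inl 0) (by simp)
      · simp [hk0 l hl]
    · exact hdisj (i := .inr k) (j := .inr l) (by simpa using hkl)
  · rintro k l (hk | ⟨l, rfl, hl⟩) - x hx y hy
    · simp [hk0 k hk] at hx
    · simp [hk0 l hl] at hy

theorem IsMansion.patternFree (h : G.IsMansion) : G.PatternFree := by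
  obtain ⟨t, A, B, C, F, X, Y, h⟩ := h
  obtain ⟨j₀, hFA, hF, hFB, hFC, hBC, hXA, hXB, hXB', hXC⟩ := h.exists_j
  obtain ⟨hdisj, huniv⟩ := h.partition
  have hd : ∀ k l, k ≠ l → Disjoint ((Sum.elim ![A, F, X, Y] (Sum.elim B C)) k)
    ((Sum.elim ![A, F, X, Y] (Sum.elim B C)) l) := fun k l hkl => hdisj hkl
  refine h.villa.patternFree (some j₀) (Sum.elim ![A, F, X, Y] (Sum.elim B C)) rfl (fun _ => rfl)
    (fun _ => rfl) (fun v => Set.mem_iUnion.1 (huniv ▸ Set.mem_univ v)) hd ?_ ?_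
  · rintro j ⟨⟩
    exact hBC
  · rintro k (l | j | j) hkl hkl' x hx y hy
    · fin_cases k <;> fin_cases l
      · simp at hkl
      · exact hFA.agrees_symm hx hy
      · exact hXA.agrees_symm hx hy
      · exact h.Y_anticomplete_A.agrees_symm (hd (.inl 3) (.inl 0) (by simp)) hx hy
      · simp [partKind] at hkl'
      · exact h.clique_F.agrees hx hy
      · exact h.F_complete_X.agrees hx hy
      · exact h.F_complete_Y.agrees hx hy
      · simp [partKind] at hkl'
      · simp [partKind] at hkl'
      · exact h.clique_X.agrees hx hy
      · exact h.X_anticomplete_Y.agrees (hd (.inl 2) (.inl 3) (by simp)) hx hy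
      · simp [partKind] at hkl'
      · simp [partKind] at hkl'
      · simp [partKind] at hkl'
      · exact h.clique_Y.agrees hx hy
    · have hk : k ≠ 0 := by simpa using hkl
      fin_cases k
      · exact absurd rfl hk
      · by_cases hj : j = j₀
        · subst hj
          simpa [partKind, villaTable, partIdx] using
            hFB.agrees (hd (.inl 1) (.inr (.inl j)) (by simp)) hx hy
        · simpa [partKind, villaTable, partIdx, hj] using (hF j hj).1.agrees hx hy
      · by_cases hj : j = j₀
        · subst hj
          simpa [partKind, villaTable, partIdx] using hXB.agrees hx hy
        · simpa [partKind, villaTable, partIdx, hj] using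
            (hXB' j hj).agrees (hd (.inl 2) (.inr (.inl j)) (by simp)) hx hy
      · exact (h.Y_anticomplete_B j).agrees (hd (.inl 3) (.inr (.inl j)) (by simp)) hx hy
    · have hk : k ≠ 0 := by simpa using hkl
      fin_cases k
      · exact absurd rfl hk
      · by_cases hj : j = j₀
        · subst hj
          simpa [partKind, villaTable, partIdx] using
            hFC.agrees (hd (.inl 1) (.inr (.inr j)) (by simp)) hx hy
        · simpa [partKind, villaTable, partIdx, hj] using (hF j hj).2.agrees hx hy
      · exact (hXC j).agrees (hd (.inl 2) (.inr (.inr j)) (by simp)) hx hy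
      · exact (h.Y_complete_C j).agrees hx hy

end
end
section
variable {V : Type*} {G : SimpleGraph V} {t : ℕ} {S A F X Y : Set V}

/-! ### Nonadjacent vertices in baskets, villas and mansions -/

theorem IsFiveBasket.exists_not_cadj (h : G.IsFiveBasket) (v : V) : ∃ w, ¬ G.CAdj v w := by
  obtain ⟨A, B, C, F, h⟩ := h
  obtain ⟨j₀, -, -, hFB, -⟩ := h.exists_j
  obtain ⟨hdisj, huniv⟩ := h.partition
  have hd : ∀ k l, k ≠ l → Disjoint ((Sum.elim ![A, F] (Sum.elim B C)) k)
    ((Sum.elim ![A, F] (Sum.elim B C)) l) := fun k l hkl => hdisj hkl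
  obtain ⟨a, ha⟩ := h.nonempty_A
  choose b hb using h.nonempty_B
  choose c hc using h.nonempty_C
  obtain ⟨k | i | i, hk⟩ := Set.mem_iUnion.1 (huniv ▸ Set.mem_univ v)
  · fin_cases k
    · exact ⟨c 0, (h.A_anticomplete_C 0).not_cadj (hd (.inl 0) (.inr (.inr 0)) (by simp)) hk (hc 0)⟩
    · exact ⟨b j₀, hFB.not_cadj (hd (.inl 1) (.inr (.inl j₀)) (by simp)) hk (hb j₀)⟩
  · have hi : i ≠ i + 1 := (by decide : ∀ i : Fin 3, i ≠ i + 1) i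
    exact ⟨b (i + 1), (h.B_anticomplete_B i _ hi).not_cadj
      (hd (.inr (.inl i)) (.inr (.inl (i + 1))) (by simp)) hk (hb _)⟩
  · exact ⟨a, mt CAdj.symm
      ((h.A_anticomplete_C i).not_cadj (hd (.inl 0) (.inr (.inr i)) (by simp)) ha hk)⟩

theorem IsFiveBasket.exists_adj_adj (h : G.IsFiveBasket) (v : V) :
    ∃ x y, G.Adj v x ∧ G.Adj v y ∧ ¬ G.CAdj x y := by
  obtain ⟨A, B, C, F, h⟩ := h
  obtain ⟨i₀, hAB, n, x, -, hx, -, hx0⟩ := h.exists_i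
  obtain ⟨j₀, hFA, hFBC, -⟩ := h.exists_j
  obtain ⟨hdisj, huniv⟩ := h.partition
  have hd : ∀ k l, k ≠ l → Disjoint ((Sum.elim ![A, F] (Sum.elim B C)) k)
    ((Sum.elim ![A, F] (Sum.elim B C)) l) := fun k l hkl => hdisj hkl
  have ha : x 0 ∈ A := hx ▸ Set.mem_range_self 0
  choose b hb using h.nonempty_B
  choose c hc using h.nonempty_C
  have hac : ∀ {a i c}, a ∈ A → c ∈ C i → ¬ G.CAdj a c := fun {a i c} ha hc =>
    (h.A_anticomplete_C i).not_cadj (hd (.inl 0) (.inr (.inr i)) (by simp)) ha hc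
  obtain ⟨k | i | i, hk⟩ := Set.mem_iUnion.1 (huniv ▸ Set.mem_univ v)
  · fin_cases k
    · obtain ⟨j, k, hj, hk', hjk⟩ :=
        (by decide : ∀ i : Fin 3, ∃ j k, j ≠ i ∧ k ≠ i ∧ j ≠ k) i₀
      exact ⟨b j, b k, hAB j hj _ hk _ (hb j), hAB k hk' _ hk _ (hb k),
        (h.B_anticomplete_B j k hjk).not_cadj
          (hd (.inr (.inl j)) (.inr (.inl k)) (by simpa using hjk)) (hb j) (hb k)⟩
    · obtain ⟨j, hj⟩ := (by decide : ∀ i : Fin 3, ∃ j, j ≠ i) j₀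
      exact ⟨x 0, c j, hFA _ hk _ ha, (hFBC j hj).2 _ hk _ (hc j), hac ha (hc j)⟩
  · refine ⟨x 0, c i, ?_, h.B_complete_C i _ hk _ (hc i), hac ha (hc i)⟩
    by_cases hi : i = i₀
    · subst hi
      exact (Set.inter_eq_right.1 hx0 hk : G.Adj (x 0) v).symm
    · exact (hAB i hi _ ha _ hk).symm
  · have hi : i ≠ i + 1 := (by decide : ∀ i : Fin 3, i ≠ i + 1) i
    exact ⟨b i, c (i + 1), (h.B_complete_C i _ (hb i) _ hk).symm,
      h.C_complete_C i _ hi _ hk _ (hc _), (h.B_anticomplete_C i _ hi).not_cadj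
        (hd (.inr (.inl i)) (.inr (.inr (i + 1))) (by simp)) (hb i) (hc _)⟩

theorem IsFiveBasket.nonempty_pent (h : G.IsFiveBasket) : Nonempty (Pent G (Fin 3)) := by
  obtain ⟨A, B, C, F, h⟩ := h
  obtain ⟨i₀, hAB, n, x, -, hx, -, hx0⟩ := h.exists_i
  obtain ⟨hdisj, -⟩ := h.partition
  have hd : ∀ k l, k ≠ l → Disjoint ((Sum.elim ![A, F] (Sum.elim B C)) k)
    ((Sum.elim ![A, F] (Sum.elim B C)) l) := fun k l hkl => hdisj hkl
  have ha : x 0 ∈ A := hx ▸ Set.mem_range_self 0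
  choose b hb using h.nonempty_B
  choose c hc using h.nonempty_C
  exact ⟨{
    a := x 0
    b := b
    c := c
    ab := fun i => by
      by_cases hi : i = i₀
      · subst hi
        exact Or.inr (Set.inter_eq_right.1 hx0 (hb i))
      · exact Or.inr (hAB i hi _ ha _ (hb i))
    ac := fun i => (h.A_anticomplete_C i).not_cadj (hd (.inl 0) (.inr (.inr i)) (by simp)) ha (hc i)
    bb := fun i j hij => (h.B_anticomplete_B i j hij).not_cadj
      (hd (.inr (.inl i)) (.inr (.inl j)) (by simpa using hij)) (hb i) (hb j)
    cc := fun i j => by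
      by_cases hij : i = j
      · exact Or.inl (by rw [hij])
      · exact Or.inr (h.C_complete_C i j hij _ (hc i) _ (hc j))
    bc := fun i => Or.inr (h.B_complete_C i _ (hb i) _ (hc i))
    bc_ne := fun i j hij => (h.B_anticomplete_C i j hij).not_cadj
      (hd (.inr (.inl i)) (.inr (.inr j)) (by simp)) (hb i) (hc j) }⟩

namespace IsVillaPartitionOn
variable {B C : Fin t → Set V} (h : G.IsVillaPartitionOn S t A B C)
include h

theorem cases {v : V} (hv : v ∈ S) : v ∈ A ∨ (∃ i, v ∈ B i) ∨ ∃ i, v ∈ C i := by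
  obtain ⟨k | i | i, hk⟩ := Set.mem_iUnion.1 (h.partition.2.symm ▸ hv)
  · exact Or.inl (by simpa using hk)
  · exact Or.inr (Or.inl ⟨i, hk⟩)
  · exact Or.inr (Or.inr ⟨i, hk⟩)

theorem exists_ne (i : Fin t) : ∃ j, i ≠ j := by
  have := h.three_le
  have : Nontrivial (Fin t) := Fin.nontrivial_iff_two_le.2 (by omega)
  obtain ⟨j, hj⟩ := _root_.exists_ne i
  exact ⟨j, hj.symm⟩

theorem not_cadj_A_C {i : Fin t} {x y : V} (hx : x ∈ A) (hy : y ∈ C i) : ¬ G.CAdj x y :=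
  (h.A_anticomplete_C i).not_cadj
    (h.partition.1 (i := .inl 0) (j := .inr (.inr i)) (by simp)) hx hy

theorem not_cadj_B_B {i j : Fin t} (hij : i ≠ j) {x y : V} (hx : x ∈ B i) (hy : y ∈ B j) :
    ¬ G.CAdj x y :=
  (h.B_anticomplete_B i j hij).not_cadj
    (h.partition.1 (i := .inr (.inl i)) (j := .inr (.inl j)) (by simpa using hij)) hx hy

theorem not_cadj_B_C {i j : Fin t} (hij : i ≠ j) {x y : V} (hx : x ∈ B i) (hy : y ∈ C j) :
    ¬ G.CAdj x y :=
  (h.B_anticomplete_C i j hij).not_cadj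
    (h.partition.1 (i := .inr (.inl i)) (j := .inr (.inr j)) (by simp)) hx hy

theorem exists_top (i : Fin t) : ∃ b ∈ B i, ∀ c ∈ C i, G.Adj b c := by
  obtain ⟨n, x, ⟨-, hx, -, hx0⟩, -⟩ := h.nested i
  exact ⟨x 0, hx ▸ Set.mem_range_self 0, fun c hc => Set.inter_eq_right.1 hx0 hc⟩

theorem exists_adj_C {i : Fin t} {v : V} (hv : v ∈ B i) : ∃ c ∈ C i, G.Adj v c := by
  obtain ⟨n, x, ⟨-, hx, hanti, -⟩, c, hc⟩ := h.nested i
  rw [← hx] at hv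
  obtain ⟨k, rfl⟩ := hv
  have := hanti (Fin.le_last k) hc
  exact ⟨c, this.2, this.1⟩

theorem exists_not_cadj {v : V} (hv : v ∈ S) : ∃ w, ¬ G.CAdj v w := by
  have i₀ : Fin t := ⟨0, by have := h.three_le; omega⟩
  rcases h.cases hv with hv | ⟨i, hv⟩ | ⟨i, hv⟩
  · obtain ⟨c, hc⟩ := h.nonempty_C i₀
    exact ⟨c, h.not_cadj_A_C hv hc⟩
  · obtain ⟨j, hij⟩ := h.exists_ne i
    obtain ⟨b, hb⟩ := h.nonempty_B j
    exact ⟨b, h.not_cadj_B_B hij hv hb⟩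
  · obtain ⟨a, ha⟩ := h.nonempty_A
    exact ⟨a, mt CAdj.symm (h.not_cadj_A_C ha hv)⟩

theorem exists_adj_adj {v : V} (hv : v ∈ S) : ∃ x y, G.Adj v x ∧ G.Adj v y ∧ ¬ G.CAdj x y := by
  have i₀ : Fin t := ⟨0, by have := h.three_le; omega⟩
  rcases h.cases hv with hv | ⟨i, hv⟩ | ⟨i, hv⟩
  · obtain ⟨j, hij⟩ := h.exists_ne i₀
    obtain ⟨b, hb⟩ := h.nonempty_B i₀
    obtain ⟨b', hb'⟩ := h.nonempty_B j
    exact ⟨b, b', h.A_complete_B _ _ hv _ hb, h.A_complete_B _ _ hv _ hb',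
      h.not_cadj_B_B hij hb hb'⟩
  · obtain ⟨a, ha⟩ := h.nonempty_A
    obtain ⟨c, hc, hvc⟩ := h.exists_adj_C hv
    exact ⟨a, c, (h.A_complete_B i _ ha _ hv).symm, hvc, h.not_cadj_A_C ha hc⟩
  · obtain ⟨j, hij⟩ := h.exists_ne i
    obtain ⟨b, hb, hbC⟩ := h.exists_top i
    obtain ⟨c, hc⟩ := h.nonempty_C j
    exact ⟨b, c, (hbC _ hv).symm, h.C_complete_C i j hij _ hv _ hc, h.not_cadj_B_C hij hb hc⟩

theorem nonempty_pent : Nonempty (Pent G (Fin 3)) := by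
  obtain ⟨a, ha⟩ := h.nonempty_A
  choose b hb hbC using h.exists_top
  choose c hc using h.nonempty_C
  let P : Pent G (Fin t) := {
    a := a
    b := b
    c := c
    ab := fun i => Or.inr (h.A_complete_B i _ ha _ (hb i))
    ac := fun i => h.not_cadj_A_C ha (hc i)
    bb := fun i j hij => h.not_cadj_B_B hij (hb i) (hb j)
    cc := fun i j => by
      by_cases hij : i = j
      · exact Or.inl (by rw [hij])
      · exact Or.inr (h.C_complete_C i j hij _ (hc i) _ (hc j))
    bc := fun i => Or.inr (hbC i _ (hc i))
    bc_ne := fun i j hij => h.not_cadj_B_C hij (hb i) (hc j) }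
  exact ⟨P.sub (Fin.castLE h.three_le) (Fin.castLE_injective _)⟩

end IsVillaPartitionOn

theorem mem_compl_union_or (F X Y : Set V) (v : V) :
    v ∈ (F ∪ X ∪ Y)ᶜ ∨ v ∈ F ∨ v ∈ X ∨ v ∈ Y := by
  simp only [Set.mem_compl_iff, Set.mem_union]
  tauto

theorem IsMansion.exists_not_cadj (h : G.IsMansion) (v : V) : ∃ w, ¬ G.CAdj v w := by
  obtain ⟨t, A, B, C, F, X, Y, h⟩ := h
  obtain ⟨j₀, -, -, hFB, -, -, -, -, -, hXC⟩ := h.exists_j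
  have hd : ∀ k l, k ≠ l → Disjoint ((Sum.elim ![A, F, X, Y] (Sum.elim B C)) k)
    ((Sum.elim ![A, F, X, Y] (Sum.elim B C)) l) := fun k l hkl => h.partition.1 hkl
  obtain ⟨a, ha⟩ := h.villa.nonempty_A
  obtain ⟨b, hb⟩ := h.villa.nonempty_B j₀
  obtain ⟨c, hc⟩ := h.villa.nonempty_C j₀
  rcases mem_compl_union_or F X Y v with hv | hv | hv | hv
  · exact h.villa.exists_not_cadj hv
  · exact ⟨b, hFB.not_cadj (hd (.inl 1) (.inr (.inl j₀)) (by simp)) hv hb⟩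
  · exact ⟨c, (hXC j₀).not_cadj (hd (.inl 2) (.inr (.inr j₀)) (by simp)) hv hc⟩
  · exact ⟨a, h.Y_anticomplete_A.not_cadj (hd (.inl 3) (.inl 0) (by simp)) hv ha⟩

theorem IsMansion.exists_adj_adj (h : G.IsMansion) (v : V) :
    ∃ x y, G.Adj v x ∧ G.Adj v y ∧ ¬ G.CAdj x y := by
  obtain ⟨t, A, B, C, F, X, Y, h⟩ := h
  obtain ⟨j₀, hFA, hF, hFB, hFC, -, -, hXB, -, -⟩ := h.exists_j
  have hd : ∀ k l, k ≠ l → Disjoint ((Sum.elim ![A, F, X, Y] (Sum.elim B C)) k)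
    ((Sum.elim ![A, F, X, Y] (Sum.elim B C)) l) := fun k l hkl => h.partition.1 hkl
  obtain ⟨f, hf⟩ := h.nonempty_F
  obtain ⟨b, hb⟩ := h.villa.nonempty_B j₀
  obtain ⟨c, hc⟩ := h.villa.nonempty_C j₀
  rcases mem_compl_union_or F X Y v with hv | hv | hv | hv
  · exact h.villa.exists_adj_adj hv
  · obtain ⟨a, ha⟩ := h.villa.nonempty_A
    obtain ⟨j, hj⟩ := h.villa.exists_ne j₀
    obtain ⟨c', hc'⟩ := h.villa.nonempty_C j
    exact ⟨a, c', hFA _ hv _ ha, (hF j hj.symm).2 _ hv _ hc', h.villa.not_cadj_A_C ha hc'⟩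
  · exact ⟨f, b, (h.F_complete_X _ hf _ hv).symm, hXB _ hv _ hb,
      hFB.not_cadj (hd (.inl 1) (.inr (.inl j₀)) (by simp)) hf hb⟩
  · exact ⟨f, c, (h.F_complete_Y _ hf _ hv).symm, h.Y_complete_C j₀ _ hv _ hc,
      hFC.not_cadj (hd (.inl 1) (.inr (.inr j₀)) (by simp)) hf hc⟩

theorem properties_of_isFiveBasket_or (h : G.IsFiveBasket ∨ G.IsVilla ∨ G.IsMansion) :
    G.PatternFree ∧ (∀ v, ∃ w, ¬ G.CAdj v w) ∧
      (∀ v, ∃ x y, G.Adj v x ∧ G.Adj v y ∧ ¬ G.CAdj x y) ∧ Nonempty (Pent G (Fin 3)) := by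
  rcases h with h | h | h
  · exact ⟨h.patternFree, h.exists_not_cadj, h.exists_adj_adj, h.nonempty_pent⟩
  · refine ⟨h.patternFree, ?_⟩
    obtain ⟨t, A, B, C, h⟩ := h
    exact ⟨fun v => h.exists_not_cadj (Set.mem_univ v), fun v => h.exists_adj_adj (Set.mem_univ v),
      h.nonempty_pent⟩
  · refine ⟨h.patternFree, h.exists_not_cadj, h.exists_adj_adj, ?_⟩
    obtain ⟨t, A, B, C, F, X, Y, h⟩ := h
    exact h.villa.nonempty_pent

/-! ### Universal vertices and anticomponents -/

/-- If `x` and `y` were in different components of the complement, with nonneighbours `x'` and `y'`,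
then `x, y, x', y'` would be an induced four-cycle of `G`. -/
theorem connected_compl (hG : G.PatternFree) (hu : ∀ v, ∃ w, ¬ G.CAdj v w) [Nonempty V] :
    Gᶜ.Connected := by
  have hadj : ∀ {x y}, ¬ G.CAdj x y → Gᶜ.Reachable x y := fun h =>
    ((compl_adj ..).2 ⟨ne_of_not_cadj h, not_adj_of_not_cadj h⟩).reachable
  refine ⟨fun x y => ?_⟩
  by_contra hxy
  obtain ⟨x', hx⟩ := hu x
  obtain ⟨y', hy⟩ := hu y
  have h1 : G.CAdj x y := by_contra fun h => hxy (hadj h)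
  have h2 : G.CAdj y x' := by_contra fun h => hxy ((hadj hx).trans (hadj h).symm)
  have h3 : G.CAdj x' y' := by_contra fun h => hxy (((hadj hx).trans (hadj h)).trans (hadj hy).symm)
  have h4 : G.CAdj y' x := by_contra fun h => hxy ((hadj h).symm.trans (hadj hy).symm)
  exact hG.c4 h1 h2 h3 h4 hx hy

theorem not_connected_compl_induce {T : Set V} {v : V} (hv : v ∈ T) (hT : T.Nontrivial)
    (hu : ∀ w, G.CAdj v w) : ¬ (G.induce T)ᶜ.Connected := by
  intro h
  have := Set.nontrivial_coe_sort.2 hT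
  obtain ⟨w, hw⟩ := h.preconnected.exists_adj_of_nontrivial ⟨v, hv⟩
  rw [compl_adj] at hw
  exact hw.2 ((hu w).adj fun h => hw.1 (Subtype.ext h))

theorem IsObtainedByAddingUniversal.cadj (h : G.IsObtainedByAddingUniversal S) {v : V}
    (hv : v ∉ S) (w : V) : G.CAdj v w := by
  by_cases hw : w ∈ S
  · exact Or.inr (h.2 v hv w hw)
  · by_cases hvw : v = w
    · exact Or.inl hvw
    · exact Or.inr (h.1 hv hw hvw)

/-- A universal vertex is isolated in the complement, so a nontrivial set whose complement graph is
connected contains no vertex outside `S`. -/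
theorem IsObtainedByAddingUniversal.isAnticomponent (h : G.IsObtainedByAddingUniversal S)
    (hS : S.Nontrivial) (hc : (G.induce S)ᶜ.Connected) :
    G.IsAnticomponent S ∧ ∀ T, G.IsAnticomponent T → T.Nontrivial → T = S := by
  have hsub : ∀ T : Set V, (G.induce T)ᶜ.Connected → T.Nontrivial → T ⊆ S := by
    intro T hT hT' v hv
    by_contra hvS
    exact not_connected_compl_induce hv hT' (h.cadj hvS) hT
  exact ⟨⟨hc, fun T hT hST => hsub T hT (hS.mono hST)⟩,
    fun T hT hT' => (hsub T hT.1 hT').antisymm (hT.2 hc (hsub T hT.1 hT'))⟩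

/-- Two distinct nonadjacent vertices induce a connected graph in the complement, so they lie in a
common nontrivial anticomponent, which must be `S`. -/
theorem isObtainedByAddingUniversal_of_anticomponent [Finite V]
    (hS : ∀ T, G.IsAnticomponent T → T.Nontrivial → T = S) :
    G.IsObtainedByAddingUniversal S := by
  have key : ∀ v ∉ S, ∀ w, G.CAdj v w := by
    intro v hv w
    by_contra hvw
    have hne := ne_of_not_cadj hvw
    have hadj : (G.induce {v, w})ᶜ.Adj ⟨v, by simp⟩ ⟨w, by simp⟩ := by
      simp [compl_adj, hne, not_adj_of_not_cadj hvw]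
    have hconn : (G.induce {v, w})ᶜ.Connected := by
      refine connected_iff_exists_forall_reachable _ |>.2 ⟨⟨v, by simp⟩, ?_⟩
      rintro ⟨x, rfl | rfl⟩
      · exact .refl _
      · exact hadj.reachable
    obtain ⟨T, hT, hTmax⟩ := (Set.toFinite {T : Set V | (G.induce T)ᶜ.Connected}).exists_le_maximal
      hconn
    have hvT : v ∈ T := hT (by simp)
    have hwT : w ∈ T := hT (by simp)
    exact hv (hS T hTmax ⟨v, hvT, w, hwT, hne⟩ ▸ hvT)
  refine ⟨fun v hv w hw hvw => (key v hv w).adj hvw, fun v hv w hw => (key v hv w).adj ?_⟩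
  rintro rfl
  exact hv hw

theorem IsObtainedByAddingUniversal.properties (h : G.IsObtainedByAddingUniversal S)
    (hG : (G.induce S).PatternFree)
    (hs : ∀ v, ∃ x y, (G.induce S).Adj v x ∧ (G.induce S).Adj v y ∧ ¬ (G.induce S).CAdj x y)
    (P : Pent (G.induce S) (Fin 3)) :
    G.PatternFree ∧ (pentagon 3).IsIndContained G ∧ ∀ v, ¬ G.IsSimplicialVertex v := by
  refine ⟨?_, ?_, fun v hv => ?_⟩
  · rintro H hH ⟨f, hf⟩
    have hmem : ∀ i < H.length, f i ∈ S := by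
      intro i hi
      -- No forbidden graph has a universal vertex, so an occurrence of one in `G` lies within `S`.
      obtain ⟨j, hj, hij⟩ := (by decide : ∀ H ∈ patterns, ∀ i < H.length, ∃ j < H.length,
        ¬ entry H i j = true) H hH i hi
      by_contra hS
      exact hij ((hf i hi j hj).1 (h.cadj hS _))
    refine hG H hH ⟨fun i => if hi : i < H.length then ⟨f i, hmem i hi⟩ else P.a,
      fun i hi j hj => ?_⟩
    simp only [cadj_induce, dif_pos hi, dif_pos hj]
    exact hf i hi j hj
  · exact (nonempty_pent_iff.1 ⟨P⟩).trans ⟨Embedding.induce S⟩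
  · by_cases hvS : v ∈ S
    · obtain ⟨x, y, hx, hy, hxy⟩ := hs ⟨v, hvS⟩
      exact not_adj_of_not_cadj hxy (hv hx hy fun h => ne_of_not_cadj hxy (Subtype.ext h))
    -- A vertex outside `S` is adjacent to the nonadjacent vertices `b 0` and `b 1`.
    · have hxy := P.bb 0 1 (by decide)
      exact not_adj_of_not_cadj hxy (hv (h.2 v hvS _ (P.b 0).2) (h.2 v hvS _ (P.b 1).2)
        fun h => ne_of_not_cadj hxy (Subtype.ext h))

end
end SimpleGraph

/-! ### The equivalence of (a), (b) and (c) -/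

theorem mainTheorem6 {V : Type*} [Finite V] (G : SimpleGraph V) :
    List.TFAE [
      -- (a)
      (SimpleGraph.IndFree SimpleGraph.twoP3 G ∧
        SimpleGraph.IndFree (SimpleGraph.cycleGraph 4) G ∧
        SimpleGraph.IndFree (SimpleGraph.cycleGraph 6) G ∧
        SimpleGraph.IndFree (SimpleGraph.cycleGraph 7) G ∧
        SimpleGraph.IndFree SimpleGraph.T0 G) ∧
      (SimpleGraph.pentagon 3).IsIndContained G ∧
      (∀ v : V, ¬ G.IsSimplicialVertex v),
      -- (b)
      ∃ S : Set V, (G.IsAnticomponent S ∧ S.Nontrivial) ∧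
        (∀ T : Set V, G.IsAnticomponent T → T.Nontrivial → T = S) ∧
        ((G.induce S).IsFiveBasket ∨ (G.induce S).IsVilla ∨ (G.induce S).IsMansion),
      -- (c)
      ∃ S : Set V, G.IsObtainedByAddingUniversal S ∧
        ((G.induce S).IsFiveBasket ∨ (G.induce S).IsVilla ∨ (G.induce S).IsMansion)
    ] := by
  tfae_have 1 → 3 := fun ⟨hG, hP, hs⟩ =>
    SimpleGraph.exists_isObtainedByAddingUniversal ((SimpleGraph.patternFree_iff G).2 hG) hs hP
  tfae_have 3 → 1 := by
    rintro ⟨S, hS, hQ⟩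
    obtain ⟨hG, -, hs, ⟨P⟩⟩ := SimpleGraph.properties_of_isFiveBasket_or hQ
    obtain ⟨hG', hP, hs'⟩ := hS.properties hG hs P
    exact ⟨(SimpleGraph.patternFree_iff G).1 hG', hP, hs'⟩
  tfae_have 3 → 2 := by
    rintro ⟨S, hS, hQ⟩
    obtain ⟨hG, hu, -, ⟨P⟩⟩ := SimpleGraph.properties_of_isFiveBasket_or hQ
    have hne : S.Nontrivial :=
      ⟨P.a, P.a.2, P.c 0, (P.c 0).2, fun h => SimpleGraph.ne_of_not_cadj (P.ac 0) (Subtype.ext h)⟩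
    have : Nonempty S := hne.nonempty.to_subtype
    obtain ⟨h1, h2⟩ := hS.isAnticomponent hne (SimpleGraph.connected_compl hG hu)
    exact ⟨S, ⟨h1, hne⟩, h2, hQ⟩
  tfae_have 2 → 3 := by
    rintro ⟨S, -, hS, hQ⟩
    exact ⟨S, SimpleGraph.isObtainedByAddingUniversal_of_anticomponent hS, hQ⟩
  tfae_finish
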